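/- **Conventions.** All locally convex spaces are real and Hausdorff. A map $f$ from an open subset $U$ of a locally convex space $X$ to a locally convex space $Y$ is $C^1$ if it is continuous, all directional derivatives $df(x)(h)=\lim_{t\to 0}\frac1t(f(x+th)-f(x))$ exist and $df\colon U\times X\to Y$ is continuous; it is $C^{n+1}$ if it is $C^1$ and $df$ is $C^n$, and smooth if it is $C^n$ for all $n$. On half spaces (and other convex sets with dense interior) one requires this on the interior together with continuous extension of the differentials. Manifolds (Hausdorff) and Lie groups modelled on locally convex spaces are defined with this notion of smoothness. A submanifold of a locally convex space $V$ is a subset $S$ for which there is a closed subspace $F\subseteq V$ such that each $s\in S$ lies in the domain $U$ of a chart $\varphi$ of $V$ with $\varphi(U\cap S)=\varphi(U)\cap F$. The spaces $C^\infty(X,E)$ of smooth functions on a finite-dimensional manifold $X$ with values in a locally convex space $E$ carry the smooth compact open topology (uniform convergence on compact sets of all derivatives in charts), and the space $\Omega^1(M,E)$ of smooth $E$-valued $1$-forms is topologized as a subspace of $C^\infty(TM,E)$. A Lie group $G$ with Lie algebra $\mathfrak g=T_{\mathbf 1}(G)$ is *regular* if for each $\xi\in C^\infty([0,1],\mathfrak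 g)$ there is a smooth curve $\gamma_\xi\colon[0,1]\to G$ with $\gamma_\xi(0)=\mathbf 1$ and $\gamma_\xi'(t)=\gamma_\xi(t).\xi(t)$, and the map $C^\infty([0,1],\mathfrak g)\to G$, $\xi\mapsto\gamma_\xi(1)$, is smooth. **Theorem.** Let $M$ be a connected finite-dimensional smooth manifold (possibly with boundary), $m_0\in M$, and let $K$ be a regular Lie group with Lie algebra $\mathfrak k$. Let $C^\infty(M,K)$ be the group of smooth maps $M\to K$ under pointwise multiplication, $C^\infty_*(M,K):=\{f\in C^\infty(M,K): f(m_0)=\mathbf 1\}$, and for $f\in C^\infty(M,K)$ let $\delta(f)=f^{-1}.df\in\Omega^1(M,\mathfrak k)$ be its left logarithmic derivative, i.e. $\delta(f)(v)=T(\lambda_{f(m)^{-1}})\,T_m(f)v$ for $v\in T_m(M)$, where $\lambda_g(x)=gx$. The map $\delta$ is injective on $C^\infty_*(M,K)$. Assume that $\delta(C^\infty_*(M,K))$ is a smooth submanifold of $\Omega^1(M,\mathfrak k)$. Endow $C^\infty_*(M,K)$ with the manifold structure for which $\delta\colon C^\infty_*(M,K)\to\delta(C^\infty_*(M,K))$ is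 a diffeomorphism, and $C^\infty(M,K)\cong K\ltimes C^\infty_*(M,K)$, $f\mapsto(f(m_0),f(m_0)^{-1}f)$, with the product manifold structure. Then: 1. For each smooth manifold $N$ modelled on a locally convex space, a map $f\colon N\times M\to K$ is smooth if and only if all the maps $f_n\colon M\to K$, $m\mapsto f(n,m)$, are smooth and the map $f^\vee\colon N\to C^\infty(M,K)$, $n\mapsto f_n$, is smooth. 2. $K$ acts smoothly on $C^\infty_*(M,K)$ by conjugation, $(k,f)\mapsto kfk^{-1}$, and $C^\infty(M,K)$ is a regular Lie group compatible with evaluations: all evaluation maps $\mathrm{ev}_m\colon C^\infty(M,K)\to K$, $f\mapsto f(m)$, are smooth, and the Lie algebra of $C^\infty(M,K)$ is the topological Lie algebra $C^\infty(M,\mathfrak k)$ with the pointwise bracket, in such a way that $T_{\mathbf 1}(\mathrm{ev}_m)\colon C^\infty(M,\mathfrak k)\to\mathfrak k$ is evaluation in $m$ for each $m\in M$. -/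

import Mathlib

open Set Filter Topology
open scoped Manifold ContDiff

noncomputable section

namespace LC

universe u v

/-! ### Calculus in locally convex spaces -/

/-- Hausdorff real locally convex spaces. -/
class IsLCS (E : Type*) [AddCommGroup E] [Module ℝ E] [TopologicalSpace E] : Prop extends
    IsTopologicalAddGroup E, ContinuousSMul ℝ E, LocallyConvexSpace ℝ E, T2Space E

section Calculus

/-- `w` is the derivative of `f` at `x` in the direction `h`. -/
def HasDirDeriv {E F : Type*} [AddCommGroup E] [Module ℝ E]
    [AddCommGroup F] [Module ℝ F] [TopologicalSpace F] (f : E → F) (x h : E) (w : F) : Prop :=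
  Tendsto (fun t : ℝ => t⁻¹ • (f (x + t • h) - f x)) (𝓝[≠] 0) (𝓝 w)

/-- The derivative of `f` at `x` in the direction `h` (meaningful if it exists). -/
def dirDeriv {E F : Type*} [AddCommGroup E] [Module ℝ E]
    [AddCommGroup F] [Module ℝ F] [TopologicalSpace F] (f : E → F) (x h : E) : F :=
  limUnder (𝓝[≠] 0) (fun t : ℝ => t⁻¹ • (f (x + t • h) - f x))

/-- `D` is the differential `df : U × E → F` of `f` on `U`, where `U` is a set with dense
interior: it is continuous on `U × E` and given by the directional derivatives at the interior
points.  (If `U` is open, this says that `f` has all directional derivatives on `U`, that they are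
given by `D`, and that `D` is continuous.) -/
structure IsDifferentialOn {E F : Type*} [AddCommGroup E] [Module ℝ E] [TopologicalSpace E]
    [AddCommGroup F] [Module ℝ F] [TopologicalSpace F]
    (f : E → F) (U : Set E) (D : E × E → F) : Prop where
  continuousOn : ContinuousOn D (U ×ˢ univ)
  hasDirDeriv : ∀ x ∈ interior U, ∀ h : E, HasDirDeriv f x h (D (x, h))

/-- `f` is a `C^n`-map on the set `U` (which has dense interior). -/
def CDiffOn {F : Type v} [AddCommGroup F] [Module ℝ F] [TopologicalSpace F] :
    (n : ℕ) → {E : Type u} → [AddCommGroup E] → [Module ℝ E] → [TopologicalSpace E] →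
      (E → F) → Set E → Prop
  | 0, _, _, _, _, f, U => ContinuousOn f U
  | n + 1, E, _, _, _, f, U => ContinuousOn f U ∧
      ∃ D : E × E → F, IsDifferentialOn f U D ∧ CDiffOn n D (U ×ˢ univ)

variable {E : Type u} [AddCommGroup E] [Module ℝ E] [TopologicalSpace E]
  {F : Type v} [AddCommGroup F] [Module ℝ F] [TopologicalSpace F]

/-- `f` is smooth on the set `U` (which has dense interior). -/
def CInfOn (f : E → F) (U : Set E) : Prop := ∀ n : ℕ, CDiffOn n f U

/-- The differential of a `C^1`-map `f` on `U`, as a function: the continuous extension of the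
directional derivatives from `interior U` to `U`. -/
def extDiff (f : E → F) (U : Set E) : E × E → F :=
  extendFrom (interior U ×ˢ univ) (fun p => dirDeriv f p.1 p.2)

/-- The higher differentials `d^k f (x; h_0, …, h_{k-1})` of a smooth map `f` on `U`. -/
def iterDiff (U : Set E) (f : E → F) : (k : ℕ) → E → (Fin k → E) → F
  | 0, x, _ => f x
  | k + 1, x, h => extDiff (fun y => iterDiff U f k y (Fin.tail h)) U (x, h 0)

/-! Linear combinations of smooth maps are smooth. -/

theorem CDiffOn.add [ContinuousAdd F] (n : ℕ) {E : Type u} [AddCommGroup E] [Module ℝ E]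
    [TopologicalSpace E] {f g : E → F} {U : Set E} (hf : CDiffOn n f U) (hg : CDiffOn n g U) :
    CDiffOn n (f + g) U := by
  induction n generalizing E with
  | zero => exact ContinuousOn.add (f := f) (g := g) hf hg
  | succ n ih =>
    obtain ⟨hf, D, hD, hDn⟩ := hf
    obtain ⟨hg, D', hD', hDn'⟩ := hg
    refine ⟨hf.add hg, D + D', ⟨hD.continuousOn.add hD'.continuousOn, ?_⟩, ih hDn hDn'⟩
    intro x hx h
    refine ((hD.hasDirDeriv x hx h).add (hD'.hasDirDeriv x hx h)).congr ?_
    intro t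
    rw [← smul_add]
    simp only [Pi.add_apply]
    congr 1
    abel

theorem CDiffOn.const_smul [ContinuousConstSMul ℝ F] (n : ℕ) {E : Type u} [AddCommGroup E]
    [Module ℝ E] [TopologicalSpace E] {f : E → F} {U : Set E} (c : ℝ) (hf : CDiffOn n f U) :
    CDiffOn n (c • f) U := by
  induction n generalizing E with
  | zero => exact ContinuousOn.const_smul (g := f) hf c
  | succ n ih =>
    obtain ⟨hf, D, hD, hDn⟩ := hf
    refine ⟨hf.const_smul c, c • D, ⟨hD.continuousOn.const_smul c, ?_⟩, ih hDn⟩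
    intro x hx h
    refine ((hD.hasDirDeriv x hx h).const_smul c).congr ?_
    intro t
    simp only [Pi.smul_apply]
    rw [smul_comm, smul_sub]

theorem CDiffOn.zero (n : ℕ) {E : Type u} [AddCommGroup E] [Module ℝ E]
    [TopologicalSpace E] {U : Set E} : CDiffOn n (0 : E → F) U := by
  induction n generalizing E with
  | zero => exact continuousOn_const (c := (0 : F))
  | succ n ih =>
    refine ⟨continuousOn_const (c := (0 : F)), 0, ⟨continuousOn_const (c := (0 : F)), ?_⟩, ih⟩
    intro x _ h
    simpa [HasDirDeriv] using tendsto_const_nhds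

end Calculus

/-! ### Manifolds modelled on locally convex spaces -/

/-- A model for manifolds with boundary or corners: `H` is embedded as a convex set with non-empty
interior (for instance a half space, a quadrant, or everything) in the vector space `E`. -/
structure LCModel (E : Type*) [AddCommGroup E] [Module ℝ E] [TopologicalSpace E]
    (H : Type*) [TopologicalSpace H] where
  toFun : H → E
  invFun : E → H
  left_inv : ∀ x, invFun (toFun x) = x
  continuous_toFun : Continuous toFun
  continuous_invFun : Continuous invFun
  convex_range : Convex ℝ (range toFun)
  nonempty_interior : (interior (range toFun)).Nonempty

/-- The model without boundary. -/
def LCModel.self (E : Type*) [AddCommGroup E] [Module ℝ E] [TopologicalSpace E] :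
    LCModel E E where
  toFun := id
  invFun := id
  left_inv _ := rfl
  continuous_toFun := continuous_id
  continuous_invFun := continuous_id
  convex_range := by rw [range_id]; exact convex_univ
  nonempty_interior := by rw [range_id, interior_univ]; exact univ_nonempty

/-- Mathlib's models with corners. -/
def LCModel.ofCorners {E : Type*} [NormedAddCommGroup E] [NormedSpace ℝ E]
    {H : Type*} [TopologicalSpace H] (I : ModelWithCorners ℝ E H) : LCModel E H where
  toFun := I
  invFun := I.symm
  left_inv := I.left_inv
  continuous_toFun := I.continuous
  continuous_invFun := I.continuous_symm
  convex_range := I.convex_range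
  nonempty_interior := I.nonempty_interior

/-- The model for the product of two manifolds. -/
def LCModel.prod {E : Type*} [AddCommGroup E] [Module ℝ E] [TopologicalSpace E]
    {H : Type*} [TopologicalSpace H]
    {E' : Type*} [AddCommGroup E'] [Module ℝ E'] [TopologicalSpace E']
    {H' : Type*} [TopologicalSpace H'] (J : LCModel E H) (J' : LCModel E' H') :
    LCModel (E × E') (ModelProd H H') where
  toFun p := (J.toFun p.1, J'.toFun p.2)
  invFun q := (J.invFun q.1, J'.invFun q.2)
  left_inv p := by
    obtain ⟨p₁, p₂⟩ := p
    simp [J.left_inv, J'.left_inv]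
  continuous_toFun :=
    (J.continuous_toFun.comp continuous_fst).prodMk (J'.continuous_toFun.comp continuous_snd)
  continuous_invFun :=
    (J.continuous_invFun.comp continuous_fst).prodMk (J'.continuous_invFun.comp continuous_snd)
  convex_range := by
    have h : range (fun p : ModelProd H H' => (J.toFun p.1, J'.toFun p.2))
        = range J.toFun ×ˢ range J'.toFun := range_prodMap (m₁ := J.toFun) (m₂ := J'.toFun)
    rw [h]
    exact J.convex_range.prod J'.convex_range
  nonempty_interior := by
    have h : range (fun p : ModelProd H H' => (J.toFun p.1, J'.toFun p.2))
        = range J.toFun ×ˢ range J'.toFun := range_prodMap (m₁ := J.toFun) (m₂ := J'.toFun)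
    rw [h, interior_prod_eq]
    exact J.nonempty_interior.prod J'.nonempty_interior

/-- The unit interval `[0,1]` as a manifold with boundary: it is its own model, with the inclusion
into `ℝ` as the only chart. -/
def LCModel.unitInterval : LCModel ℝ (Icc (0 : ℝ) 1) where
  toFun := Subtype.val
  invFun := projIcc 0 1 zero_le_one
  left_inv x := projIcc_val zero_le_one x
  continuous_toFun := continuous_subtype_val
  continuous_invFun := continuous_projIcc
  convex_range := by rw [Subtype.range_val]; exact convex_Icc 0 1
  nonempty_interior := by
    rw [Subtype.range_val, interior_Icc]
    exact nonempty_Ioo.2 zero_lt_one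

section Manifold

variable {E : Type*} [AddCommGroup E] [Module ℝ E] [TopologicalSpace E]
  {H : Type*} [TopologicalSpace H]
  {E' : Type*} [AddCommGroup E'] [Module ℝ E'] [TopologicalSpace E']
  {H' : Type*} [TopologicalSpace H']

/-- Smooth maps between manifolds: continuous maps that are smooth in all charts. -/
structure Smooth (J : LCModel E H) (J' : LCModel E' H') {X Y : Type*}
    [TopologicalSpace X] [ChartedSpace H X] [TopologicalSpace Y] [ChartedSpace H' Y]
    (f : X → Y) : Prop where
  continuous : Continuous f
  smooth_charts : ∀ φ ∈ atlas H X, ∀ ψ ∈ atlas H' Y,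
    CInfOn (fun x => J'.toFun (ψ (f (φ.symm (J.invFun x)))))
      (J.toFun '' (φ.target ∩ φ.symm ⁻¹' (f ⁻¹' ψ.source)))

/-- `X` with its atlas is a (Hausdorff) smooth manifold: the changes of charts are smooth. -/
structure IsMfd (J : LCModel E H) (X : Type*) [TopologicalSpace X] [ChartedSpace H X] : Prop where
  t2 : T2Space X
  compatible : ∀ φ ∈ atlas H X, ∀ ψ ∈ atlas H X,
    CInfOn (fun x => J.toFun (ψ (φ.symm (J.invFun x))))
      (J.toFun '' (φ.target ∩ φ.symm ⁻¹' ψ.source))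

/-- The type `C^∞(X,Y)` of smooth maps between manifolds. -/
@[ext]
structure SmoothMap (J : LCModel E H) (J' : LCModel E' H') (X Y : Type*)
    [TopologicalSpace X] [ChartedSpace H X] [TopologicalSpace Y] [ChartedSpace H' Y] where
  toFun : X → Y
  smooth : Smooth J J' toFun

instance (J : LCModel E H) (J' : LCModel E' H') (X Y : Type*)
    [TopologicalSpace X] [ChartedSpace H X] [TopologicalSpace Y] [ChartedSpace H' Y] :
    CoeFun (SmoothMap J J' X Y) (fun _ => X → Y) := ⟨SmoothMap.toFun⟩

end Manifold

/-! ### The locally convex space `C^∞(X,F)` -/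

section SmoothFun

variable {E : Type*} [AddCommGroup E] [Module ℝ E] [TopologicalSpace E]
  {H : Type*} [TopologicalSpace H] (J : LCModel E H)
  (X : Type*) [TopologicalSpace X] [ChartedSpace H X]
  (F : Type*) [AddCommGroup F] [Module ℝ F] [TopologicalSpace F]

/-- The smooth `F`-valued functions on `X`, as a subspace of the space of all functions. -/
def smoothSubmodule [IsLCS F] : Submodule ℝ (X → F) where
  carrier := {f | Smooth J (LCModel.self F) f}
  add_mem' := by
    intro f g hf hg
    refine ⟨hf.continuous.add hg.continuous, fun φ hφ ψ hψ => ?_⟩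
    have h1 := hf.smooth_charts φ hφ ψ hψ
    have h2 := hg.smooth_charts φ hφ ψ hψ
    obtain rfl : ψ = OpenPartialHomeomorph.refl F := by simpa using hψ
    intro n
    exact (h1 n).add n (h2 n)
  zero_mem' := by
    refine ⟨continuous_const (y := (0 : F)), fun φ hφ ψ hψ => ?_⟩
    obtain rfl : ψ = OpenPartialHomeomorph.refl F := by simpa using hψ
    intro n
    exact CDiffOn.zero n
  smul_mem' := by
    intro c f hf
    refine ⟨hf.continuous.const_smul c, fun φ hφ ψ hψ => ?_⟩
    have h1 := hf.smooth_charts φ hφ ψ hψ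
    obtain rfl : ψ = OpenPartialHomeomorph.refl F := by simpa using hψ
    intro n
    exact (h1 n).const_smul n c

/-- The vector space `C^∞(X,F)` of smooth functions with values in a locally convex space.
(A separate type, so that it does not inherit the topology of pointwise convergence.) -/
def SmoothFun [IsLCS F] : Type _ := ↥(smoothSubmodule J X F)

instance [IsLCS F] : AddCommGroup (SmoothFun J X F) :=
  inferInstanceAs (AddCommGroup ↥(smoothSubmodule J X F))

instance [IsLCS F] : Module ℝ (SmoothFun J X F) :=
  inferInstanceAs (Module ℝ ↥(smoothSubmodule J X F))

instance [IsLCS F] : CoeFun (SmoothFun J X F) (fun _ => X → F) := ⟨Subtype.val⟩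

/-- The smooth compact open topology on `C^∞(X,F)`: the coarsest topology for which all the maps
`f ↦ d^k (f ∘ φ⁻¹)`, with `φ` a chart and `k ∈ ℕ`, are continuous into the space of continuous
functions on `φ(U) × E^k` with the compact open topology. -/
instance [IsLCS F] : TopologicalSpace (SmoothFun J X F) :=
  TopologicalSpace.generateFrom
    {W | ∃ φ ∈ atlas H X, ∃ (k : ℕ) (C : Set (E × (Fin k → E))) (O : Set F),
      IsCompact C ∧ C ⊆ (J.toFun '' φ.target) ×ˢ univ ∧ IsOpen O ∧
      W = {f : SmoothFun J X F | ∀ z ∈ C,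
        iterDiff (J.toFun '' φ.target) (fun x => f (φ.symm (J.invFun x))) k z.1 z.2 ∈ O}}

end SmoothFun

/-! ### Lie groups

The Lie algebra of a Lie group `G` modelled on `E` is `T_1 G`, which is identified with `E` by the
differential of the preferred chart at `1`. -/

section LieGroup

variable (E : Type*) [AddCommGroup E] [Module ℝ E] [TopologicalSpace E]
  (G : Type*) [Group G] [TopologicalSpace G] [ChartedSpace E G]

/-- `G` is a Lie group modelled on `E`. -/
structure IsLieGrp : Prop where
  isMfd : IsMfd (LCModel.self E) G
  smooth_mul : Smooth ((LCModel.self E).prod (LCModel.self E)) (LCModel.self E)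
    (fun p : G × G => p.1 * p.2)
  smooth_inv : Smooth (LCModel.self E) (LCModel.self E) (fun g : G => g⁻¹)

/-- The left invariant vector field `x_l` of `G` with `x_l(1) = x`, in the preferred chart at `1`:
its value at the point with coordinates `p` is the derivative of left multiplication with that
point, at `1` and in the direction `x`. -/
def leftInvField (x : E) (p : E) : E :=
  dirDeriv (fun q => chartAt E (1 : G) ((chartAt E (1 : G)).symm p * (chartAt E (1 : G)).symm q))
    (chartAt E (1 : G) 1) x

/-- The Lie bracket of `T_1 G`: the value at `1` of the bracket of vector fields `[x_l, y_l]`,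
computed in the preferred chart at `1`. -/
def lieBracket (x y : E) : E :=
  dirDeriv (leftInvField E G y) (chartAt E (1 : G) 1) x -
    dirDeriv (leftInvField E G x) (chartAt E (1 : G) 1) y

variable {E G} in
/-- `γ' (t) = γ(t).ξ(t)` for all `t ∈ [0,1]`, i.e. the derivative of `s ↦ γ(t)⁻¹ γ(s)` at `s = t`
is `ξ(t)`. -/
def IsEvolution (ξ : Icc (0 : ℝ) 1 → E) (γ : Icc (0 : ℝ) 1 → G) : Prop :=
  ∀ t : Icc (0 : ℝ) 1,
    Tendsto (fun s : Icc (0 : ℝ) 1 => ((s : ℝ) - t)⁻¹ •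
      (chartAt E (1 : G) ((γ t)⁻¹ * γ s) - chartAt E (1 : G) 1)) (𝓝[≠] t) (𝓝 (ξ t))

/-- `G` is regular: each `ξ ∈ C^∞([0,1], 𝔤)` is the left logarithmic derivative of a smooth curve
`γ_ξ : [0,1] → G` starting in `1`, and `evol : C^∞([0,1], 𝔤) → G`, `ξ ↦ γ_ξ(1)` is smooth. -/
def IsRegularGrp [IsLCS E] : Prop :=
  ∃ evol : SmoothFun LCModel.unitInterval (Icc (0 : ℝ) 1) E → G,
    Smooth (LCModel.self (SmoothFun LCModel.unitInterval (Icc (0 : ℝ) 1) E)) (LCModel.self E)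
      evol ∧
    ∀ ξ : SmoothFun LCModel.unitInterval (Icc (0 : ℝ) 1) E,
      ∃ γ : Icc (0 : ℝ) 1 → G, Smooth LCModel.unitInterval (LCModel.self E) γ ∧
      γ 0 = 1 ∧ IsEvolution ξ γ ∧ evol ξ = γ 1

end LieGroup

/-! ### Submanifolds of locally convex spaces and transport of structure -/

section Submanifold

variable {V : Type*} [AddCommGroup V] [Module ℝ V] [TopologicalSpace V]

/-- `φ` is a chart of the manifold `V` that maps `S` to `F`. -/
structure IsAdaptedChart (S : Set V) (F : Submodule ℝ V) (φ : OpenPartialHomeomorph V V) :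
    Prop where
  smooth : CInfOn φ φ.source
  smooth_symm : CInfOn φ.symm φ.target
  image_eq : φ '' (φ.source ∩ S) = φ.target ∩ F

/-- `S` is a submanifold of `V`, modelled on the closed subspace `F`. -/
structure IsSubmanifold (S : Set V) (F : Submodule ℝ V) : Prop where
  isClosed : IsClosed (F : Set V)
  exists_chart : ∀ s ∈ S, ∃ φ : OpenPartialHomeomorph V V, IsAdaptedChart S F φ ∧ s ∈ φ.source

theorem IsAdaptedChart.map_mem {S : Set V} {F : Submodule ℝ V} {φ : OpenPartialHomeomorph V V}
    (hφ : IsAdaptedChart S F φ) {s : V} (hs : s ∈ S) (hs' : s ∈ φ.source) : φ s ∈ F :=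
  (hφ.image_eq.subset ⟨s, ⟨hs', hs⟩, rfl⟩).2

theorem IsAdaptedChart.symm_mem {S : Set V} {F : Submodule ℝ V} {φ : OpenPartialHomeomorph V V}
    (hφ : IsAdaptedChart S F φ) {x : V} (hx : x ∈ F) (hx' : x ∈ φ.target) : φ.symm x ∈ S := by
  obtain ⟨s, ⟨hs', hs⟩, rfl⟩ := hφ.image_eq.superset ⟨hx', hx⟩
  rwa [φ.left_inv hs']

open Classical in
/-- The chart of the submanifold `S` obtained by restricting an adapted chart of `V`. -/
def IsAdaptedChart.restr {S : Set V} {F : Submodule ℝ V} {φ : OpenPartialHomeomorph V V}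
    (hφ : IsAdaptedChart S F φ) (s₀ : S) : OpenPartialHomeomorph S F where
  toFun s := if h : φ s ∈ F then ⟨φ s, h⟩ else 0
  invFun x := if h : φ.symm x ∈ S then ⟨φ.symm x, h⟩ else s₀
  source := {s | (s : V) ∈ φ.source}
  target := {x | (x : V) ∈ φ.target}
  map_source' s hs := by
    simp only [mem_ofPred_eq] at hs ⊢
    rw [dif_pos (hφ.map_mem s.2 hs)]
    exact φ.map_source hs
  map_target' x hx := by
    simp only [mem_ofPred_eq] at hx ⊢
    rw [dif_pos (hφ.symm_mem x.2 hx)]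
    exact φ.map_target hx
  left_inv' s hs := by
    simp only [mem_ofPred_eq] at hs
    have h1 := hφ.map_mem s.2 hs
    apply Subtype.ext
    simp [h1, φ.left_inv hs]
  right_inv' x hx := by
    simp only [mem_ofPred_eq] at hx
    have h1 := hφ.symm_mem x.2 hx
    apply Subtype.ext
    simp [h1, φ.right_inv hx]
  open_source := φ.open_source.preimage continuous_subtype_val
  open_target := φ.open_target.preimage continuous_subtype_val
  continuousOn_toFun := by
    rw [Topology.IsInducing.subtypeVal.continuousOn_iff]
    refine (φ.continuousOn.comp continuous_subtype_val.continuousOn (fun s hs => hs)).congr ?_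
    intro s hs
    have h1 := hφ.map_mem s.2 hs
    simp [h1]
  continuousOn_invFun := by
    rw [Topology.IsInducing.subtypeVal.continuousOn_iff]
    refine (φ.symm.continuousOn.comp continuous_subtype_val.continuousOn (fun x hx => hx)).congr ?_
    intro x hx
    have h1 := hφ.symm_mem x.2 hx
    simp [h1]

/-- The manifold structure of a submanifold: its charts are the restrictions of all adapted
charts. -/
@[reducible]
def IsSubmanifold.chartedSpace {S : Set V} {F : Submodule ℝ V} (hS : IsSubmanifold S F) :
    ChartedSpace F S where
  atlas := {c : OpenPartialHomeomorph S F | ∃ φ : OpenPartialHomeomorph V V, IsAdaptedChart S F φ ∧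
    c.source = {s : S | (s : V) ∈ φ.source} ∧ ∀ s ∈ c.source, (c s : V) = φ s}
  chartAt s := (hS.exists_chart s s.2).choose_spec.1.restr s
  mem_chart_source s := (hS.exists_chart s s.2).choose_spec.2
  chart_mem_atlas s := by
    refine ⟨_, (hS.exists_chart s s.2).choose_spec.1, rfl, fun x hx => ?_⟩
    have h1 := (hS.exists_chart s s.2).choose_spec.1.map_mem x.2 hx
    simp [IsAdaptedChart.restr, h1]

/-- The charts on `X` for which the bijection `e : X ≃ Y` is a diffeomorphism; the topology on `X`
is the one for which `e` is a homeomorphism. -/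
@[reducible]
def transportCharts {X Y H : Type*} [TopologicalSpace H] [tY : TopologicalSpace Y]
    [ChartedSpace H Y] (e : X ≃ Y) : @ChartedSpace H _ X (tY.induced e) :=
  letI : TopologicalSpace X := tY.induced e
  let e' : X ≃ₜ Y := e.toHomeomorphOfIsInducing ⟨rfl⟩
  { atlas := {c | ∃ φ ∈ atlas H Y, c = e'.toOpenPartialHomeomorph.trans φ}
    chartAt := fun x => e'.toOpenPartialHomeomorph.trans (chartAt H (e x))
    mem_chart_source := fun x => by
      simp [e']
    chart_mem_atlas := fun x => ⟨_, chart_mem_atlas H (e x), rfl⟩ }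

/-- The product manifold of two manifolds without boundary. -/
@[reducible]
def prodCharts (E F X Y : Type*) [TopologicalSpace E] [TopologicalSpace F]
    [TopologicalSpace X] [TopologicalSpace Y] [ChartedSpace E X] [ChartedSpace F Y] :
    ChartedSpace (E × F) (X × Y) :=
  prodChartedSpace E X F Y

end Submanifold

/-! ### One-forms and the logarithmic derivative -/

section LogDeriv

variable {EM : Type*} [NormedAddCommGroup EM] [NormedSpace ℝ EM]
  {HM : Type*} [TopologicalSpace HM] (I : ModelWithCorners ℝ EM HM)
  (M : Type*) [TopologicalSpace M] [ChartedSpace HM M]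

/-- The space `Ω^1(M,𝔨)` of smooth `𝔨`-valued `1`-forms, as the subspace of `C^∞(TM,𝔨)` that
consists of the functions that are linear on each tangent space; it carries the topology induced
by `C^∞(TM,𝔨)`. -/
def OneForm [IsManifold I ∞ M] (𝔨 : Type*) [AddCommGroup 𝔨] [Module ℝ 𝔨] [TopologicalSpace 𝔨]
    [IsLCS 𝔨] :
    Submodule ℝ (SmoothFun (LCModel.ofCorners I.tangent) (TangentBundle I M) 𝔨) where
  carrier := {α | ∀ m : M, IsLinearMap ℝ (fun v : TangentSpace I m => α ⟨m, v⟩)}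
  add_mem' := by
    intro α β hα hβ m
    refine ⟨fun v w => ?_, fun c v => ?_⟩
    · change α _ + β _ = (α _ + β _) + (α _ + β _)
      rw [(hα m).map_add, (hβ m).map_add]
      abel
    · change α _ + β _ = c • (α _ + β _)
      rw [(hα m).map_smul, (hβ m).map_smul, smul_add]
  zero_mem' := by
    intro m
    refine ⟨fun v w => ?_, fun c v => ?_⟩
    · change (0 : 𝔨) = 0 + 0
      simp
    · change (0 : 𝔨) = c • 0
      simp
  smul_mem' := by
    intro c α hα m
    refine ⟨fun v w => ?_, fun d v => ?_⟩
    · change c • α _ = c • α _ + c • α _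
      rw [(hα m).map_add, smul_add]
    · change c • α _ = d • c • α _
      rw [(hα m).map_smul, smul_comm]

variable {M}
variable {𝔨 : Type*} [AddCommGroup 𝔨] [Module ℝ 𝔨] [TopologicalSpace 𝔨]
  {K : Type*} [Group K] [TopologicalSpace K] [ChartedSpace 𝔨 K]

variable (𝔨) in
/-- The left logarithmic derivative `δ(f) = f⁻¹.df` of a map `f : M → K`: for `v ∈ T_m M`,
`δ(f)(v) ∈ T_1 K` is the derivative at `m` in the direction `v` of the map
`x ↦ f(m)⁻¹ f(x)`, which maps `m` to `1`.  As usual, `T_m M` is identified with the model space by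
the preferred chart at `m`. -/
def leftLogDeriv (f : M → K) (v : TangentBundle I M) : 𝔨 :=
  extDiff (fun y => chartAt 𝔨 (1 : K) ((f v.proj)⁻¹ * f ((extChartAt I v.proj).symm y)))
    (range I) (extChartAt I v.proj v.proj, v.snd)

variable (M 𝔨 K) in
/-- The set `C^∞(M,K)`. -/
abbrev MapGroup : Type _ := SmoothMap (LCModel.ofCorners I) (LCModel.self 𝔨) M K

variable (𝔨 K) in
/-- The set `C^∞_*(M,K)` of smooth maps `f` with `f(m₀) = 1`. -/
def BasedMap (m₀ : M) : Type _ := {f : MapGroup I M 𝔨 K // f m₀ = 1}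

variable (𝔨 K) in
/-- The set `δ(C^∞_*(M,K))`. -/
def leftLogDerivImage [IsManifold I ∞ M] [IsLCS 𝔨] (m₀ : M) : Set (OneForm I M 𝔨) :=
  {α | ∃ f : BasedMap I 𝔨 K m₀, ∀ v : TangentBundle I M, α.1 v = leftLogDeriv I 𝔨 f.1 v}

variable (M 𝔨 K) in
/-- The Lie group structure on `G` (a group of maps from `M` to `K`, with evaluations `ev`) is
compatible with evaluations: all the evaluation maps `ev_m : G → K` are smooth, and the Lie
algebra of `G` is the topological Lie algebra `C^∞(M,𝔨)` with the pointwise bracket in such a way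
that `T_1(ev_m)` is the evaluation `C^∞(M,𝔨) → 𝔨` in `m`. -/
structure CompatibleWithEvaluations [IsLCS 𝔨] (EG : Type*) [AddCommGroup EG] [Module ℝ EG]
    [TopologicalSpace EG] (G : Type*) [Group G] [TopologicalSpace G] [ChartedSpace EG G]
    (ev : G → M → K) : Prop where
  smooth_ev : ∀ m, Smooth (LCModel.self EG) (LCModel.self 𝔨) (fun g => ev g m)
  lieAlgebra : ∃ Ψ : EG ≃L[ℝ] SmoothFun (LCModel.ofCorners I) M 𝔨,
    (∀ (x : EG) (m : M),
      HasDirDeriv (fun y => chartAt 𝔨 (1 : K) (ev ((chartAt EG (1 : G)).symm y) m))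
        (chartAt EG (1 : G) 1) x (Ψ x m)) ∧
    ∀ (x y : EG) (m : M), Ψ (lieBracket EG G x y) m = lieBracket 𝔨 K (Ψ x m) (Ψ y m)

end LogDeriv

end LC

end

open LC

open Set Filter Topology
open scoped Manifold ContDiff

noncomputable section

namespace LC

universe u v w

/-! The map `f ↦ (f m₀, δ(f))` identifies `C^∞(M,K)` with `K × δ(C^∞_*(M,K))`, because `δ` ignores
left translations by constants. As the second factor is a submanifold of `Ω^1(M,𝔨)`, a map into
`C^∞(M,K)` is smooth if and only if its value at `m₀` and its logarithmic derivative are smooth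
(`IsAdaptedAtlas.smAt_iff`, `IsMapMfd.smAt_iff`). The first assertion, an exponential law, follows
from this criterion, and the rest follows from the exponential law.

If `f : N × M → K` is smooth, then `(n, v) ↦ δ(f_n)(v)` is smooth on charts of `N × TM`. The
exponential law for vector valued functions then shows that `n ↦ δ(f_n)` is smooth (`smAt_logForm`).
Conversely, along a segment from `x` to `y` in a convex chart domain, `f_n` solves an evolution
equation whose right hand side depends smoothly on `δ(f_n)`, `x` and `y`; here the evaluation of
smooth functions on the finite-dimensional manifold `TM` has to be smooth. Regularity of `K` yields
`f_n(y) = f_n(x) Θ(δ(f_n), x, y)` with `Θ` smooth (`exists_local_evolution`). Connectedness of `M`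
carries smoothness in `n` from `m₀` to all points, and the local formula then gives joint smoothness
(`smAt_uncurry_of_logForm`). Uniqueness of evolutions along segments also shows that `δ` is
injective on based maps (`eq_of_leftLogDeriv_eq`).

Evaluation, multiplication, inversion and conjugation are now smooth because their uncurried forms
are. The Lie algebra is computed by differentiating the evaluations. A tangent vector killed by all
of them is killed by the differential of `f ↦ (f m₀, δ(f))`, by Schwarz' theorem, hence is zero. The
pointwise exponential map supplies the inverse of `EG → C^∞(M,𝔨)`, where `EG` is the model space.
Brackets agree since evaluations are homomorphisms (`mdiff_lieBracket`). Regularity is obtained by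
solving the evolution equation pointwise in `M` and currying the solution (`IsMapMfd.isRegularGrp`).

The underlying calculus lives on relatively open subsets of convex sets with interior points, so
that boundaries need no separate treatment. Its engine is `IsDifferentialOn.strict`: difference
quotients converge even if base point, direction and step vary simultaneously. It rests on the mean
value theorem and Hahn-Banach separation, so no completeness is needed. Linearity of differentials,
the chain rule and both exponential laws are applications. -/

set_option linter.unusedSectionVars false

/-! ### Permanence properties of locally convex spaces. -/

section Instances

instance instIsLCSProd {E F : Type*} [AddCommGroup E] [Module ℝ E] [TopologicalSpace E] [IsLCS E]
    [AddCommGroup F] [Module ℝ F] [TopologicalSpace F] [IsLCS F] : IsLCS (E × F) where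

instance instIsLCSOfNormed {E : Type*} [NormedAddCommGroup E] [NormedSpace ℝ E] : IsLCS E where

instance instIsLCSSubmodule {E : Type*} [AddCommGroup E] [Module ℝ E] [TopologicalSpace E]
    [IsLCS E] (S : Submodule ℝ E) : IsLCS S where

instance instIsLCSPi {ι : Type*} [Finite ι] {E : Type*} [AddCommGroup E] [Module ℝ E]
    [TopologicalSpace E] [IsLCS E] : IsLCS (ι → E) where
  toLocallyConvexSpace := by
    rw [Pi.topologicalSpace]
    exact LocallyConvexSpace.iInf fun i =>
      LocallyConvexSpace.induced (LinearMap.proj (R := ℝ) (φ := fun _ : ι => E) i)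

end Instances

/-! ### Domains of differentiability. -/

section Domains

variable {E : Type*} [AddCommGroup E] [Module ℝ E] [TopologicalSpace E]
  {E' : Type*} [AddCommGroup E'] [Module ℝ E'] [TopologicalSpace E']

/-- Relatively open subsets of convex sets with non-empty interior. -/
def Good (U : Set E) : Prop :=
  ∃ C O : Set E, Convex ℝ C ∧ (interior C).Nonempty ∧ IsOpen O ∧ U = C ∩ O

theorem good_of_isOpen {O : Set E} (hO : IsOpen O) : Good O :=
  ⟨univ, O, convex_univ, by rw [interior_univ]; exact univ_nonempty, hO, by simp⟩

theorem good_univ : Good (univ : Set E) := good_of_isOpen isOpen_univ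

theorem Good.prod {U : Set E} {V : Set E'} (hU : Good U) (hV : Good V) : Good (U ×ˢ V) := by
  obtain ⟨C, O, hC, hi, hO, rfl⟩ := hU
  obtain ⟨C', O', hC', hi', hO', rfl⟩ := hV
  refine ⟨C ×ˢ C', O ×ˢ O', hC.prod hC', ?_, hO.prod hO', prod_inter_prod.symm⟩
  rw [interior_prod_eq]
  exact hi.prod hi'

/-- A convex set with interior points lies in the closure of its interior, and intersecting with an
open set preserves this. Hence a continuous differential is determined at boundary points by its
values at interior points. -/
theorem Good.subset_closure_interior [IsTopologicalAddGroup E] [ContinuousSMul ℝ E] {U : Set E}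
    (hU : Good U) : U ⊆ closure (interior U) := by
  obtain ⟨C, O, hC, hi, hO, rfl⟩ := hU
  rintro x ⟨hxC, hxO⟩
  rw [interior_inter, hO.interior_eq]
  have h1 : x ∈ closure (interior C) := by
    rw [hC.closure_interior_eq_closure_of_nonempty_interior hi]
    exact subset_closure hxC
  rw [inter_comm]
  exact hO.inter_closure ⟨hxO, h1⟩

end Domains

/-! ### Mean value theorem and strict differentiability. -/

section MeanValue

variable {E : Type*} [AddCommGroup E] [Module ℝ E] [TopologicalSpace E]
  {F : Type*} [AddCommGroup F] [Module ℝ F] [TopologicalSpace F]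

theorem HasDirDeriv.dirDeriv_eq [T2Space F] {f : E → F} {x h : E} {a : F}
    (H : HasDirDeriv f x h a) : dirDeriv f x h = a :=
  Filter.Tendsto.limUnder_eq H

theorem HasDirDeriv.unique [T2Space F] {f : E → F} {x h : E} {a b : F}
    (H : HasDirDeriv f x h a) (H' : HasDirDeriv f x h b) : a = b :=
  tendsto_nhds_unique H H'

/-- A functional separating `g 1 - g 0` from `A` would contradict the scalar mean value theorem.
This replaces the integral form of the mean value theorem, which would need completeness. -/
theorem sub_mem_of_hasDirDeriv_mem [IsLCS F] {g g' : ℝ → F} {A : Set F} (hA : Convex ℝ A)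
    (hcl : IsClosed A) (hc : ContinuousOn g (Icc 0 1))
    (hd : ∀ s ∈ Ioo (0 : ℝ) 1, HasDirDeriv g s (1 : ℝ) (g' s))
    (hm : ∀ s ∈ Ioo (0 : ℝ) 1, g' s ∈ A) : g 1 - g 0 ∈ A := by
  by_contra hn
  obtain ⟨l, u, h1, h2⟩ := geometric_hahn_banach_closed_point hA hcl hn
  obtain ⟨c, hc1, hc2⟩ := exists_hasDerivAt_eq_slope (fun s => l (g s)) (fun s => l (g' s))
    zero_lt_one (l.continuous.comp_continuousOn hc) (fun s hs => by
      rw [hasDerivAt_iff_tendsto_slope_zero]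
      refine ((l.continuous.tendsto _).comp (hd s hs)).congr fun t => ?_
      simp)
  have h3 := h1 _ (hm c hc1)
  rw [map_sub] at h2
  simp only [sub_zero, div_one] at hc2
  linarith

theorem exists_closed_convex_nhds [IsLCS F] {a : F} {W : Set F} (hW : W ∈ 𝓝 a) :
    ∃ W' ∈ 𝓝 a, Convex ℝ W' ∧ IsClosed W' ∧ W' ⊆ W := by
  obtain ⟨S, ⟨hS, hScl⟩, hSW⟩ := (closed_nhds_basis a).mem_iff.1 hW
  obtain ⟨T, ⟨hT, hTc⟩, hTS⟩ := (LocallyConvexSpace.convex_basis (𝕜 := ℝ) a).mem_iff.1 hS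
  exact ⟨closure T, mem_of_superset hT subset_closure, hTc.closure, isClosed_closure,
    (closure_minimal hTS hScl).trans hSW⟩

/-- A line segment in the domain of a `C^1`-map, at whose interior points the map is
differentiable. -/
theorem quotient_mem_of_segment_interior [IsLCS E] [IsLCS F] {f : E → F} {U : Set E}
    {D : E × E → F} (hc : ContinuousOn f U) (hD : IsDifferentialOn f U D) {A : Set F}
    (hA : Convex ℝ A) (hcl : IsClosed A) {x h : E} {t : ℝ} (ht : t ≠ 0)
    (hseg : ∀ s ∈ Icc (0 : ℝ) 1, x + (s * t) • h ∈ interior U)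
    (hm : ∀ s ∈ Icc (0 : ℝ) 1, D (x + (s * t) • h, h) ∈ A) :
    t⁻¹ • (f (x + t • h) - f x) ∈ A := by
  have key := sub_mem_of_hasDirDeriv_mem (g := fun s => t⁻¹ • f (x + (s * t) • h))
    (g' := fun s => D (x + (s * t) • h, h)) hA hcl ?_ ?_ (fun s hs => hm s (Ioo_subset_Icc_self hs))
  · simpa [smul_sub] using key
  · refine ContinuousOn.const_smul (hc.comp (Continuous.continuousOn (by fun_prop)) ?_) _
    exact fun s hs => interior_subset (hseg s hs)
  · intro s hs
    have h1 := hD.hasDirDeriv _ (hseg s (Ioo_subset_Icc_self hs)) h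
    unfold HasDirDeriv at h1 ⊢
    have h2 : Tendsto (fun r : ℝ => r * t) (𝓝[≠] 0) (𝓝[≠] 0) := by
      refine tendsto_nhdsWithin_of_tendsto_nhds_of_eventually_within _ ?_ ?_
      · have : Tendsto (fun r : ℝ => r * t) (𝓝 0) (𝓝 (0 * t)) := Continuous.tendsto (by fun_prop) _
        rw [zero_mul] at this
        exact this.mono_left nhdsWithin_le_nhds
      · filter_upwards [self_mem_nhdsWithin] with r hr
        exact mul_ne_zero hr ht
    refine (h1.comp h2).congr fun r => ?_
    simp only [Function.comp, smul_eq_mul, mul_one, add_mul, add_smul, mul_inv, ← smul_sub,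
      smul_smul, add_assoc]

/-- The difference quotient lies in a closed convex neighbourhood of `D (x, h)` as soon as `D` does
so along the segment. If the segment touches the boundary, it is first shrunk towards an interior
point `p` of the convex set `C`. -/
theorem IsDifferentialOn.strict [IsLCS E] [IsLCS F] {f : E → F} {U : Set E} {D : E × E → F}
    (hU : Good U) (hc : ContinuousOn f U) (hD : IsDifferentialOn f U D) {x h : E} (hx : x ∈ U)
    {ι : Type*} {l : Filter ι} {a b : ι → E} {t : ι → ℝ} (ha : Tendsto a l (𝓝 x))
    (hb : Tendsto b l (𝓝 h)) (ht : Tendsto t l (𝓝 0)) (haU : ∀ᶠ i in l, a i ∈ U)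
    (hbU : ∀ᶠ i in l, a i + t i • b i ∈ U) (ht0 : ∀ᶠ i in l, t i ≠ 0) :
    Tendsto (fun i => (t i)⁻¹ • (f (a i + t i • b i) - f (a i))) l (𝓝 (D (x, h))) := by
  obtain ⟨C, O, hC, ⟨p, hp⟩, hO, rfl⟩ := hU
  intro W hW
  obtain ⟨A, hA, hAc, hAcl, hAW⟩ := exists_closed_convex_nhds hW
  rw [Filter.mem_map]
  have h1 : D ⁻¹' A ∈ 𝓝[(C ∩ O) ×ˢ univ] (x, h) := hD.continuousOn (x, h) ⟨hx, mem_univ _⟩ hA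
  rw [nhdsWithin_prod_eq, nhdsWithin_univ, Filter.mem_prod_iff] at h1
  obtain ⟨P, hP, B, hB, hPB⟩ := h1
  obtain ⟨P', hP', hPP'⟩ := mem_nhdsWithin_iff_exists_mem_nhds_inter.1 hP
  obtain ⟨Q, ⟨hQ, hQc⟩, hQP⟩ := (LocallyConvexSpace.convex_basis (𝕜 := ℝ) x).mem_iff.1
    (inter_mem hP' (hO.mem_nhds hx.2))
  have hsum : Tendsto (fun i => a i + t i • b i) l (𝓝 x) := by
    simpa using ha.add (ht.smul hb)
  filter_upwards [ha (interior_mem_nhds.2 hQ), hsum (interior_mem_nhds.2 hQ),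
    hb (interior_mem_nhds.2 hB), haU, hbU, ht0] with i hi1 hi2 hi3 hi4 hi5 hi6
  apply hAW
  -- push the segment into the interior
  set y := a i + t i • b i with hy
  have hlim : Tendsto (fun ε : ℝ => (t i)⁻¹ • (f (y + ε • (p - y)) - f (a i + ε • (p - a i))))
      (𝓝[>] 0) (𝓝 ((t i)⁻¹ • (f y - f (a i)))) := by
    have aux : ∀ z ∈ C ∩ O, Tendsto (fun ε : ℝ => f (z + ε • (p - z))) (𝓝[>] 0) (𝓝 (f z)) := by
      intro z hz
      refine (hc z hz).tendsto.comp (tendsto_nhdsWithin_iff.2 ⟨?_, ?_⟩)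
      · have : Tendsto (fun ε : ℝ => z + ε • (p - z)) (𝓝 0) (𝓝 (z + (0 : ℝ) • (p - z))) :=
          Continuous.tendsto (by fun_prop) _
        simp only [zero_smul, add_zero] at this
        exact this.mono_left nhdsWithin_le_nhds
      · have : Tendsto (fun ε : ℝ => z + ε • (p - z)) (𝓝 0) (𝓝 (z + (0 : ℝ) • (p - z))) :=
          Continuous.tendsto (by fun_prop) _
        simp only [zero_smul, add_zero] at this
        filter_upwards [this.mono_left nhdsWithin_le_nhds (hO.mem_nhds hz.2),
          Ioc_mem_nhdsGT (zero_lt_one' ℝ)] with ε h1 h2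
        exact ⟨interior_subset (hC.add_smul_sub_mem_interior hz.1 hp h2), h1⟩
    exact ((aux y hi5).sub (aux (a i) hi4)).const_smul _
  -- Since `A` is closed, it suffices to treat the shrunken segments for small `ε > 0`.
  refine hAcl.mem_of_tendsto hlim ?_
  have e1 : ∀ z ∈ interior Q, ∀ᶠ ε : ℝ in 𝓝[>] 0, z + ε • (p - z) ∈ interior Q := by
    intro z hz
    have : Tendsto (fun ε : ℝ => z + ε • (p - z)) (𝓝 0) (𝓝 (z + (0 : ℝ) • (p - z))) :=
      Continuous.tendsto (by fun_prop) _
    simp only [zero_smul, add_zero] at this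
    exact this.mono_left nhdsWithin_le_nhds (isOpen_interior.mem_nhds hz)
  have e2 : ∀ᶠ ε : ℝ in 𝓝[>] 0, (1 - ε) • b i ∈ interior B := by
    have : Tendsto (fun ε : ℝ => (1 - ε) • b i) (𝓝 0) (𝓝 ((1 - (0 : ℝ)) • b i)) :=
      Continuous.tendsto (by fun_prop) _
    simp only [sub_zero, one_smul] at this
    exact this.mono_left nhdsWithin_le_nhds (isOpen_interior.mem_nhds hi3)
  filter_upwards [e1 _ hi1, e1 _ hi2, e2, Ioo_mem_nhdsGT (zero_lt_one' ℝ)] with ε h1 h2 h3 h4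
  have hε : 0 < 1 - ε := by linarith [h4.2]
  -- The homothety with centre `p` and ratio `1 - ε` maps the segment from `a i` to `y` into the
  -- interior of `C` and multiplies its direction `b i` by `1 - ε`.
  have hseg : ∀ s ∈ Icc (0 : ℝ) 1,
      (a i + ε • (p - a i)) + (s * t i) • ((1 - ε) • b i) ∈ interior C ∩ Q := by
    intro s hs
    have hx1 := hC.add_smul_sub_mem_interior hi4.1 hp ⟨h4.1, h4.2.le⟩
    have hx2 := hC.add_smul_sub_mem_interior hi5.1 hp ⟨h4.1, h4.2.le⟩
    have e : (a i + ε • (p - a i)) + (s * t i) • ((1 - ε) • b i)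
        = (a i + ε • (p - a i)) + s • ((y + ε • (p - y)) - (a i + ε • (p - a i))) := by
      rw [hy]; module
    rw [e]
    exact ⟨hC.interior.add_smul_sub_mem hx1 hx2 hs,
      hQc.add_smul_sub_mem (interior_subset h1) (interior_subset h2) hs⟩
  have hint : interior (C ∩ O) = interior C ∩ O := by rw [interior_inter, hO.interior_eq]
  have key := quotient_mem_of_segment_interior hc hD hAc hAcl hi6
    (x := a i + ε • (p - a i)) (h := (1 - ε) • b i)
    (fun s hs => by rw [hint]; exact ⟨(hseg s hs).1, (hQP (hseg s hs).2).2⟩)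
    (fun s hs => hPB (mk_mem_prod (hPP' ⟨(hQP (hseg s hs).2).1,
      interior_subset (hseg s hs).1, (hQP (hseg s hs).2).2⟩) (interior_subset h3)))
  have e : (a i + ε • (p - a i)) + t i • ((1 - ε) • b i) = y + ε • (p - y) := by rw [hy]; module
  rwa [e] at key

end MeanValue

/-! ### Uniqueness, locality and linearity of the differential. -/

section Differential

variable {E : Type*} [AddCommGroup E] [Module ℝ E] [TopologicalSpace E]
  {F : Type*} [AddCommGroup F] [Module ℝ F] [TopologicalSpace F]
  {f g : E → F} {U V : Set E} {D D' : E × E → F}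

theorem HasDirDeriv.congr_of_eventuallyEq [ContinuousAdd E] [ContinuousSMul ℝ E] {x h : E} {a : F}
    (H : HasDirDeriv f x h a) (hfg : f =ᶠ[𝓝 x] g) : HasDirDeriv g x h a := by
  have h1 : Tendsto (fun t : ℝ => x + t • h) (𝓝[≠] 0) (𝓝 x) := by
    have : Tendsto (fun t : ℝ => x + t • h) (𝓝 0) (𝓝 (x + (0 : ℝ) • h)) :=
      Continuous.tendsto (by fun_prop) _
    simp only [zero_smul, add_zero] at this
    exact this.mono_left nhdsWithin_le_nhds
  refine Tendsto.congr' ?_ H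
  filter_upwards [h1.eventually hfg] with t ht
  rw [ht, hfg.eq_of_nhds]

theorem IsDifferentialOn.congr [ContinuousAdd E] [ContinuousSMul ℝ E]
    (hD : IsDifferentialOn f U D) (hfg : EqOn f g U)
    (hDD : EqOn D D' (U ×ˢ univ)) : IsDifferentialOn g U D' := by
  refine ⟨hD.continuousOn.congr hDD.symm, fun x hx h => ?_⟩
  rw [← hDD (mk_mem_prod (interior_subset hx) (mem_univ h))]
  exact (hD.hasDirDeriv x hx h).congr_of_eventuallyEq
    (hfg.eventuallyEq_of_mem (mem_interior_iff_mem_nhds.1 hx))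

theorem IsDifferentialOn.mono (hD : IsDifferentialOn f U D) (hV : V ⊆ U) :
    IsDifferentialOn f V D :=
  ⟨hD.continuousOn.mono (prod_mono hV Subset.rfl),
    fun x hx h => hD.hasDirDeriv x (interior_mono hV hx) h⟩

variable [IsLCS E] [IsLCS F]

/-- Near a point of `O` the interiors of `U` and of `U ∩ O` coincide, so the limit that defines
`extDiff` sees only `D`. Thus `extDiff` can be computed on arbitrarily small neighbourhoods. -/
theorem IsDifferentialOn.extDiff_eq_of_inter_open (hU : Good U) {O : Set E} (hO : IsOpen O)
    (hD : IsDifferentialOn f (U ∩ O) D) {x : E} (hx : x ∈ U) (hxO : x ∈ O) (h : E) :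
    extDiff f U (x, h) = D (x, h) := by
  have hint : interior (U ∩ O) = interior U ∩ O := by rw [interior_inter, hO.interior_eq]
  apply extendFrom_eq
  · rw [closure_prod_eq, closure_univ]
    exact ⟨hU.subset_closure_interior hx, mem_univ _⟩
  · have h1 : 𝓝[interior U ×ˢ univ] (x, h) = 𝓝[(interior U ∩ O) ×ˢ univ] (x, h) := by
      rw [nhdsWithin_prod_eq, nhdsWithin_prod_eq, nhdsWithin_inter_of_mem' (s := interior U)]
      exact nhdsWithin_le_nhds (hO.mem_nhds hxO)
    rw [h1]
    have h2 := (hD.continuousOn (x, h) ⟨⟨hx, hxO⟩, mem_univ _⟩).tendsto.mono_left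
      (nhdsWithin_mono _ (prod_mono (interior_subset (s := U ∩ O)) (Subset.refl univ)))
    rw [hint] at h2
    refine h2.congr' ?_
    filter_upwards [self_mem_nhdsWithin] with p hp
    exact (hD.hasDirDeriv p.1 (hint ▸ hp.1) p.2).dirDeriv_eq.symm

theorem IsDifferentialOn.extDiff_eq (hU : Good U) (hD : IsDifferentialOn f U D) {x : E}
    (hx : x ∈ U) (h : E) : extDiff f U (x, h) = D (x, h) := by
  rw [← inter_univ U] at hD
  exact hD.extDiff_eq_of_inter_open hU isOpen_univ hx (mem_univ x) h

/-- At interior points, use strict differentiability with step `t * c`; the general case follows by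
continuity and density of the interior. -/
theorem IsDifferentialOn.map_smul (hU : Good U) (hc : ContinuousOn f U)
    (hD : IsDifferentialOn f U D) {x : E} (hx : x ∈ U) (c : ℝ) (h : E) :
    D (x, c • h) = c • D (x, h) := by
  have hcl : IsClosed {y : E × F × F | y.2.1 = c • y.2.2} :=
    isClosed_eq (by fun_prop) (by fun_prop)
  have aux : ∀ y ∈ interior U, D (y, c • h) = c • D (y, h) := by
    intro y hy
    -- The case `c = 0` is separate because the steps `t * c` must be non-zero.
    rcases eq_or_ne c 0 with rfl | hc0
    · have h1 := hD.hasDirDeriv y hy ((0 : ℝ) • h)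
      simp only [zero_smul] at h1 ⊢
      refine h1.unique ?_
      simp [HasDirDeriv]
    · have hyU := interior_subset hy
      have ev : ∀ᶠ t : ℝ in 𝓝[≠] 0, y + t • (c • h) ∈ U := by
        have : Tendsto (fun t : ℝ => y + t • (c • h)) (𝓝 0) (𝓝 (y + (0 : ℝ) • (c • h))) :=
          Continuous.tendsto (by fun_prop) _
        simp only [zero_smul, add_zero] at this
        exact this.mono_left nhdsWithin_le_nhds (mem_interior_iff_mem_nhds.1 hy)
      have t0 : Tendsto (fun t : ℝ => t * c) (𝓝[≠] 0) (𝓝 0) := by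
        have : Tendsto (fun t : ℝ => t * c) (𝓝 0) (𝓝 (0 * c)) := Continuous.tendsto (by fun_prop) _
        rw [zero_mul] at this
        exact this.mono_left nhdsWithin_le_nhds
      have h2 := hD.strict hU hc hyU (a := fun _ : ℝ => y) (b := fun _ => h)
        (t := fun t => t * c) tendsto_const_nhds tendsto_const_nhds t0 (Eventually.of_forall
          fun _ => hyU) (ev.mono fun t ht => by simpa [mul_smul] using ht)
          (by filter_upwards [self_mem_nhdsWithin] with t ht using mul_ne_zero ht hc0)
      refine (hD.hasDirDeriv y hy (c • h)).unique ((h2.const_smul c).congr fun t => ?_)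
      rw [smul_smul, mul_inv, mul_comm t⁻¹, ← mul_assoc, mul_inv_cancel₀ hc0, one_mul, mul_smul]
  have hcont : ContinuousOn (fun y => D (y, c • h) - c • D (y, h)) U := by
    have h1 : ∀ k : E, ContinuousOn (fun y => D (y, k)) U := fun k =>
      hD.continuousOn.comp (f := fun y => (y, k)) (by fun_prop) (fun y hy => ⟨hy, mem_univ _⟩)
    exact (h1 _).sub ((h1 _).const_smul c)
  have h3 := closure_minimal (t := {y : F | y = 0}) (s := {0}) (by simp) isClosed_singleton
  have h4 : ContinuousWithinAt (fun y => D (y, c • h) - c • D (y, h)) (interior U) x :=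
    (hcont x hx).mono interior_subset
  have h5 := h4.mem_closure_image (hU.subset_closure_interior hx)
  have h6 : (fun y => D (y, c • h) - c • D (y, h)) '' interior U ⊆ {0} := by
    rintro _ ⟨y, hy, rfl⟩
    simp [aux y hy]
  have h7 := closure_mono h6 h5
  rw [closure_singleton] at h7
  exact sub_eq_zero.1 h7

theorem IsDifferentialOn.map_add (hU : Good U) (hc : ContinuousOn f U)
    (hD : IsDifferentialOn f U D) {x : E} (hx : x ∈ U) (h k : E) :
    D (x, h + k) = D (x, h) + D (x, k) := by
  have aux : ∀ y ∈ interior U, D (y, h + k) = D (y, h) + D (y, k) := by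
    intro y hy
    have hyU := interior_subset hy
    have t1 : ∀ v : E, Tendsto (fun t : ℝ => y + t • v) (𝓝[≠] 0) (𝓝 y) := fun v => by
      have : Tendsto (fun t : ℝ => y + t • v) (𝓝 0) (𝓝 (y + (0 : ℝ) • v)) :=
        Continuous.tendsto (by fun_prop) _
      simp only [zero_smul, add_zero] at this
      exact this.mono_left nhdsWithin_le_nhds
    have ev : ∀ v : E, ∀ᶠ t : ℝ in 𝓝[≠] 0, y + t • v ∈ U := fun v =>
      t1 v (mem_interior_iff_mem_nhds.1 hy)
    -- The increment along `h + k` is split at `y + t • h`; the second half has a moving base point,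
    -- which strict differentiability permits.
    have h2 := hD.strict hU hc hyU (a := fun t : ℝ => y + t • h) (b := fun _ => k)
      (t := fun t => t) (t1 h) tendsto_const_nhds (tendsto_id.mono_left nhdsWithin_le_nhds) (ev h)
      ((ev (h + k)).mono fun t ht => by rwa [smul_add, ← add_assoc] at ht) self_mem_nhdsWithin
    refine (hD.hasDirDeriv y hy (h + k)).unique
      (((hD.hasDirDeriv y hy h).add h2).congr fun t => ?_)
    rw [← smul_add, smul_add t, ← add_assoc]
    congr 1
    abel
  have h1 : ∀ k : E, ContinuousOn (fun y => D (y, k)) U := fun k =>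
    hD.continuousOn.comp (f := fun y => (y, k)) (by fun_prop) (fun y hy => ⟨hy, mem_univ _⟩)
  have hcont : ContinuousOn (fun y => D (y, h + k) - (D (y, h) + D (y, k))) U :=
    (h1 _).sub ((h1 _).add (h1 _))
  have h5 := ((hcont x hx).mono interior_subset).mem_closure_image (hU.subset_closure_interior hx)
  have h6 : (fun y => D (y, h + k) - (D (y, h) + D (y, k))) '' interior U ⊆ {0} := by
    rintro _ ⟨y, hy, rfl⟩
    simp [aux y hy]
  have h7 := closure_mono h6 h5
  rw [closure_singleton] at h7
  exact sub_eq_zero.1 h7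

theorem IsDifferentialOn.map_zero (hU : Good U) (hc : ContinuousOn f U)
    (hD : IsDifferentialOn f U D) {x : E} (hx : x ∈ U) : D (x, 0) = 0 := by
  simpa using hD.map_smul hU hc hx 0 0

end Differential

/-! ### Maps of class `C^n`: locality, products and compositions. -/

section CDiff

variable {F : Type v} [AddCommGroup F] [Module ℝ F] [TopologicalSpace F]

theorem CDiffOn.continuousOn {n : ℕ} {E : Type u} [AddCommGroup E] [Module ℝ E]
    [TopologicalSpace E] {f : E → F} {U : Set E} (hf : CDiffOn n f U) : ContinuousOn f U := by
  cases n with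
  | zero => exact hf
  | succ n => exact hf.1

theorem CDiffOn.congr (n : ℕ) {E : Type u} [AddCommGroup E] [Module ℝ E]
    [TopologicalSpace E] [ContinuousAdd E] [ContinuousSMul ℝ E] {f g : E → F} {U : Set E}
    (hf : CDiffOn n f U) (hfg : EqOn f g U) : CDiffOn n g U := by
  cases n with
  | zero => exact ContinuousOn.congr hf hfg.symm
  | succ n =>
    obtain ⟨hc, D, hD, hDn⟩ := hf
    exact ⟨hc.congr hfg.symm, D, hD.congr hfg fun _ _ => rfl, hDn⟩

theorem CDiffOn.mono (n : ℕ) {E : Type u} [AddCommGroup E] [Module ℝ E]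
    [TopologicalSpace E] {f : E → F} {U V : Set E} (hf : CDiffOn n f U) (hV : V ⊆ U) :
    CDiffOn n f V := by
  induction n generalizing E with
  | zero => exact ContinuousOn.mono hf hV
  | succ n ih =>
    obtain ⟨hc, D, hD, hDn⟩ := hf
    exact ⟨hc.mono hV, D, hD.mono hV, ih hDn (prod_mono hV Subset.rfl)⟩

theorem CDiffOn.of_succ (n : ℕ) {E : Type u} [AddCommGroup E] [Module ℝ E]
    [TopologicalSpace E] {f : E → F} {U : Set E} (hf : CDiffOn (n + 1) f U) : CDiffOn n f U := by
  induction n generalizing E with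
  | zero => exact hf.1
  | succ n ih =>
    obtain ⟨hc, D, hD, hDn⟩ := hf
    exact ⟨hc, D, hD, ih hDn⟩

/-- The local differentials all agree with `extDiff f U`, which is therefore a global differential.
It is of class `C^n` by the induction hypothesis. -/
theorem CDiffOn.of_local [IsLCS F] (n : ℕ) {E : Type u} [AddCommGroup E] [Module ℝ E]
    [TopologicalSpace E] [IsLCS E] {f : E → F} {U : Set E} (hU : Good U)
    (h : ∀ x ∈ U, ∃ O, IsOpen O ∧ x ∈ O ∧ CDiffOn n f (U ∩ O)) : CDiffOn n f U := by
  induction n generalizing E with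
  | zero =>
    intro x hx
    obtain ⟨O, hO, hxO, hf⟩ := h x hx
    exact (hf x ⟨hx, hxO⟩).mono_of_mem_nhdsWithin (inter_mem_nhdsWithin _ (hO.mem_nhds hxO))
  | succ n ih =>
    have hloc : ∀ x ∈ U, ∃ O, IsOpen O ∧ x ∈ O ∧ ContinuousOn f (U ∩ O) ∧
        IsDifferentialOn f (U ∩ O) (extDiff f U) ∧
        CDiffOn n (extDiff f U) ((U ×ˢ univ) ∩ (O ×ˢ univ)) := by
      intro x hx
      obtain ⟨O, hO, hxO, hc, D, hD, hDn⟩ := h x hx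
      have he : EqOn D (extDiff f U) ((U ∩ O) ×ˢ univ) := by
        rintro ⟨y, k⟩ ⟨⟨hy, hyO⟩, -⟩
        exact (hD.extDiff_eq_of_inter_open hU hO hy hyO k).symm
      refine ⟨O, hO, hxO, hc, hD.congr (fun _ _ => rfl) he, ?_⟩
      rw [prod_inter_prod, univ_inter]
      exact hDn.congr n he
    refine ⟨?_, extDiff f U, ⟨?_, ?_⟩, ih (hU.prod good_univ) ?_⟩
    · intro x hx
      obtain ⟨O, hO, hxO, hf, -⟩ := hloc x hx
      exact (hf x ⟨hx, hxO⟩).mono_of_mem_nhdsWithin (inter_mem_nhdsWithin _ (hO.mem_nhds hxO))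
    · rintro ⟨x, k⟩ ⟨hx, -⟩
      obtain ⟨O, hO, hxO, -, hf, -⟩ := hloc x hx
      refine (hf.continuousOn (x, k) ⟨⟨hx, hxO⟩, mem_univ _⟩).mono_of_mem_nhdsWithin ?_
      rw [show (U ∩ O) ×ˢ (univ : Set E) = (U ×ˢ univ) ∩ (O ×ˢ univ) by
        rw [prod_inter_prod, univ_inter]]
      exact inter_mem_nhdsWithin _ ((hO.prod isOpen_univ).mem_nhds ⟨hxO, mem_univ _⟩)
    · intro x hx k
      obtain ⟨O, hO, hxO, -, hf, -⟩ := hloc x (interior_subset hx)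
      exact hf.hasDirDeriv x (by rw [interior_inter, hO.interior_eq]; exact ⟨hx, hxO⟩) k
    · rintro ⟨x, k⟩ ⟨hx, -⟩
      obtain ⟨O, hO, hxO, -, -, hf⟩ := hloc x hx
      exact ⟨O ×ˢ univ, hO.prod isOpen_univ, ⟨hxO, mem_univ _⟩, hf⟩

/-- Linear inner maps come before the general chain rule, whose induction step needs the composition
of `f` with the projection `(x, h) ↦ x`. -/
theorem CDiffOn.comp_clm [IsLCS F] (n : ℕ) {E : Type u} [AddCommGroup E] [Module ℝ E]
    [TopologicalSpace E] [IsLCS E] {E' : Type w} [AddCommGroup E'] [Module ℝ E']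
    [TopologicalSpace E'] [IsLCS E'] {f : E → F} {V : Set E} (hV : Good V) (hf : CDiffOn n f V)
    (L : E' →L[ℝ] E) {U : Set E'} (hL : MapsTo L U V) : CDiffOn n (fun x => f (L x)) U := by
  induction n generalizing E E' with
  | zero => exact ContinuousOn.comp hf L.continuous.continuousOn hL
  | succ n ih =>
    obtain ⟨hc, D, hD, hDn⟩ := hf
    have hm : MapsTo (L.prodMap L) (U ×ˢ (univ : Set E')) (V ×ˢ (univ : Set E)) :=
      fun p hp => ⟨hL hp.1, mem_univ _⟩
    refine ⟨hc.comp L.continuous.continuousOn hL, fun p => D (L.prodMap L p), ⟨?_, ?_⟩,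
      ih (hV.prod good_univ) hDn (L.prodMap L) hm⟩
    · exact hD.continuousOn.comp (L.prodMap L).continuous.continuousOn hm
    · intro x hx h
      have h1 : Tendsto (fun t : ℝ => x + t • h) (𝓝[≠] 0) (𝓝 x) := by
        have : Tendsto (fun t : ℝ => x + t • h) (𝓝 0) (𝓝 (x + (0 : ℝ) • h)) :=
          Continuous.tendsto (by fun_prop) _
        simp only [zero_smul, add_zero] at this
        exact this.mono_left nhdsWithin_le_nhds
      have h2 := hD.strict hV hc (hL (interior_subset hx)) (a := fun _ : ℝ => L x)
        (b := fun _ => L h) (t := fun t => t) tendsto_const_nhds tendsto_const_nhds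
        (tendsto_id.mono_left nhdsWithin_le_nhds)
        (Eventually.of_forall fun _ => hL (interior_subset hx))
        (by
          filter_upwards [h1 (mem_interior_iff_mem_nhds.1 hx)] with t ht
          have := hL ht
          simpa using this) self_mem_nhdsWithin
      refine h2.congr fun t => ?_
      simp

theorem CDiffOn.prodMk (n : ℕ) {E : Type u} [AddCommGroup E] [Module ℝ E]
    [TopologicalSpace E] {F' : Type w} [AddCommGroup F'] [Module ℝ F'] [TopologicalSpace F']
    {f : E → F} {g : E → F'} {U : Set E} (hf : CDiffOn n f U) (hg : CDiffOn n g U) :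
    CDiffOn n (fun x => (f x, g x)) U := by
  induction n generalizing E with
  | zero => exact ContinuousOn.prodMk hf hg
  | succ n ih =>
    obtain ⟨hc, D, hD, hDn⟩ := hf
    obtain ⟨hc', D', hD', hDn'⟩ := hg
    exact ⟨hc.prodMk hc', fun p => (D p, D' p), ⟨hD.continuousOn.prodMk hD'.continuousOn,
      fun x hx h => (hD.hasDirDeriv x hx h).prodMk_nhds (hD'.hasDirDeriv x hx h)⟩, ih hDn hDn'⟩

/-- Write `f (x + t • h)` as `f x + t • b t` with `b t` the difference quotient of `f`, and apply
strict differentiability of `g` with the moving direction `b t`. -/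
theorem IsDifferentialOn.comp {E : Type*} [AddCommGroup E] [Module ℝ E]
    [TopologicalSpace E] [IsLCS E] {E' : Type*} [AddCommGroup E'] [Module ℝ E']
    [TopologicalSpace E'] [IsLCS E'] {F : Type*} [AddCommGroup F] [Module ℝ F]
    [TopologicalSpace F] [IsLCS F] {g : E' → F} {f : E → E'} {V : Set E'} {U : Set E}
    {Dg : E' × E' → F} {Df : E × E → E'} (hV : Good V) (hcg : ContinuousOn g V)
    (hg : IsDifferentialOn g V Dg) (hcf : ContinuousOn f U) (hf : IsDifferentialOn f U Df)
    (hm : MapsTo f U V) : IsDifferentialOn (fun x => g (f x)) U (fun p => Dg (f p.1, Df p)) := by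
  refine ⟨?_, fun x hx h => ?_⟩
  · refine hg.continuousOn.comp ?_ (fun p hp => ⟨hm hp.1, mem_univ _⟩)
    exact ((hcf.comp continuousOn_fst fun p hp => hp.1).prodMk hf.continuousOn)
  · have h1 : Tendsto (fun t : ℝ => x + t • h) (𝓝[≠] 0) (𝓝 x) := by
      have : Tendsto (fun t : ℝ => x + t • h) (𝓝 0) (𝓝 (x + (0 : ℝ) • h)) :=
        Continuous.tendsto (by fun_prop) _
      simp only [zero_smul, add_zero] at this
      exact this.mono_left nhdsWithin_le_nhds
    have e : ∀ t : ℝ, t ≠ 0 → f x + t • t⁻¹ • (f (x + t • h) - f x) = f (x + t • h) := by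
      intro t ht
      rw [smul_smul, mul_inv_cancel₀ ht, one_smul, add_sub_cancel]
    have h2 := hg.strict hV hcg (hm (interior_subset hx)) (a := fun _ : ℝ => f x)
        (b := fun t => t⁻¹ • (f (x + t • h) - f x)) (t := fun t => t) tendsto_const_nhds
        (hf.hasDirDeriv x hx h) (tendsto_id.mono_left nhdsWithin_le_nhds)
        (Eventually.of_forall fun _ => hm (interior_subset hx))
        (by
          filter_upwards [h1 (mem_interior_iff_mem_nhds.1 hx), self_mem_nhdsWithin] with t ht ht'
          rw [e t ht']
          exact hm ht) self_mem_nhdsWithin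
    refine h2.congr' ?_
    filter_upwards [self_mem_nhdsWithin] with t ht
    rw [e t ht]

theorem CDiffOn.comp [IsLCS F] (n : ℕ) {E : Type u} [AddCommGroup E] [Module ℝ E]
    [TopologicalSpace E] [IsLCS E] {E' : Type w} [AddCommGroup E'] [Module ℝ E']
    [TopologicalSpace E'] [IsLCS E'] {g : E' → F} {f : E → E'} {V : Set E'} {U : Set E}
    (hV : Good V) (hU : Good U) (hg : CDiffOn n g V) (hf : CDiffOn n f U) (hm : MapsTo f U V) :
    CDiffOn n (fun x => g (f x)) U := by
  induction n generalizing E E' with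
  | zero => exact ContinuousOn.comp hg hf hm
  | succ n ih =>
    obtain ⟨hcg, Dg, hDg, hDgn⟩ := hg
    have hfn := hf.of_succ n
    obtain ⟨hcf, Df, hDf, hDfn⟩ := hf
    refine ⟨hcg.comp hcf hm, fun p => Dg (f p.1, Df p), hDg.comp hV hcg hcf hDf hm,
      ih (hV.prod good_univ) (hU.prod good_univ) hDgn (CDiffOn.prodMk n ?_ hDfn)
        (fun p hp => ⟨hm hp.1, mem_univ _⟩)⟩
    exact hfn.comp_clm n hU (ContinuousLinearMap.fst ℝ E E) (fun p hp => hp.1)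

theorem CDiffOn.const (n : ℕ) {E : Type u} [AddCommGroup E] [Module ℝ E]
    [TopologicalSpace E] {U : Set E} (c : F) : CDiffOn n (fun _ : E => c) U := by
  cases n with
  | zero => exact continuousOn_const (c := c)
  | succ n =>
    refine ⟨continuousOn_const, 0, ⟨continuousOn_const (c := (0 : F)), fun x _ h => ?_⟩,
      CDiffOn.zero n⟩
    simp [HasDirDeriv, tendsto_const_nhds]

theorem CDiffOn.clm (n : ℕ) {E : Type u} [AddCommGroup E] [Module ℝ E]
    [TopologicalSpace E] (L : E →L[ℝ] F) {U : Set E} : CDiffOn n L U := by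
  induction n generalizing E with
  | zero => exact L.continuous.continuousOn
  | succ n ih =>
    refine ⟨L.continuous.continuousOn, fun p => L p.2,
      ⟨(L.continuous.comp continuous_snd).continuousOn, fun x _ h => ?_⟩,
      ih (L.comp (ContinuousLinearMap.snd ℝ E E))⟩
    refine Tendsto.congr' (f₁ := fun _ => L h) ?_ tendsto_const_nhds
    filter_upwards [self_mem_nhdsWithin] with t ht
    rw [L.map_add, add_sub_cancel_left, L.map_smul, smul_smul, inv_mul_cancel₀ ht, one_smul]

end CDiff

/-! ### Smooth maps between locally convex spaces. -/

section CInf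

variable {E : Type u} [AddCommGroup E] [Module ℝ E] [TopologicalSpace E] [IsLCS E]
  {E' : Type w} [AddCommGroup E'] [Module ℝ E'] [TopologicalSpace E'] [IsLCS E']
  {F : Type v} [AddCommGroup F] [Module ℝ F] [TopologicalSpace F] [IsLCS F]
  {F' : Type*} [AddCommGroup F'] [Module ℝ F'] [TopologicalSpace F'] [IsLCS F']
  {f g : E → F} {U V : Set E} {D : E × E → F}

theorem CInfOn.continuousOn (hf : CInfOn f U) : ContinuousOn f U := hf 0

theorem CInfOn.congr (hf : CInfOn f U) (h : EqOn f g U) : CInfOn g U := fun n => (hf n).congr n h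

theorem CInfOn.mono (hf : CInfOn f U) (h : V ⊆ U) : CInfOn f V := fun n => (hf n).mono n h

theorem CInfOn.of_local (hU : Good U)
    (h : ∀ x ∈ U, ∃ O, IsOpen O ∧ x ∈ O ∧ CInfOn f (U ∩ O)) : CInfOn f U := by
  intro n
  refine CDiffOn.of_local n hU fun x hx => ?_
  obtain ⟨O, hO, hxO, hf⟩ := h x hx
  exact ⟨O, hO, hxO, hf n⟩

theorem CInfOn.prodMk {g : E → F'} (hf : CInfOn f U) (hg : CInfOn g U) :
    CInfOn (fun x => (f x, g x)) U := fun n => (hf n).prodMk n (hg n)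

theorem CInfOn.comp {g : E' → F} {f : E → E'} {V : Set E'} (hV : Good V) (hU : Good U)
    (hg : CInfOn g V) (hf : CInfOn f U) (hm : MapsTo f U V) : CInfOn (fun x => g (f x)) U :=
  fun n => (hg n).comp n hV hU (hf n) hm

theorem cInfOn_const (c : F) : CInfOn (fun _ : E => c) U := fun n => CDiffOn.const n c

theorem cInfOn_clm (L : E →L[ℝ] F) : CInfOn L U := fun n => CDiffOn.clm n L

theorem cInfOn_id : CInfOn (fun x : E => x) U := cInfOn_clm (ContinuousLinearMap.id ℝ E)

theorem cInfOn_fst {U : Set (E × E')} : CInfOn (fun x : E × E' => x.1) U :=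
  cInfOn_clm (ContinuousLinearMap.fst ℝ E E')

theorem cInfOn_snd {U : Set (E × E')} : CInfOn (fun x : E × E' => x.2) U :=
  cInfOn_clm (ContinuousLinearMap.snd ℝ E E')

theorem CInfOn.add (hf : CInfOn f U) (hg : CInfOn g U) : CInfOn (fun x => f x + g x) U :=
  fun n => (hf n).add n (hg n)

/-- By the product rule the differential is a sum of two copies of the same map precomposed with
linear maps, so induction on the order applies. -/
theorem cInfOn_smul {U : Set (ℝ × F)} : CInfOn (fun p : ℝ × F => p.1 • p.2) U := by
  suffices h : ∀ n, CDiffOn n (fun p : ℝ × F => p.1 • p.2) univ from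
    fun n => (h n).mono n (subset_univ _)
  intro n
  induction n with
  | zero => exact (continuous_fst.smul continuous_snd).continuousOn
  | succ n ih =>
    refine ⟨(continuous_fst.smul continuous_snd).continuousOn,
      fun q => q.1.1 • q.2.2 + q.2.1 • q.1.2, ⟨Continuous.continuousOn (by fun_prop), ?_⟩, ?_⟩
    · rintro ⟨c, x⟩ - ⟨d, y⟩
      have : Tendsto (fun t : ℝ => c • y + d • x + t • d • y) (𝓝[≠] 0)
          (𝓝 (c • y + d • x + (0 : ℝ) • d • y)) :=
        Tendsto.mono_left (Continuous.tendsto (by fun_prop) _) nhdsWithin_le_nhds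
      simp only [zero_smul, add_zero] at this
      refine this.congr' ?_
      filter_upwards [self_mem_nhdsWithin] with t ht
      have ht' : t ≠ 0 := ht
      simp only [Prod.smul_mk, Prod.mk_add_mk, smul_eq_mul]
      have e : (c + t * d) • (x + t • y) - c • x = t • (c • y + d • x + t • d • y) := by module
      rw [e, inv_smul_smul₀ ht']
    · rw [univ_prod_univ]
      have a1 := ih.comp_clm n good_univ
        (((ContinuousLinearMap.fst ℝ ℝ F).comp (ContinuousLinearMap.fst ℝ (ℝ × F) (ℝ × F))).prod
        ((ContinuousLinearMap.snd ℝ ℝ F).comp (ContinuousLinearMap.snd ℝ (ℝ × F) (ℝ × F))))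
        (mapsTo_univ _ _) (U := univ)
      have a2 := ih.comp_clm n good_univ
        (((ContinuousLinearMap.fst ℝ ℝ F).comp (ContinuousLinearMap.snd ℝ (ℝ × F) (ℝ × F))).prod
        ((ContinuousLinearMap.snd ℝ ℝ F).comp (ContinuousLinearMap.fst ℝ (ℝ × F) (ℝ × F))))
        (mapsTo_univ _ _) (U := univ)
      exact a1.add n a2

theorem CInfOn.isDifferentialOn (hU : Good U) (hf : CInfOn f U) :
    IsDifferentialOn f U (extDiff f U) := by
  obtain ⟨-, D, hD, -⟩ := hf 1
  exact hD.congr (fun _ _ => rfl) fun p hp => (hD.extDiff_eq hU hp.1 p.2).symm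

theorem CInfOn.extDiff (hU : Good U) (hf : CInfOn f U) : CInfOn (extDiff f U) (U ×ˢ univ) := by
  intro n
  obtain ⟨-, D, hD, hDn⟩ := hf (n + 1)
  exact hDn.congr n fun p hp => (hD.extDiff_eq hU hp.1 p.2).symm

end CInf

/-! ### Partial differentials. -/

section Partial

variable {E : Type*} [AddCommGroup E] [Module ℝ E] [TopologicalSpace E] [IsLCS E]
  {E' : Type*} [AddCommGroup E'] [Module ℝ E'] [TopologicalSpace E'] [IsLCS E']
  {F : Type*} [AddCommGroup F] [Module ℝ F] [TopologicalSpace F] [IsLCS F]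

theorem isDifferentialOn_mk_left (x : E) {V : Set E'} :
    IsDifferentialOn (fun y : E' => (x, y)) V (fun p => (0, p.2)) := by
  refine ⟨Continuous.continuousOn (by fun_prop), fun y _ k => ?_⟩
  refine Tendsto.congr' (f₁ := fun _ => ((0 : E), k)) ?_ tendsto_const_nhds
  filter_upwards [self_mem_nhdsWithin] with t ht
  have ht' : t ≠ 0 := ht
  simp [inv_smul_smul₀ ht']

theorem isDifferentialOn_mk_right (y : E') {U : Set E} :
    IsDifferentialOn (fun x : E => (x, y)) U (fun p => (p.2, 0)) := by
  refine ⟨Continuous.continuousOn (by fun_prop), fun x _ k => ?_⟩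
  refine Tendsto.congr' (f₁ := fun _ => (k, (0 : E'))) ?_ tendsto_const_nhds
  filter_upwards [self_mem_nhdsWithin] with t ht
  have ht' : t ≠ 0 := ht
  simp [inv_smul_smul₀ ht']

variable {f : E × E' → F} {U : Set E} {V : Set E'} {D : (E × E') × (E × E') → F}

theorem IsDifferentialOn.partial_snd (hU : Good U) (hV : Good V) (hc : ContinuousOn f (U ×ˢ V))
    (hD : IsDifferentialOn f (U ×ˢ V) D) {x : E} (hx : x ∈ U) :
    IsDifferentialOn (fun y => f (x, y)) V (fun p => D ((x, p.1), (0, p.2))) :=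
  hD.comp (hU.prod hV) hc (Continuous.continuousOn (by fun_prop)) (isDifferentialOn_mk_left x)
    (fun _ hy => ⟨hx, hy⟩)

theorem IsDifferentialOn.partial_fst (hU : Good U) (hV : Good V) (hc : ContinuousOn f (U ×ˢ V))
    (hD : IsDifferentialOn f (U ×ˢ V) D) {y : E'} (hy : y ∈ V) :
    IsDifferentialOn (fun x => f (x, y)) U (fun p => D ((p.1, y), (p.2, 0))) :=
  hD.comp (hU.prod hV) hc (Continuous.continuousOn (by fun_prop)) (isDifferentialOn_mk_right y)
    (fun _ hx => ⟨hx, hy⟩)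

theorem CInfOn.partial_snd (hU : Good U) (hV : Good V) (hf : CInfOn f (U ×ˢ V)) {x : E}
    (hx : x ∈ U) : CInfOn (fun y => f (x, y)) V :=
  CInfOn.comp (hU.prod hV) hV hf ((cInfOn_const x).prodMk cInfOn_id) (fun _ hy => ⟨hx, hy⟩)

theorem CInfOn.partial_fst (hU : Good U) (hV : Good V) (hf : CInfOn f (U ×ˢ V)) {y : E'}
    (hy : y ∈ V) : CInfOn (fun x => f (x, y)) U :=
  CInfOn.comp (hU.prod hV) hU hf (cInfOn_id.prodMk (cInfOn_const y)) (fun _ hx => ⟨hx, hy⟩)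

end Partial

/-! ### Symmetry of second differentials. -/

section Schwarz

variable {E : Type*} [AddCommGroup E] [Module ℝ E] [TopologicalSpace E] [IsLCS E]
  {F : Type*} [AddCommGroup F] [Module ℝ F] [TopologicalSpace F] [IsLCS F]
  {f : E → F} {U : Set E} {D : E × E → F} {D₂ : (E × E) × (E × E) → F}

/-- Apply the mean value theorem twice: to `D (·, h)` in direction `k`, and then to the increment of
`f` along `t • k` in direction `h`. The second difference is symmetric in `h` and `k`, so its limit
is symmetric too. -/
theorem tendsto_second_difference (hU : Good U) (hc : ContinuousOn f U)
    (hD : IsDifferentialOn f U D) (hD₂ : IsDifferentialOn D (U ×ˢ univ) D₂) {x : E}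
    (hx : x ∈ interior U) (h k : E) :
    Tendsto (fun t : ℝ => t⁻¹ • (t⁻¹ • (f (x + t • h + t • k) - f (x + t • h))
      - t⁻¹ • (f (x + t • k) - f x))) (𝓝[>] 0) (𝓝 (D₂ ((x, h), (k, 0)))) := by
  have hDh : IsDifferentialOn (fun y => D (y, h)) U (fun p => D₂ ((p.1, h), (p.2, 0))) :=
    hD₂.partial_fst hU good_univ hD.continuousOn (mem_univ h)
  have hDc : ∀ v, ContinuousOn (fun y => D (y, v)) U := fun v =>
    hD.continuousOn.comp (f := fun y => (y, v)) (Continuous.continuousOn (by fun_prop))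
      (fun y hy => ⟨hy, mem_univ _⟩)
  intro W hW
  obtain ⟨A, hA, hAc, hAcl, hAW⟩ := exists_closed_convex_nhds hW
  have hP : {y | y ∈ interior U ∧ D₂ ((y, h), (k, 0)) ∈ A} ∈ 𝓝 x := by
    refine inter_mem (isOpen_interior.mem_nhds hx) ?_
    have h1 : ContinuousOn (fun y => D₂ ((y, h), (k, 0))) U :=
      hD₂.continuousOn.comp (f := fun y => ((y, h), (k, 0)))
        (Continuous.continuousOn (by fun_prop)) (fun y hy => ⟨⟨hy, mem_univ _⟩, mem_univ _⟩)
    exact (h1.continuousAt (mem_interior_iff_mem_nhds.1 hx)) hA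
  have hcont : Tendsto (fun q : ℝ × ℝ => x + q.1 • h + q.2 • k) (𝓝 ((0 : ℝ), (0 : ℝ))) (𝓝 x) := by
    have : Tendsto (fun q : ℝ × ℝ => x + q.1 • h + q.2 • k) (𝓝 ((0 : ℝ), (0 : ℝ)))
      (𝓝 (x + (0 : ℝ) • h + (0 : ℝ) • k)) := Continuous.tendsto (by fun_prop) _
    simpa using this
  obtain ⟨ε, hε, hball⟩ := Metric.mem_nhds_iff.1 (hcont hP)
  have hin : ∀ a b : ℝ, |a| < ε → |b| < ε →
      x + a • h + b • k ∈ interior U ∧ D₂ ((x + a • h + b • k, h), (k, 0)) ∈ A := by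
    intro a b ha hb
    have : (a, b) ∈ Metric.ball ((0 : ℝ), (0 : ℝ)) ε := by
      simp [Prod.dist_eq, ha, hb]
    exact hball this
  rw [Filter.mem_map]
  filter_upwards [Ioo_mem_nhdsGT hε] with t ht
  apply hAW
  have ht0 : t ≠ 0 := ht.1.ne'
  have habs : ∀ s ∈ Icc (0 : ℝ) 1, |s * t| < ε := by
    intro s hs
    rw [abs_mul, abs_of_nonneg hs.1, abs_of_pos ht.1]
    nlinarith [hs.2, ht.1, ht.2]
  have habst : |t| < ε := by simpa using habs 1 ⟨zero_le_one, le_rfl⟩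
  have inner : ∀ a : ℝ, |a| < ε → t⁻¹ • (D (x + a • h + t • k, h) - D (x + a • h, h)) ∈ A := by
    intro a ha
    exact quotient_mem_of_segment_interior (hDc h) hDh hAc hAcl ht0
      (fun s hs => (hin a (s * t) ha (habs s hs)).1) (fun s hs => (hin a (s * t) ha (habs s hs)).2)
  -- The set of points where both terms of the increment `f (y + t • k) - f y` are differentiable.
  set U' : Set E := interior U ∩ (fun y => y + t • k) ⁻¹' interior U with hU'
  have hU'o : IsOpen U' := isOpen_interior.inter (isOpen_interior.preimage (by fun_prop))
  have hshift : ContinuousOn (fun y => f (y + t • k)) U' :=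
    hc.comp (Continuous.continuousOn (by fun_prop)) (fun y hy => interior_subset hy.2)
  have outer := quotient_mem_of_segment_interior (U := U')
    (f := fun y => t⁻¹ • (f (y + t • k) - f y))
    (D := fun p => t⁻¹ • (D (p.1 + t • k, p.2) - D p)) (A := A) (x := x) (h := h) (t := t)
    ((hshift.sub (hc.mono fun y hy => interior_subset hy.1)).const_smul _)
    ⟨?_, ?_⟩ hAc hAcl ht0 ?_ ?_
  · exact outer
  · refine ContinuousOn.const_smul (ContinuousOn.sub ?_ ?_) _
    · exact hD.continuousOn.comp (f := fun p : E × E => (p.1 + t • k, p.2))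
        (Continuous.continuousOn (by fun_prop))
        (fun p hp => ⟨interior_subset hp.1.2, mem_univ _⟩)
    · exact hD.continuousOn.mono fun p hp => ⟨interior_subset hp.1.1, mem_univ _⟩
  · intro y hy v
    rw [hU'o.interior_eq] at hy
    have h1 := hD.hasDirDeriv _ hy.1 v
    have h2 := hD.hasDirDeriv _ hy.2 v
    refine ((h2.sub h1).const_smul t⁻¹).congr fun r => ?_
    simp only [smul_sub, smul_comm t⁻¹ r⁻¹, add_right_comm y (t • k) (r • v)]
    abel
  · intro s hs
    rw [hU'o.interior_eq]
    refine ⟨?_, (hin (s * t) t (habs s hs) habst).1⟩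
    simpa using (hin (s * t) 0 (habs s hs) (by simpa using hε)).1
  · intro s hs
    exact inner _ (habs s hs)

theorem second_differential_symm (hU : Good U) (hc : ContinuousOn f U)
    (hD : IsDifferentialOn f U D) (hD₂ : IsDifferentialOn D (U ×ˢ univ) D₂) {x : E}
    (hx : x ∈ U) (h k : E) : D₂ ((x, h), (k, 0)) = D₂ ((x, k), (h, 0)) := by
  have aux : ∀ y ∈ interior U, D₂ ((y, h), (k, 0)) = D₂ ((y, k), (h, 0)) := by
    intro y hy
    refine tendsto_nhds_unique (tendsto_second_difference hU hc hD hD₂ hy h k)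
      ((tendsto_second_difference hU hc hD hD₂ hy k h).congr fun t => ?_)
    congr 1
    rw [← smul_sub, ← smul_sub, add_right_comm]
    congr 1
    abel
  have h1 : ∀ h k : E, ContinuousOn (fun y => D₂ ((y, h), (k, 0))) U := fun h k =>
      hD₂.continuousOn.comp (f := fun y => ((y, h), (k, 0)))
        (Continuous.continuousOn (by fun_prop)) (fun y hy => ⟨⟨hy, mem_univ _⟩, mem_univ _⟩)
  have h5 := ((((h1 h k).sub (h1 k h)) x hx).mono interior_subset).mem_closure_image
    (hU.subset_closure_interior hx)
  have h6 : (fun y => D₂ ((y, h), (k, 0)) - D₂ ((y, k), (h, 0))) '' interior U ⊆ {0} := by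
    rintro _ ⟨y, hy, rfl⟩
    simp [aux y hy]
  have h7 := closure_mono h6 h5
  rw [closure_singleton] at h7
  exact sub_eq_zero.1 h7

end Schwarz

/-! ### Smooth maps into closed subspaces. -/

section CodRestrict

variable {V : Type v} [AddCommGroup V] [Module ℝ V] [TopologicalSpace V] [IsLCS V]

/-- Difference quotients of a map into `S` lie in `S`. As `S` is closed, so do their limits and the
continuous extension of these to the boundary. -/
theorem CDiffOn.codRestrict (n : ℕ) {S : Submodule ℝ V} (hS : IsClosed (S : Set V)) {E : Type u}
    [AddCommGroup E] [Module ℝ E] [TopologicalSpace E] [IsLCS E] {U : Set E} (hU : Good U)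
    {g : E → S} (hg : CDiffOn n (fun x => (g x : V)) U) : CDiffOn n g U := by
  induction n generalizing E with
  | zero => exact (IsInducing.subtypeVal.continuousOn_iff).2 hg
  | succ n ih =>
    obtain ⟨hc, D, hD, hDn⟩ := hg
    have hmem : ∀ p ∈ U ×ˢ (univ : Set E), D p ∈ S := by
      rintro ⟨x, h⟩ ⟨hx, -⟩
      have h0 : ∀ y ∈ interior U, D (y, h) ∈ S := by
        intro y hy
        refine hS.mem_of_tendsto (hD.hasDirDeriv y hy h) (Eventually.of_forall fun t => ?_)
        exact S.smul_mem _ (S.sub_mem (g _).2 (g _).2)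
      have h1 : ContinuousOn (fun y => D (y, h)) U :=
        hD.continuousOn.comp (f := fun y => (y, h)) (Continuous.continuousOn (by fun_prop))
          (fun y hy => ⟨hy, mem_univ _⟩)
      have h5 := ((h1 x hx).mono interior_subset).mem_closure_image
        (hU.subset_closure_interior hx)
      have h6 : (fun y => D (y, h)) '' interior U ⊆ S := by
        rintro _ ⟨y, hy, rfl⟩
        exact h0 y hy
      exact closure_minimal h6 hS h5
    classical
    -- The default value `0` is never taken on `U ×ˢ univ`.
    let D' : E × E → S := fun p => if hp : D p ∈ S then ⟨D p, hp⟩ else 0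
    have hD' : EqOn D (fun p => (D' p : V)) (U ×ˢ univ) := by
      intro p hp
      simp [D', hmem p hp]
    have hDD := hD.congr (fun _ _ => rfl) hD'
    refine ⟨(IsInducing.subtypeVal.continuousOn_iff).2 hc, D', ⟨?_, ?_⟩,
      ih (hU.prod good_univ) (hDn.congr n hD')⟩
    · exact (IsInducing.subtypeVal.continuousOn_iff).2 hDD.continuousOn
    · intro x hx h
      exact (IsInducing.subtypeVal.tendsto_nhds_iff).2 (hDD.hasDirDeriv x hx h)

theorem CInfOn.codRestrict {S : Submodule ℝ V} (hS : IsClosed (S : Set V)) {E : Type u}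
    [AddCommGroup E] [Module ℝ E] [TopologicalSpace E] [IsLCS E] {U : Set E} (hU : Good U)
    {g : E → S} (hg : CInfOn (fun x => (g x : V)) U) : CInfOn g U :=
  fun n => (hg n).codRestrict n hS hU

end CodRestrict

/-! ### The canonical differential and mixed partial differentials. -/

section ExtDiff

variable {E : Type*} [AddCommGroup E] [Module ℝ E] [TopologicalSpace E] [IsLCS E]
  {P : Type*} [AddCommGroup P] [Module ℝ P] [TopologicalSpace P] [IsLCS P]
  {F : Type*} [AddCommGroup F] [Module ℝ F] [TopologicalSpace F] [IsLCS F]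

theorem extDiff_congr {f g : E → F} {U : Set E} (hfg : EqOn f g U) (p : E × E) :
    extDiff f U p = extDiff g U p := by
  have h1 : ∀ y ∈ interior U, ∀ h, dirDeriv f y h = dirDeriv g y h := by
    intro y hy h
    unfold dirDeriv limUnder
    congr 1
    apply Filter.map_congr
    have : Tendsto (fun t : ℝ => y + t • h) (𝓝 0) (𝓝 (y + (0 : ℝ) • h)) :=
      Continuous.tendsto (by fun_prop) _
    simp only [zero_smul, add_zero] at this
    filter_upwards [this.mono_left nhdsWithin_le_nhds (mem_interior_iff_mem_nhds.1 hy)] with t ht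
    rw [hfg ht, hfg (interior_subset hy)]
  unfold extDiff extendFrom limUnder
  congr 1
  apply Filter.map_congr
  filter_upwards [self_mem_nhdsWithin] with q hq
  exact h1 q.1 hq.1 q.2

theorem cInfOn_of_linear (f : E → F) (ha : ∀ x y, f (x + y) = f x + f y)
    (hs : ∀ (c : ℝ) x, f (c • x) = c • f x) (hc : Continuous f) {U : Set E} : CInfOn f U :=
  cInfOn_clm (⟨⟨⟨f, ha⟩, hs⟩, hc⟩ : E →L[ℝ] F)

/-- Mixed partial differentials commute. -/
theorem extDiff_comm {g : P × E → F} {W : Set P} {U : Set E} (hW : Good W) (hU : Good U)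
    (hg : CInfOn g (W ×ˢ U)) {w : P} {x : E} (hw : w ∈ W) (hx : x ∈ U) (h : P) (v : E) :
    extDiff (fun y => extDiff (fun w' => g (w', y)) W (w, h)) U (x, v) =
      extDiff (fun w' => extDiff (fun y => g (w', y)) U (x, v)) W (w, h) := by
  have hWU := hW.prod hU
  set D := extDiff g (W ×ˢ U) with hDdef
  have hD : IsDifferentialOn g (W ×ˢ U) D := hg.isDifferentialOn hWU
  have hDs : CInfOn D ((W ×ˢ U) ×ˢ univ) := hg.extDiff hWU
  have hD₂ := hDs.isDifferentialOn (hWU.prod good_univ)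
  set D₂ := extDiff D ((W ×ˢ U) ×ˢ univ)
  have e1 : EqOn (fun y => extDiff (fun w' => g (w', y)) W (w, h))
      (fun y => D ((w, y), (h, 0))) U := fun y hy =>
    (hD.partial_fst hW hU hg.continuousOn hy).extDiff_eq hW hw h
  have e2 : EqOn (fun w' => extDiff (fun y => g (w', y)) U (x, v))
      (fun w' => D ((w', x), (0, v))) W := fun w' hw' =>
    (hD.partial_snd hW hU hg.continuousOn hw').extDiff_eq hU hx v
  rw [extDiff_congr e1, extDiff_congr e2]
  have d1 : IsDifferentialOn (fun q : P × E => D (q, (h, 0))) (W ×ˢ U)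
      (fun p => D₂ ((p.1, (h, 0)), (p.2, 0))) :=
    hD₂.partial_fst hWU good_univ hDs.continuousOn (mem_univ _)
  have d2 : IsDifferentialOn (fun q : P × E => D (q, (0, v))) (W ×ˢ U)
      (fun p => D₂ ((p.1, (0, v)), (p.2, 0))) :=
    hD₂.partial_fst hWU good_univ hDs.continuousOn (mem_univ _)
  have c1 : ∀ k, ContinuousOn (fun q : P × E => D (q, k)) (W ×ˢ U) := fun k =>
    hDs.continuousOn.comp (f := fun q => (q, k)) (Continuous.continuousOn (by fun_prop))
      (fun q hq => ⟨hq, mem_univ _⟩)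
  rw [(d1.partial_snd hW hU (c1 _) hw).extDiff_eq hU hx v,
    (d2.partial_fst hW hU (c1 _) hx).extDiff_eq hW hw h]
  exact second_differential_symm hWU hg.continuousOn hD hD₂ ⟨hw, hx⟩ _ _

end ExtDiff

/-! ### Higher differentials, with parameters. -/

section IterDiff

variable {E : Type*} [AddCommGroup E] [Module ℝ E] [TopologicalSpace E] [IsLCS E]
  {P : Type*} [AddCommGroup P] [Module ℝ P] [TopologicalSpace P] [IsLCS P]
  {F : Type*} [AddCommGroup F] [Module ℝ F] [TopologicalSpace F] [IsLCS F]

theorem iterDiff_succ (U : Set E) (f : E → F) (k : ℕ) (x : E) (h : Fin (k + 1) → E) :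
    iterDiff U f (k + 1) x h = extDiff (fun y => iterDiff U f k y (Fin.tail h)) U (x, h 0) := rfl

theorem iterDiff_congr {U : Set E} {f g : E → F} (hfg : EqOn f g U) (k : ℕ) {x : E} (hx : x ∈ U)
    (h : Fin k → E) : iterDiff U f k x h = iterDiff U g k x h := by
  induction k generalizing x with
  | zero => exact hfg hx
  | succ k ih => exact extDiff_congr (fun y hy => ih hy _) _

/-- The next differential is the joint differential of the previous one in a direction that moves
only the point `x`; thus smoothness is inherited inductively. -/
theorem iterDiff_param_cInfOn {f : P × E → F} {W : Set P} {U : Set E} (hW : Good W) (hU : Good U)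
    (hf : CInfOn f (W ×ˢ U)) (k : ℕ) :
    CInfOn (fun q : P × (E × (Fin k → E)) => iterDiff U (fun y => f (q.1, y)) k q.2.1 q.2.2)
      (W ×ˢ (U ×ˢ univ)) := by
  induction k with
  | zero =>
    exact CInfOn.comp (hW.prod hU) (hW.prod (hU.prod good_univ)) hf
      (cInfOn_of_linear (fun q : P × (E × (Fin 0 → E)) => (q.1, q.2.1)) (fun _ _ => rfl)
        (fun _ _ => rfl) (by fun_prop)) (fun q hq => ⟨hq.1, hq.2.1⟩)
  | succ k ih =>
    have hG : Good (W ×ˢ (U ×ˢ (univ : Set (Fin k → E)))) := hW.prod (hU.prod good_univ)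
    have hD := ih.isDifferentialOn hG
    -- In the direction `(0, (h 0, 0))` the parameter and the remaining directions `Fin.tail h` stay
    -- fixed, as in the recursion for `iterDiff`.
    have key := CInfOn.comp (hG.prod good_univ) (hW.prod (hU.prod good_univ)) (ih.extDiff hG)
      (cInfOn_of_linear (U := W ×ˢ (U ×ˢ univ)) (fun q : P × (E × (Fin (k + 1) → E)) =>
        (((q.1, (q.2.1, Fin.tail q.2.2)), (0, (q.2.2 0, 0))) :
          (P × (E × (Fin k → E))) × (P × (E × (Fin k → E)))))
        (fun q q' => by ext <;> simp [Fin.tail]) (fun c q => by ext <;> simp [Fin.tail])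
        (by unfold Fin.tail; fun_prop)) (fun q hq => ⟨⟨hq.1, hq.2.1, mem_univ _⟩, mem_univ _⟩)
    refine key.congr ?_
    rintro ⟨w, x, h⟩ ⟨hw, hx, -⟩
    have h1 := (hD.partial_snd hW (hU.prod good_univ) ih.continuousOn hw).partial_fst hU good_univ
      (ih.partial_snd hW (hU.prod good_univ) hw).continuousOn (mem_univ (Fin.tail h))
    exact (h1.extDiff_eq hU hx (h 0)).symm

theorem iterDiff_cInfOn {f : E → F} {U : Set E} (hU : Good U) (hf : CInfOn f U) (k : ℕ) :
    CInfOn (fun z : E × (Fin k → E) => iterDiff U f k z.1 z.2) (U ×ˢ univ) :=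
  (iterDiff_param_cInfOn (P := ℝ) (W := univ) (f := fun q => f q.2) good_univ hU
    (CInfOn.comp hU (good_univ.prod hU) hf cInfOn_snd (fun _ hq => hq.2)) k).partial_snd
      good_univ (hU.prod good_univ) (mem_univ 0)

theorem iterDiff_fixed_cInfOn {f : E → F} {U : Set E} (hU : Good U) (hf : CInfOn f U) (k : ℕ)
    (h : Fin k → E) : CInfOn (fun x => iterDiff U f k x h) U :=
  (iterDiff_cInfOn hU hf k).partial_fst hU good_univ (mem_univ h)

theorem CInfOn.extDiff_add {f g : E → F} {U : Set E} (hU : Good U) (hf : CInfOn f U)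
    (hg : CInfOn g U) {x : E} (hx : x ∈ U) (h : E) :
    LC.extDiff (fun y => f y + g y) U (x, h) = LC.extDiff f U (x, h) + LC.extDiff g U (x, h) := by
  have hD := hf.isDifferentialOn hU
  have hD' := hg.isDifferentialOn hU
  refine IsDifferentialOn.extDiff_eq (D := fun p => LC.extDiff f U p + LC.extDiff g U p) hU
    ⟨hD.continuousOn.add hD'.continuousOn, fun x hx h => ?_⟩ hx h
  refine ((hD.hasDirDeriv x hx h).add (hD'.hasDirDeriv x hx h)).congr fun t => ?_
  rw [← smul_add]
  exact congrArg _ (add_sub_add_comm _ _ _ _).symm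

theorem CInfOn.extDiff_const_smul {f : E → F} {U : Set E} (hU : Good U) (hf : CInfOn f U)
    (c : ℝ) {x : E} (hx : x ∈ U) (h : E) :
    LC.extDiff (fun y => c • f y) U (x, h) = c • LC.extDiff f U (x, h) := by
  have hD := hf.isDifferentialOn hU
  refine IsDifferentialOn.extDiff_eq (D := fun p => c • LC.extDiff f U p) hU
    ⟨hD.continuousOn.const_smul c, fun x hx h => ?_⟩ hx h
  refine ((hD.hasDirDeriv x hx h).const_smul c).congr fun t => ?_
  rw [smul_comm, smul_sub]

theorem iterDiff_add {f g : E → F} {U : Set E} (hU : Good U) (hf : CInfOn f U)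
    (hg : CInfOn g U) (k : ℕ) {x : E} (hx : x ∈ U) (h : Fin k → E) :
    iterDiff U (fun y => f y + g y) k x h = iterDiff U f k x h + iterDiff U g k x h := by
  induction k generalizing x with
  | zero => rfl
  | succ k ih =>
    rw [iterDiff_succ, extDiff_congr (fun y hy => ih hy (Fin.tail h))]
    exact (iterDiff_fixed_cInfOn hU hf k _).extDiff_add hU (iterDiff_fixed_cInfOn hU hg k _) hx _

theorem iterDiff_const_smul {f : E → F} {U : Set E} (hU : Good U) (hf : CInfOn f U)
    (c : ℝ) (k : ℕ) {x : E} (hx : x ∈ U) (h : Fin k → E) :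
    iterDiff U (fun y => c • f y) k x h = c • iterDiff U f k x h := by
  induction k generalizing x with
  | zero => rfl
  | succ k ih =>
    rw [iterDiff_succ, extDiff_congr (fun y hy => ih hy (Fin.tail h))]
    exact (iterDiff_fixed_cInfOn hU hf k _).extDiff_const_smul hU c hx _

theorem iterDiff_update_add {f : E → F} {U : Set E} (hU : Good U) (hf : CInfOn f U) (k : ℕ)
    {x : E} (hx : x ∈ U) (h : Fin k → E) (i : Fin k) (a b : E) :
    iterDiff U f k x (Function.update h i (a + b)) =
      iterDiff U f k x (Function.update h i a) + iterDiff U f k x (Function.update h i b) := by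
  induction k generalizing x with
  | zero => exact i.elim0
  | succ k ih =>
    simp only [iterDiff_succ]
    refine Fin.cases ?_ (fun j => ?_) i
    · simp only [Fin.tail_update_zero, Function.update_self]
      have hs := iterDiff_fixed_cInfOn hU hf k (Fin.tail h)
      exact (hs.isDifferentialOn hU).map_add hU hs.continuousOn hx a b
    · simp only [Fin.tail_update_succ, ne_eq, (Fin.succ_ne_zero j).symm, not_false_eq_true,
        Function.update_of_ne]
      rw [extDiff_congr (fun y hy => ih hy (Fin.tail h) j)]
      exact (iterDiff_fixed_cInfOn hU hf k _).extDiff_add hU (iterDiff_fixed_cInfOn hU hf k _) hx _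

theorem iterDiff_update_smul {f : E → F} {U : Set E} (hU : Good U) (hf : CInfOn f U) (k : ℕ)
    {x : E} (hx : x ∈ U) (h : Fin k → E) (i : Fin k) (c : ℝ) (a : E) :
    iterDiff U f k x (Function.update h i (c • a)) =
      c • iterDiff U f k x (Function.update h i a) := by
  induction k generalizing x with
  | zero => exact i.elim0
  | succ k ih =>
    simp only [iterDiff_succ]
    refine Fin.cases ?_ (fun j => ?_) i
    · simp only [Fin.tail_update_zero, Function.update_self]
      have hs := iterDiff_fixed_cInfOn hU hf k (Fin.tail h)
      exact (hs.isDifferentialOn hU).map_smul hU hs.continuousOn hx c a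
    · simp only [Fin.tail_update_succ, ne_eq, (Fin.succ_ne_zero j).symm, not_false_eq_true,
        Function.update_of_ne]
      rw [extDiff_congr (fun y hy => ih hy (Fin.tail h) j)]
      exact (iterDiff_fixed_cInfOn hU hf k _).extDiff_const_smul hU c hx _

/-- The differential of `(x, h) ↦ d^k f (x; h)`. -/
theorem extDiff_iterDiff {f : E → F} {U : Set E} (hU : Good U) (hf : CInfOn f U) (k : ℕ)
    {x : E} (hx : x ∈ U) (h : Fin k → E) (y : E) (v : Fin k → E) :
    extDiff (fun z : E × (Fin k → E) => iterDiff U f k z.1 z.2) (U ×ˢ univ) ((x, h), (y, v)) =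
      iterDiff U f (k + 1) x (Fin.cons y h) +
        ∑ i, iterDiff U f k x (Function.update h i (v i)) := by
  have hs := iterDiff_cInfOn hU hf k
  have hG : Good (U ×ˢ (univ : Set (Fin k → E))) := hU.prod good_univ
  have hD := hs.isDifferentialOn hG
  set A := fun z : E × (Fin k → E) => iterDiff U f k z.1 z.2
  set D := extDiff A (U ×ˢ univ)
  have hxh : (x, h) ∈ U ×ˢ (univ : Set (Fin k → E)) := ⟨hx, mem_univ _⟩
  have h1 : D ((x, h), (y, 0)) = iterDiff U f (k + 1) x (Fin.cons y h) := by
    rw [iterDiff_succ]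
    simp only [Fin.tail_cons, Fin.cons_zero]
    exact ((hD.partial_fst hU good_univ hs.continuousOn (mem_univ h)).extDiff_eq hU hx y).symm
  -- The map is linear in the `i`-th direction, so the difference quotients are constant and equal
  -- to the claimed value.
  have h2 : ∀ i, D ((x, h), (0, Pi.single i (v i))) =
      iterDiff U f k x (Function.update h i (v i)) := by
    intro i
    have h3 := hD.strict hG hs.continuousOn hxh (a := fun _ : ℝ => (x, h))
      (b := fun _ => (0, Pi.single i (v i))) (t := fun t => t) (l := 𝓝[≠] 0) tendsto_const_nhds
      tendsto_const_nhds (tendsto_id.mono_left nhdsWithin_le_nhds)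
      (Eventually.of_forall fun _ => hxh)
      (Eventually.of_forall fun t => ⟨by simpa using hx, mem_univ _⟩) self_mem_nhdsWithin
    refine tendsto_nhds_unique h3 (Tendsto.congr' ?_ tendsto_const_nhds)
    filter_upwards [self_mem_nhdsWithin] with t ht
    have ht' : t ≠ 0 := ht
    have e : h + t • (Pi.single i (v i) : Fin k → E) = Function.update h i (h i + t • v i) := by
      ext j
      rcases eq_or_ne j i with rfl | hj
      · simp
      · simp [hj]
    simp only [A, Prod.smul_mk, Prod.mk_add_mk, smul_zero, add_zero]
    rw [e, iterDiff_update_add hU hf k hx, iterDiff_update_smul hU hf k hx,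
      Function.update_eq_self, add_sub_cancel_left, inv_smul_smul₀ ht']
  have h4 : ∀ s : Finset (Fin k), D ((x, h), (0, ∑ i ∈ s, Pi.single i (v i))) =
      ∑ i ∈ s, D ((x, h), (0, Pi.single i (v i))) := by
    intro s
    induction s using Finset.induction_on with
    | empty => exact hD.map_zero hG hs.continuousOn hxh
    | insert i s hi ih =>
      rw [Finset.sum_insert hi, Finset.sum_insert hi, ← ih,
        ← hD.map_add hG hs.continuousOn hxh]
      simp
  have e : ((y, v) : E × (Fin k → E)) = (y, 0) + (0, ∑ i, Pi.single i (v i)) := by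
    simp [Finset.univ_sum_single]
  rw [e, hD.map_add hG hs.continuousOn hxh, h1, h4]
  simp only [h2]

/-- The derivative with respect to the parameter is moved past one derivative in `x` at a time, by
`extDiff_comm`. -/
theorem iterDiff_extDiff_param {f : P × E → F} {W : Set P} {U : Set E} (hW : Good W)
    (hU : Good U) (hf : CInfOn f (W ×ˢ U)) {w : P} (hw : w ∈ W) (h : P) (k : ℕ) {x : E}
    (hx : x ∈ U) (e : Fin k → E) :
    iterDiff U (fun y => extDiff (fun w' => f (w', y)) W (w, h)) k x e =
      extDiff (fun w' => iterDiff U (fun y => f (w', y)) k x e) W (w, h) := by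
  induction k generalizing x with
  | zero => rfl
  | succ k ih =>
    rw [iterDiff_succ, extDiff_congr (fun y hy => ih hy (Fin.tail e))]
    simp only [iterDiff_succ]
    refine extDiff_comm (g := fun q => iterDiff U (fun y => f (q.1, y)) k q.2 (Fin.tail e))
      hW hU ?_ hw hx h (e 0)
    exact CInfOn.comp (hW.prod (hU.prod good_univ)) (hW.prod hU) (iterDiff_param_cInfOn hW hU hf k)
      (f := fun q => (q.1, (q.2, Fin.tail e)))
      (cInfOn_fst.prodMk (cInfOn_snd.prodMk (cInfOn_const _)))
      (fun q hq => ⟨hq.1, hq.2, mem_univ _⟩)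

end IterDiff

/-! ### Model spaces as subsets of vector spaces. -/

section Model

variable {E : Type*} [AddCommGroup E] [Module ℝ E] [TopologicalSpace E]
  {H : Type*} [TopologicalSpace H] (J : LCModel E H)

theorem LCModel.image_eq (V : Set H) : J.toFun '' V = range J.toFun ∩ J.invFun ⁻¹' V := by
  ext x
  constructor
  · rintro ⟨a, ha, rfl⟩
    exact ⟨⟨a, rfl⟩, by simpa [J.left_inv] using ha⟩
  · rintro ⟨⟨a, rfl⟩, ha⟩
    exact ⟨a, by simpa [J.left_inv] using ha, rfl⟩

theorem LCModel.good_image {V : Set H} (hV : IsOpen V) : Good (J.toFun '' V) := by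
  rw [J.image_eq]
  exact ⟨_, _, J.convex_range, J.nonempty_interior, hV.preimage J.continuous_invFun, rfl⟩

theorem LCModel.good_range : Good (range J.toFun) := by
  rw [← image_univ]
  exact J.good_image isOpen_univ

theorem LCModel.isInducing : IsInducing J.toFun :=
  IsInducing.of_comp J.continuous_toFun J.continuous_invFun (by
    have : J.invFun ∘ J.toFun = id := funext J.left_inv
    rw [this]
    exact IsInducing.id)

/-- The range is the fixed point set of `toFun ∘ invFun`. Closedness makes chart images locally
closed, hence locally compact in finite dimensions. -/
theorem LCModel.isClosed_range [T2Space E] : IsClosed (range J.toFun) := by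
  have : range J.toFun = {x | J.toFun (J.invFun x) = x} := by
    ext x
    constructor
    · rintro ⟨a, rfl⟩
      simp [J.left_inv]
    · intro h
      exact ⟨_, h⟩
  rw [this]
  exact isClosed_eq (J.continuous_toFun.comp J.continuous_invFun) continuous_id

end Model

/-! ### The locally convex topology of `C^∞(X,F)`. -/

section Topology

variable {E : Type*} [AddCommGroup E] [Module ℝ E] [TopologicalSpace E] [IsLCS E]
  {H : Type*} [TopologicalSpace H] {J : LCModel E H}
  {X : Type*} [TopologicalSpace X] [ChartedSpace H X]
  {F : Type*} [AddCommGroup F] [Module ℝ F] [TopologicalSpace F] [IsLCS F]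

theorem Smooth.cInfOn_chart {f : X → F} (hf : Smooth J (LCModel.self F) f)
    {φ : OpenPartialHomeomorph X H} (hφ : φ ∈ atlas H X) :
    CInfOn (fun x => f (φ.symm (J.invFun x))) (J.toFun '' φ.target) := by
  have h := hf.smooth_charts φ hφ (OpenPartialHomeomorph.refl F) (by simp)
  simpa [LCModel.self] using h

theorem smooth_of_cInfOn_chart {f : X → F} (hf : ∀ φ ∈ atlas H X,
    CInfOn (fun x => f (φ.symm (J.invFun x))) (J.toFun '' φ.target)) :
    Smooth J (LCModel.self F) f := by
  refine ⟨continuous_iff_continuousAt.2 fun x => ?_, fun φ hφ ψ hψ => ?_⟩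
  · have h1 := (hf _ (chart_mem_atlas H x)).continuousOn
    have h2 : ContinuousOn (fun y => f ((chartAt H x).symm (J.invFun (J.toFun (chartAt H x y)))))
        (chartAt H x).source :=
      h1.comp (f := fun y => J.toFun (chartAt H x y))
        (J.continuous_toFun.comp_continuousOn (chartAt H x).continuousOn)
        (fun y hy => ⟨_, (chartAt H x).map_source hy, rfl⟩)
    refine (h2.congr fun y hy => ?_).continuousAt ((chartAt H x).open_source.mem_nhds
      (mem_chart_source H x))
    rw [J.left_inv, (chartAt H x).left_inv hy]
  · obtain rfl : ψ = OpenPartialHomeomorph.refl F := by simpa using hψ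
    simpa [LCModel.self] using hf φ hφ

theorem SmoothFun.cInfOn (f : SmoothFun J X F) {φ : OpenPartialHomeomorph X H}
    (hφ : φ ∈ atlas H X) :
    CInfOn (fun x => f (φ.symm (J.invFun x))) (J.toFun '' φ.target) :=
  Smooth.cInfOn_chart f.2 hφ

theorem SmoothFun.ext {f g : SmoothFun J X F} (h : ∀ x, f x = g x) : f = g :=
  Subtype.ext (funext h)

theorem SmoothFun.zero_apply (x : X) : (0 : SmoothFun J X F) x = 0 := rfl

/-- The `k`-th differential in the chart `φ`, as a continuous function. -/
def SmoothFun.jet (φ : atlas H X) (k : ℕ) : SmoothFun J X F →ₗ[ℝ]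
    C(((J.toFun '' φ.1.target) ×ˢ (univ : Set (Fin k → E)) : Set (E × (Fin k → E))), F) where
  toFun f := ⟨fun z => iterDiff (J.toFun '' φ.1.target) (fun x => f (φ.1.symm (J.invFun x))) k
      z.1.1 z.1.2, continuousOn_iff_continuous_domRestrict.1
        (iterDiff_cInfOn (J.good_image φ.1.open_target) (f.cInfOn φ.2) k).continuousOn⟩
  map_add' f g := by
    ext z
    exact iterDiff_add (J.good_image φ.1.open_target) (f.cInfOn φ.2) (g.cInfOn φ.2) k z.2.1 _
  map_smul' c f := by
    ext z
    exact iterDiff_const_smul (J.good_image φ.1.open_target) (f.cInfOn φ.2) c k z.2.1 _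

/-- As an initial topology for the linear maps `jet` into spaces with the compact open topology, the
topology of `C^∞(X,F)` inherits its vector space properties and local convexity from them. -/
theorem SmoothFun.topology_eq : (inferInstance : TopologicalSpace (SmoothFun J X F)) =
    ⨅ i : atlas H X × ℕ, TopologicalSpace.induced (SmoothFun.jet (J := J) (F := F) i.1 i.2)
      inferInstance := by
  apply le_antisymm
  · refine le_iInf fun i => continuous_iff_le_induced.1 ?_
    rw [ContinuousMap.compactOpen_eq, continuous_generateFrom_iff]
    rintro _ ⟨K, hK, O, hO, rfl⟩
    refine TopologicalSpace.isOpen_generateFrom_of_mem ⟨i.1.1, i.1.2, i.2, Subtype.val '' K, O,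
      hK.image continuous_subtype_val, by rintro _ ⟨z, -, rfl⟩; exact z.2, hO, ?_⟩
    ext f
    constructor
    · rintro h _ ⟨z, hz, rfl⟩
      exact h hz
    · intro h z hz
      exact h z ⟨z, hz, rfl⟩
  · refine le_generateFrom ?_
    rintro _ ⟨φ, hφ, k, C, O, hC, hCs, hO, rfl⟩
    have h1 : IsCompact (Subtype.val ⁻¹' C : Set ((J.toFun '' φ.target) ×ˢ
        (univ : Set (Fin k → E)) : Set (E × (Fin k → E)))) := by
      rw [Subtype.isCompact_iff, Subtype.image_preimage_coe, inter_eq_right.2 hCs]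
      exact hC
    have h2 := (ContinuousMap.isOpen_setOfPred_mapsTo h1 hO)
    refine (iInf_le (fun i : atlas H X × ℕ => TopologicalSpace.induced
      (SmoothFun.jet (J := J) (F := F) i.1 i.2) inferInstance) (⟨φ, hφ⟩, k)) _ ?_
    refine isOpen_induced_iff.2 ⟨_, h2, ?_⟩
    ext f
    symm
    constructor
    · intro h z hz
      exact h z.1 hz
    · intro h z hz
      exact h (x := ⟨z, hCs hz⟩) hz

theorem SmoothFun.tendsto_iff {ι : Type*} {l : Filter ι} {g : ι → SmoothFun J X F}
    {g₀ : SmoothFun J X F} : Tendsto g l (𝓝 g₀) ↔ ∀ (φ : atlas H X) (k : ℕ),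
      Tendsto (fun i => SmoothFun.jet φ k (g i)) l (𝓝 (SmoothFun.jet φ k g₀)) := by
  have h : 𝓝 g₀ = ⨅ i : atlas H X × ℕ,
      Filter.comap (SmoothFun.jet i.1 i.2) (𝓝 (SmoothFun.jet i.1 i.2 g₀)) := by
    conv_lhs => rw [show (instTopologicalSpaceSmoothFun J X F : TopologicalSpace (SmoothFun J X F)) = _
      from SmoothFun.topology_eq]
    rw [nhds_iInf]
    simp only [nhds_induced]
  rw [h, tendsto_iInf]
  simp only [tendsto_comap_iff, Prod.forall, Function.comp_def]

theorem SmoothFun.continuous_jet (φ : atlas H X) (k : ℕ) :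
    Continuous (SmoothFun.jet (J := J) (F := F) φ k) :=
  continuous_iff_continuousAt.2 fun _ => SmoothFun.tendsto_iff.1 tendsto_id φ k

theorem SmoothFun.continuous_eval_const (x : X) : Continuous fun f : SmoothFun J X F => f x := by
  let φ : atlas H X := ⟨chartAt H x, chart_mem_atlas H x⟩
  have hz : (J.toFun (chartAt H x x), (0 : Fin 0 → E)) ∈
      (J.toFun '' φ.1.target) ×ˢ (univ : Set (Fin 0 → E)) :=
    ⟨⟨_, (chartAt H x).map_source (mem_chart_source H x), rfl⟩, mem_univ _⟩
  have h1 : Continuous fun f : SmoothFun J X F => SmoothFun.jet φ 0 f ⟨_, hz⟩ :=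
    (ContinuousEvalConst.continuous_eval_const _).comp (SmoothFun.continuous_jet φ 0)
  convert h1 using 2 with f
  change f x = f ((chartAt H x).symm (J.invFun (J.toFun (chartAt H x x))))
  rw [J.left_inv, (chartAt H x).left_inv (mem_chart_source H x)]

instance instIsLCSSmoothFun : IsLCS (SmoothFun J X F) where
  toIsTopologicalAddGroup := by
    rw [show (instTopologicalSpaceSmoothFun J X F : TopologicalSpace (SmoothFun J X F)) = _
      from SmoothFun.topology_eq]
    exact topologicalAddGroup_iInf fun i => topologicalAddGroup_induced _
  toContinuousSMul := by
    rw [show (instTopologicalSpaceSmoothFun J X F : TopologicalSpace (SmoothFun J X F)) = _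
      from SmoothFun.topology_eq]
    exact continuousSMul_iInf fun i => continuousSMul_induced _
  toLocallyConvexSpace := by
    rw [show (instTopologicalSpaceSmoothFun J X F : TopologicalSpace (SmoothFun J X F)) = _
      from SmoothFun.topology_eq]
    exact LocallyConvexSpace.iInf fun i => LocallyConvexSpace.induced _
  toT2Space := T2Space.of_injective_continuous (f := fun (f : SmoothFun J X F) (x : X) => f x)
    (fun _ _ h => SmoothFun.ext fun x => congrFun h x)
    (continuous_pi fun x => SmoothFun.continuous_eval_const x)

/-- Evaluation in a point, as a continuous linear map. -/
def SmoothFun.evalCLM (x : X) : SmoothFun J X F →L[ℝ] F :=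
  ⟨⟨⟨fun f => f x, fun _ _ => rfl⟩, fun _ _ => rfl⟩, SmoothFun.continuous_eval_const x⟩

end Topology

/-- Joint convergence at each point of a compact set `K` gives one index set valid on a
neighbourhood of `K`. Local compactness of `Y` is not involved. -/
theorem tendsto_compactOpen_of_prod {ι Y Z : Type*} [TopologicalSpace Y] [TopologicalSpace Z]
    {l : Filter ι} {q : ι → C(Y, Z)} {g : C(Y, Z)}
    (h : ∀ y, Tendsto (fun p : ι × Y => q p.1 p.2) (l ×ˢ 𝓝 y) (𝓝 (g y))) :
    Tendsto q l (𝓝 g) := by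
  rw [ContinuousMap.tendsto_nhds_compactOpen]
  intro K hK O hO hg
  have h1 := hK.mem_prod_nhdsSet_of_forall (l := l) (s := {p : ι × Y | q p.1 p.2 ∈ O})
    (fun y hy => h y (hO.mem_nhds (hg hy)))
  obtain ⟨A, hA, B, hB, hAB⟩ := Filter.mem_prod_iff.1 h1
  filter_upwards [hA] with i hi y hy
  exact hAB (mk_mem_prod hi (subset_of_mem_nhdsSet hB hy))

/-! ### Exponential law and smooth evaluation on vector space domains. -/

section ExponentialLaw

variable {E : Type*} [AddCommGroup E] [Module ℝ E] [TopologicalSpace E] [IsLCS E]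
  {H : Type*} [TopologicalSpace H] {J : LCModel E H}
  {X : Type*} [TopologicalSpace X] [ChartedSpace H X]
  {F : Type*} [AddCommGroup F] [Module ℝ F] [TopologicalSpace F] [IsLCS F]

/-- A map into `C^∞(X,F)` is continuous if it is jointly smooth. -/
theorem SmoothFun.continuousOn_of_uncurry {P : Type*} [AddCommGroup P] [Module ℝ P]
    [TopologicalSpace P] [IsLCS P] {W : Set P} (hW : Good W) {G : P → SmoothFun J X F}
    (hG : ∀ φ ∈ atlas H X, CInfOn (fun p : P × E => G p.1 (φ.symm (J.invFun p.2)))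
      (W ×ˢ (J.toFun '' φ.target))) : ContinuousOn G W := by
  intro w hw
  refine SmoothFun.tendsto_iff.2 fun φ k => ?_
  have h1 := (iterDiff_param_cInfOn hW (J.good_image φ.1.open_target) (hG φ.1 φ.2) k).continuousOn
  refine ContinuousMap.continuousOn_of_continuousOn_uncurry
    (fun p => SmoothFun.jet φ k (G p)) ?_ w hw
  exact h1.comp (f := fun q : P × ((J.toFun '' φ.1.target) ×ˢ (univ : Set (Fin k → E)) :
      Set (E × (Fin k → E))) => (q.1, q.2.1)) (Continuous.continuousOn (by fun_prop))
    (fun q hq => ⟨hq.1, q.2.2⟩)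

/-- The differential of `G` is the function-valued map `(w, h) ↦ ∂_w G(w)(·)(h)`, again jointly
smooth, so induction applies. The difference quotients must converge in every jet, uniformly on
compact sets. -/
theorem SmoothFun.cDiffOn_of_uncurry (n : ℕ) {P : Type u} [AddCommGroup P] [Module ℝ P]
    [TopologicalSpace P] [IsLCS P] {W : Set P} (hW : Good W) {G : P → SmoothFun J X F}
    (hG : ∀ φ ∈ atlas H X, CInfOn (fun p : P × E => G p.1 (φ.symm (J.invFun p.2)))
      (W ×ˢ (J.toFun '' φ.target))) : CDiffOn n G W := by
  induction n generalizing P with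
  | zero => exact SmoothFun.continuousOn_of_uncurry hW hG
  | succ n ih =>
    have hU : ∀ φ : OpenPartialHomeomorph X H, Good (J.toFun '' φ.target) := fun φ =>
      J.good_image φ.open_target
    let dG : P × P → X → F := fun p x => extDiff (fun w' => G w' x) W p
    have hdG : ∀ φ ∈ atlas H X, CInfOn (fun p : (P × P) × E => dG p.1 (φ.symm (J.invFun p.2)))
        ((W ×ˢ univ) ×ˢ (J.toFun '' φ.target)) := by
      intro φ hφ
      have hs := hG φ hφ
      have hD := hs.isDifferentialOn (hW.prod (hU φ))
      have key := CInfOn.comp ((hW.prod (hU φ)).prod good_univ)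
        ((hW.prod good_univ).prod (hU φ)) (hs.extDiff (hW.prod (hU φ)))
        (cInfOn_of_linear (U := (W ×ˢ (univ : Set P)) ×ˢ (J.toFun '' φ.target))
          (fun q : (P × P) × E => (((q.1.1, q.2), (q.1.2, 0)) : (P × E) × (P × E)))
          (fun q q' => by ext <;> simp) (fun c q => by ext <;> simp) (by fun_prop))
        (fun q hq => ⟨⟨hq.1.1, hq.2⟩, mem_univ _⟩)
      refine key.congr ?_
      rintro ⟨⟨w, h⟩, y⟩ ⟨⟨hw, -⟩, hy⟩
      exact ((hD.partial_fst hW (hU φ) hs.continuousOn hy).extDiff_eq hW hw h).symm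
    have hsm : ∀ p ∈ W ×ˢ (univ : Set P), Smooth J (LCModel.self F) (dG p) := fun p hp =>
      smooth_of_cInfOn_chart fun φ hφ =>
        (hdG φ hφ).partial_snd (hW.prod good_univ) (hU φ) hp
    classical
    -- Smoothness of `dG p` is known only for `p` in `W ×ˢ univ`; elsewhere a value is irrelevant.
    let D : P × P → SmoothFun J X F := fun p => if hp : p ∈ W ×ˢ (univ : Set P)
      then ⟨dG p, hsm p hp⟩ else 0
    have hDval : ∀ p ∈ W ×ˢ (univ : Set P), ∀ x, D p x = dG p x := by
      intro p hp x
      have : D p = ⟨dG p, hsm p hp⟩ := dif_pos hp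
      rw [this]
    have hDs : ∀ φ ∈ atlas H X, CInfOn (fun p : (P × P) × E => D p.1 (φ.symm (J.invFun p.2)))
        ((W ×ˢ univ) ×ˢ (J.toFun '' φ.target)) := fun φ hφ =>
      (hdG φ hφ).congr fun q hq => (hDval _ hq.1 _).symm
    refine ⟨SmoothFun.continuousOn_of_uncurry hW hG, D,
      ⟨SmoothFun.continuousOn_of_uncurry (hW.prod good_univ) hDs, fun w hwi h => ?_⟩,
      ih (hW.prod good_univ) hDs⟩
    have hw : w ∈ W := interior_subset hwi
    refine SmoothFun.tendsto_iff.2 fun φ k => tendsto_compactOpen_of_prod fun z => ?_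
    have hs := hG φ.1 φ.2
    have hk := iterDiff_param_cInfOn hW (hU φ.1) hs k
    have hWk : Good (W ×ˢ ((J.toFun '' φ.1.target) ×ˢ (univ : Set (Fin k → E)))) :=
      hW.prod ((hU φ.1).prod good_univ)
    have hDk := hk.isDifferentialOn hWk
    have t1 : Tendsto (fun t : ℝ => w + t • h) (𝓝[≠] 0) (𝓝 w) := by
      have : Tendsto (fun t : ℝ => w + t • h) (𝓝 0) (𝓝 (w + (0 : ℝ) • h)) :=
        Continuous.tendsto (by fun_prop) _
      simp only [zero_smul, add_zero] at this
      exact this.mono_left nhdsWithin_le_nhds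
    -- The point `q.2` varies together with the step `q.1`; this is the joint convergence that
    -- yields uniformity on compact sets.
    have key := hDk.strict hWk hk.continuousOn (x := (w, z.1)) (h := (h, 0)) ⟨hw, z.2⟩
      (l := (𝓝[≠] (0 : ℝ)) ×ˢ 𝓝 z) (a := fun q => (w, q.2.1)) (b := fun _ => (h, 0))
      (t := fun q => q.1)
      (tendsto_const_nhds.prodMk_nhds ((continuous_subtype_val.tendsto z).comp tendsto_snd))
      tendsto_const_nhds ((tendsto_id.mono_left nhdsWithin_le_nhds).comp tendsto_fst)
      (Eventually.of_forall fun q => ⟨hw, q.2.2⟩)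
      (by
        filter_upwards [tendsto_fst.eventually (t1 (mem_interior_iff_mem_nhds.1 hwi))] with q hq
        refine ⟨hq, ?_⟩
        simp) (tendsto_fst.eventually self_mem_nhdsWithin)
    have e : SmoothFun.jet φ k (D (w, h)) z =
        extDiff (fun q : P × (E × (Fin k → E)) => iterDiff (J.toFun '' φ.1.target)
          (fun y => G q.1 (φ.1.symm (J.invFun y))) k q.2.1 q.2.2)
          (W ×ˢ ((J.toFun '' φ.1.target) ×ˢ univ)) ((w, z.1), (h, 0)) := by
      rw [← (hDk.partial_fst hW ((hU φ.1).prod good_univ) hk.continuousOn z.2).extDiff_eq hW hw h]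
      refine (iterDiff_congr (fun y hy => hDval (w, h) ⟨hw, mem_univ _⟩ _) k z.2.1 z.1.2).trans ?_
      exact iterDiff_extDiff_param hW (hU φ.1) hs hw h k z.2.1 z.1.2
    rw [e]
    refine key.congr fun q => ?_
    rw [map_smul, map_sub]
    simp only [Prod.smul_mk, Prod.mk_add_mk, smul_zero, add_zero]
    rfl

/-- The exponential law: a map into `C^∞(X,F)` is smooth if it is jointly smooth. -/
theorem SmoothFun.cInfOn_of_uncurry {P : Type*} [AddCommGroup P] [Module ℝ P]
    [TopologicalSpace P] [IsLCS P] {W : Set P} (hW : Good W) {G : P → SmoothFun J X F}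
    (hG : ∀ φ ∈ atlas H X, CInfOn (fun p : P × E => G p.1 (φ.symm (J.invFun p.2)))
      (W ×ˢ (J.toFun '' φ.target))) : CInfOn G W :=
  fun n => SmoothFun.cDiffOn_of_uncurry n hW hG

theorem CDiffOn.sum {E : Type u} [AddCommGroup E] [Module ℝ E] [TopologicalSpace E]
    {F : Type v} [AddCommGroup F] [Module ℝ F] [TopologicalSpace F] [IsLCS F]
    (n : ℕ) {ι : Type*} (s : Finset ι) {f : ι → E → F} {U : Set E}
    (hf : ∀ i, CDiffOn n (f i) U) : CDiffOn n (fun x => ∑ i ∈ s, f i x) U := by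
  classical
  induction s using Finset.induction_on with
  | empty => simpa using CDiffOn.const n (0 : F)
  | insert i s hi ih =>
    simp only [Finset.sum_insert hi]
    exact (hf i).add n ih

/-- The expression is linear in the function, and its differential in the point involves the
differentials of orders `k` and `k + 1`. Hence the induction on `n` treats all `k` simultaneously.
-/
theorem SmoothFun.cDiffOn_jet [LocallyCompactSpace E] (n : ℕ) {φ : OpenPartialHomeomorph X H}
    (hφ : φ ∈ atlas H X) (k : ℕ) :
    CDiffOn n (fun q : SmoothFun J X F × (E × (Fin k → E)) => iterDiff (J.toFun '' φ.target)
      (fun x => q.1 (φ.symm (J.invFun x))) k q.2.1 q.2.2)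
      (univ ×ˢ ((J.toFun '' φ.target) ×ˢ univ)) := by
  set U := J.toFun '' φ.target with hUdef
  have hU : Good U := J.good_image φ.open_target
  have hcont : ∀ k, ContinuousOn (fun q : SmoothFun J X F × (E × (Fin k → E)) => iterDiff U
      (fun x => q.1 (φ.symm (J.invFun x))) k q.2.1 q.2.2) (univ ×ˢ (U ×ˢ univ)) := by
    intro k
    -- Local compactness of the domain makes evaluation continuous for the compact open topology.
    have hlc : IsLocallyClosed (U ×ˢ (univ : Set (Fin k → E))) := by
      rw [hUdef, J.image_eq, ← univ_inter (univ : Set (Fin k → E)), ← prod_inter_prod]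
      exact (J.isClosed_range.prod isClosed_univ).isLocallyClosed.inter
        ((φ.open_target.preimage J.continuous_invFun).prod isOpen_univ).isLocallyClosed
    have : LocallyCompactSpace (U ×ˢ (univ : Set (Fin k → E)) : Set (E × (Fin k → E))) :=
      IsInducing.subtypeVal.locallyCompactSpace (by rwa [Subtype.range_val])
    have h1 : Continuous fun q : SmoothFun J X F × (U ×ˢ (univ : Set (Fin k → E)) :
        Set (E × (Fin k → E))) => SmoothFun.jet ⟨φ, hφ⟩ k q.1 q.2 :=
      ((SmoothFun.continuous_jet ⟨φ, hφ⟩ k).comp continuous_fst).eval continuous_snd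
    rw [continuousOn_iff_continuous_domRestrict]
    exact h1.comp (f := fun q : (univ ×ˢ (U ×ˢ (univ : Set (Fin k → E))) :
      Set (SmoothFun J X F × (E × (Fin k → E)))) => (q.1.1, ⟨q.1.2, q.2.2⟩))
      (by fun_prop)
  induction n generalizing k with
  | zero => exact hcont k
  | succ n ih =>
    have hG : ∀ k, Good ((univ : Set (SmoothFun J X F)) ×ˢ (U ×ˢ (univ : Set (Fin k → E)))) :=
      fun k => good_univ.prod (hU.prod good_univ)
    let A : (k : ℕ) → SmoothFun J X F × (E × (Fin k → E)) → F := fun k q =>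
      iterDiff U (fun x => q.1 (φ.symm (J.invFun x))) k q.2.1 q.2.2
    -- With `q = ((f, (x, h)), (g, (y, v)))`, the first summand is the derivative in the function,
    -- and the rest is `extDiff_iterDiff` applied to `f`.
    let D : (SmoothFun J X F × (E × (Fin k → E))) × (SmoothFun J X F × (E × (Fin k → E))) → F :=
      fun q => A k (q.2.1, q.1.2) + (A (k + 1) (q.1.1, (q.1.2.1, Fin.cons q.2.2.1 q.1.2.2)) +
        ∑ i, A k (q.1.1, (q.1.2.1, Function.update q.1.2.2 i (q.2.2.2 i))))
    have hD : ∀ m, (∀ j, CDiffOn m (A j) (univ ×ˢ (U ×ˢ univ))) →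
        CDiffOn m D ((univ ×ˢ (U ×ˢ univ)) ×ˢ univ) := by
      intro m hA
      refine CDiffOn.add m ?_ (CDiffOn.add m ?_ (CDiffOn.sum m _ fun i => ?_))
      · exact (hA k).comp m (hG k) ((hG k).prod good_univ) (cInfOn_of_linear (fun q :
          (SmoothFun J X F × (E × (Fin k → E))) × (SmoothFun J X F × (E × (Fin k → E))) =>
          (q.2.1, q.1.2)) (fun _ _ => rfl) (fun _ _ => rfl) (by fun_prop) m)
          (fun q hq => ⟨mem_univ _, hq.1.2⟩)
      · refine (hA (k + 1)).comp m (hG (k + 1)) ((hG k).prod good_univ) (cInfOn_of_linear (fun q :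
          (SmoothFun J X F × (E × (Fin k → E))) × (SmoothFun J X F × (E × (Fin k → E))) =>
          (q.1.1, (q.1.2.1, (Fin.cons q.2.2.1 q.1.2.2 : Fin (k + 1) → E))))
          (fun q q' => ?_) (fun c q => ?_) ?_ m)
          (fun q hq => ⟨mem_univ _, hq.1.2.1, mem_univ _⟩)
        · refine Prod.ext rfl (Prod.ext rfl (funext fun j => ?_))
          refine Fin.cases ?_ (fun j => ?_) j <;> simp
        · refine Prod.ext rfl (Prod.ext rfl (funext fun j => ?_))
          refine Fin.cases ?_ (fun j => ?_) j <;> simp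
        · refine (by fun_prop : Continuous _).prodMk ((by fun_prop : Continuous _).prodMk
            (continuous_pi fun j => ?_))
          refine Fin.cases ?_ (fun j => ?_) j
          · simp only [Fin.cons_zero]; fun_prop
          · simp only [Fin.cons_succ]; fun_prop
      · refine (hA k).comp m (hG k) ((hG k).prod good_univ) (cInfOn_of_linear (fun q :
          (SmoothFun J X F × (E × (Fin k → E))) × (SmoothFun J X F × (E × (Fin k → E))) =>
          (q.1.1, (q.1.2.1, Function.update q.1.2.2 i (q.2.2.2 i))))
          (fun q q' => ?_) (fun c q => ?_) ?_ m)
          (fun q hq => ⟨mem_univ _, hq.1.2.1, mem_univ _⟩)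
        · refine Prod.ext rfl (Prod.ext rfl (funext fun j => ?_))
          rcases eq_or_ne j i with rfl | hj
          · simp
          · simp [hj]
        · refine Prod.ext rfl (Prod.ext rfl (funext fun j => ?_))
          rcases eq_or_ne j i with rfl | hj
          · simp
          · simp [hj]
        · fun_prop
    refine ⟨hcont k, D, ⟨(hD 0 hcont).continuousOn, ?_⟩, hD n fun j => ih j⟩
    rintro ⟨f, z⟩ hfz ⟨g, ζ⟩
    have hz : z ∈ U ×ˢ (univ : Set (Fin k → E)) := (interior_subset hfz).2
    have hzi : z ∈ interior (U ×ˢ (univ : Set (Fin k → E))) := by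
      rw [interior_prod_eq] at hfz
      exact hfz.2
    have hsf := iterDiff_cInfOn hU (f.cInfOn hφ) k
    have t1 : Tendsto (fun t : ℝ => z + t • ζ) (𝓝[≠] 0) (𝓝 z) := by
      have : Tendsto (fun t : ℝ => z + t • ζ) (𝓝 0) (𝓝 (z + (0 : ℝ) • ζ)) :=
        Continuous.tendsto (by fun_prop) _
      simp only [zero_smul, add_zero] at this
      exact this.mono_left nhdsWithin_le_nhds
    have ev := t1 (mem_interior_iff_mem_nhds.1 hzi)
    have h2 := (hsf.isDifferentialOn (hU.prod good_univ)).hasDirDeriv z hzi ζ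
    rw [show extDiff _ _ (z, ζ) = _ from extDiff_iterDiff hU (f.cInfOn hφ) k hz.1 z.2 ζ.1 ζ.2] at h2
    have h1 : Tendsto (fun t : ℝ => A k (g, z + t • ζ)) (𝓝[≠] 0) (𝓝 (A k (g, z))) :=
      ((iterDiff_cInfOn hU (g.cInfOn hφ) k).continuousOn.continuousAt
        (mem_interior_iff_mem_nhds.1 hzi)).tendsto.comp t1
    refine (h1.add h2).congr' ?_
    filter_upwards [self_mem_nhdsWithin, ev] with t ht htU
    have ht' : t ≠ 0 := ht
    have e : A k ((f, z) + t • (g, ζ)) = A k (f, z + t • ζ) + t • A k (g, z + t • ζ) := by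
      refine (iterDiff_add hU (f.cInfOn hφ) ((t • g).cInfOn hφ) k htU.1 _).trans ?_
      congr 1
      exact iterDiff_const_smul hU (g.cInfOn hφ) t k htU.1 _
    change A k (g, z + t • ζ) + t⁻¹ • (A k (f, z + t • ζ) - A k (f, z)) =
      t⁻¹ • (A k ((f, z) + t • (g, ζ)) - A k (f, z))
    rw [e, add_sub_right_comm, smul_add, inv_smul_smul₀ ht', add_comm]

/-- The evaluation map is smooth in charts. -/
theorem SmoothFun.cInfOn_eval [LocallyCompactSpace E] {φ : OpenPartialHomeomorph X H}
    (hφ : φ ∈ atlas H X) :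
    CInfOn (fun q : SmoothFun J X F × E => q.1 (φ.symm (J.invFun q.2)))
      (univ ×ˢ (J.toFun '' φ.target)) := by
  have hU : Good (J.toFun '' φ.target) := J.good_image φ.open_target
  exact CInfOn.comp (good_univ.prod (hU.prod good_univ)) (good_univ.prod hU)
    (fun n => SmoothFun.cDiffOn_jet n hφ 0) (f := fun q : SmoothFun J X F × E => (q.1, (q.2, 0)))
    (cInfOn_fst.prodMk (cInfOn_snd.prodMk (cInfOn_const _)))
    (fun q hq => ⟨mem_univ _, hq.2, mem_univ _⟩)

end ExponentialLaw

/-! ### Smoothness at a point of a manifold. -/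

section Defs

variable {E : Type*} [AddCommGroup E] [Module ℝ E] [TopologicalSpace E]
  {H : Type*} [TopologicalSpace H]
  {E' : Type*} [AddCommGroup E'] [Module ℝ E'] [TopologicalSpace E']
  {H' : Type*} [TopologicalSpace H']

/-- The changes of charts of `X` are smooth. -/
class Compat (J : LCModel E H) (X : Type*) [TopologicalSpace X] [ChartedSpace H X] : Prop where
  compatible : ∀ φ ∈ atlas H X, ∀ ψ ∈ atlas H X,
    CInfOn (fun x => J.toFun (ψ (φ.symm (J.invFun x))))
      (J.toFun '' (φ.target ∩ φ.symm ⁻¹' ψ.source))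

/-- `f` is smooth in suitable charts on a neighbourhood of `x`. -/
def SmAt (J : LCModel E H) (J' : LCModel E' H') {X Y : Type*}
    [TopologicalSpace X] [ChartedSpace H X] [TopologicalSpace Y] [ChartedSpace H' Y]
    (f : X → Y) (x : X) : Prop :=
  ∃ φ ∈ atlas H X, ∃ ψ ∈ atlas H' Y, ∃ V : Set X, IsOpen V ∧ x ∈ V ∧ V ⊆ φ.source ∧
    MapsTo f V ψ.source ∧
    CInfOn (fun e => J'.toFun (ψ (f (φ.symm (J.invFun e))))) (J.toFun '' (φ '' V))

end Defs

/-! ### Change of charts, compositions and charts as smooth maps. -/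

section Basic

variable {E : Type*} [AddCommGroup E] [Module ℝ E] [TopologicalSpace E] [IsLCS E]
  {H : Type*} [TopologicalSpace H] {J : LCModel E H}
  {E' : Type*} [AddCommGroup E'] [Module ℝ E'] [TopologicalSpace E'] [IsLCS E']
  {H' : Type*} [TopologicalSpace H'] {J' : LCModel E' H'}
  {E'' : Type*} [AddCommGroup E''] [Module ℝ E''] [TopologicalSpace E''] [IsLCS E'']
  {H'' : Type*} [TopologicalSpace H''] {J'' : LCModel E'' H''}
  {X : Type*} [TopologicalSpace X] [ChartedSpace H X]
  {Y : Type*} [TopologicalSpace Y] [ChartedSpace H' Y]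
  {Z : Type*} [TopologicalSpace Z] [ChartedSpace H'' Z]

theorem good_chart_image (J : LCModel E H) {φ : OpenPartialHomeomorph X H} {V : Set X}
    (hV : IsOpen V) (hVφ : V ⊆ φ.source) : Good (J.toFun '' (φ '' V)) :=
  J.good_image (φ.isOpen_image_of_subset_source hV hVφ)

theorem continuousOn_of_chart {φ : OpenPartialHomeomorph X H} {ψ : OpenPartialHomeomorph Y H'}
    {f : X → Y} {V : Set X} (hVφ : V ⊆ φ.source) (hf : MapsTo f V ψ.source)
    (h : ContinuousOn (fun e => J'.toFun (ψ (f (φ.symm (J.invFun e))))) (J.toFun '' (φ '' V))) :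
    ContinuousOn f V := by
  have h1 : ContinuousOn (fun y => J'.toFun (ψ (f (φ.symm (J.invFun (J.toFun (φ y))))))) V :=
    h.comp (f := fun y => J.toFun (φ y))
      (J.continuous_toFun.comp_continuousOn (φ.continuousOn.mono hVφ))
      (fun y hy => ⟨_, ⟨y, hy, rfl⟩, rfl⟩)
  have h2 : ContinuousOn (fun y => ψ.symm (J'.invFun (J'.toFun (ψ (f (φ.symm (J.invFun
      (J.toFun (φ y))))))))) V := by
    refine ψ.symm.continuousOn.comp (J'.continuous_invFun.comp_continuousOn h1) fun y hy => ?_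
    rw [J.left_inv, φ.left_inv (hVφ hy), J'.left_inv]
    exact ψ.map_source (hf hy)
  refine h2.congr fun y hy => ?_
  simp only [J.left_inv, φ.left_inv (hVφ hy), J'.left_inv, ψ.left_inv (hf hy)]

theorem SmAt.continuousAt {f : X → Y} {x : X} (h : SmAt J J' f x) : ContinuousAt f x := by
  obtain ⟨φ, hφ, ψ, hψ, V, hV, hxV, hVφ, hfV, hs⟩ := h
  exact (continuousOn_of_chart hVφ hfV hs.continuousOn).continuousAt (hV.mem_nhds hxV)

theorem SmAt.eventually {f : X → Y} {x : X} (h : SmAt J J' f x) : ∀ᶠ y in 𝓝 x, SmAt J J' f y := by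
  obtain ⟨φ, hφ, ψ, hψ, V, hV, hxV, hVφ, hfV, hs⟩ := h
  filter_upwards [hV.mem_nhds hxV] with y hy
  exact ⟨φ, hφ, ψ, hψ, V, hV, hy, hVφ, hfV, hs⟩

/-- The target chart is replaced by composing with a chart change of `Y`. The source chart is left
alone, so nothing is required of the atlas of `X`. -/
theorem SmAt.exists_target [Compat J' Y] {f : X → Y} {x : X} (h : SmAt J J' f x)
    {ψ' : OpenPartialHomeomorph Y H'} (hψ' : ψ' ∈ atlas H' Y) (hx : f x ∈ ψ'.source) :
    ∃ φ ∈ atlas H X, ∃ V : Set X, IsOpen V ∧ x ∈ V ∧ V ⊆ φ.source ∧ MapsTo f V ψ'.source ∧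
      CInfOn (fun e => J'.toFun (ψ' (f (φ.symm (J.invFun e))))) (J.toFun '' (φ '' V)) := by
  obtain ⟨φ, hφ, ψ, hψ, V, hV, hxV, hVφ, hfV, hs⟩ := h
  have hc := continuousOn_of_chart hVφ hfV hs.continuousOn
  have hV' : IsOpen (V ∩ f ⁻¹' ψ'.source) := hc.isOpen_inter_preimage hV ψ'.open_source
  have hsub : V ∩ f ⁻¹' ψ'.source ⊆ φ.source := inter_subset_left.trans hVφ
  refine ⟨φ, hφ, V ∩ f ⁻¹' ψ'.source, hV', ⟨hxV, hx⟩, hsub, fun y hy => hy.2, ?_⟩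
  have hT := Compat.compatible (J := J') ψ hψ ψ' hψ'
  have hs' := hs.mono (image_mono (image_mono (inter_subset_left (s := V) (t := f ⁻¹' ψ'.source))))
  have key := CInfOn.comp (J'.good_image (ψ.isOpen_inter_preimage_symm ψ'.open_source))
    (good_chart_image J hV' hsub) hT hs' ?_
  · refine key.congr ?_
    rintro _ ⟨_, ⟨y, hy, rfl⟩, rfl⟩
    simp only [J.left_inv, φ.left_inv (hVφ hy.1), J'.left_inv, ψ.left_inv (hfV hy.1)]
  · rintro _ ⟨_, ⟨y, hy, rfl⟩, rfl⟩
    refine ⟨_, ⟨?_, ?_⟩, rfl⟩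
    · simp only [J.left_inv, φ.left_inv (hVφ hy.1)]
      exact ψ.map_source (hfV hy.1)
    · simp only [J.left_inv, φ.left_inv (hVφ hy.1), mem_preimage, ψ.left_inv (hfV hy.1)]
      exact hy.2

theorem SmAt.exists_source_target [Compat J X] [Compat J' Y] {f : X → Y} {x : X}
    (h : SmAt J J' f x) {φ' : OpenPartialHomeomorph X H} (hφ' : φ' ∈ atlas H X)
    (hxφ : x ∈ φ'.source) {ψ' : OpenPartialHomeomorph Y H'} (hψ' : ψ' ∈ atlas H' Y)
    (hx : f x ∈ ψ'.source) :
    ∃ V : Set X, IsOpen V ∧ x ∈ V ∧ V ⊆ φ'.source ∧ MapsTo f V ψ'.source ∧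
      CInfOn (fun e => J'.toFun (ψ' (f (φ'.symm (J.invFun e))))) (J.toFun '' (φ' '' V)) := by
  obtain ⟨φ, hφ, V, hV, hxV, hVφ, hfV, hs⟩ := h.exists_target hψ' hx
  have hV' : IsOpen (V ∩ φ'.source) := hV.inter φ'.open_source
  refine ⟨V ∩ φ'.source, hV', ⟨hxV, hxφ⟩, inter_subset_right, fun y hy => hfV hy.1, ?_⟩
  have hT := (Compat.compatible (J := J) φ' hφ' φ hφ).mono (V := J.toFun '' (φ' '' (V ∩ φ'.source)))
    (image_mono (by
      rintro _ ⟨y, hy, rfl⟩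
      exact ⟨φ'.map_source hy.2, by simpa [φ'.left_inv hy.2] using hVφ hy.1⟩))
  have key := CInfOn.comp (good_chart_image J hV hVφ) (good_chart_image J hV' inter_subset_right)
    hs hT ?_
  · refine key.congr ?_
    rintro _ ⟨_, ⟨y, hy, rfl⟩, rfl⟩
    simp only [J.left_inv, φ'.left_inv hy.2, φ.left_inv (hVφ hy.1)]
  · rintro _ ⟨_, ⟨y, hy, rfl⟩, rfl⟩
    simp only [J.left_inv, φ'.left_inv hy.2]
    exact ⟨_, ⟨y, hy.1, rfl⟩, rfl⟩

/-- Only the middle manifold needs compatible charts: its two charts, one from each map, have to be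
matched. -/
theorem SmAt.comp [Compat J' Y] {g : Y → Z} {f : X → Y} {x : X} (hg : SmAt J' J'' g (f x))
    (hf : SmAt J J' f x) : SmAt J J'' (fun y => g (f y)) x := by
  obtain ⟨ψ, hψ, χ, hχ, W, hW, hxW, hWψ, hgW, hsg⟩ := hg
  obtain ⟨φ, hφ, V, hV, hxV, hVφ, hfV, hs⟩ := hf.exists_target hψ (hWψ hxW)
  have hc := continuousOn_of_chart hVφ hfV hs.continuousOn
  have hV' : IsOpen (V ∩ f ⁻¹' W) := hc.isOpen_inter_preimage hV hW
  have hsub : V ∩ f ⁻¹' W ⊆ φ.source := inter_subset_left.trans hVφ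
  refine ⟨φ, hφ, χ, hχ, V ∩ f ⁻¹' W, hV', ⟨hxV, hxW⟩, hsub, fun y hy => hgW hy.2, ?_⟩
  have key := CInfOn.comp (good_chart_image J' hW hWψ) (good_chart_image J hV' hsub)
    hsg (hs.mono (image_mono (image_mono (inter_subset_left (s := V) (t := f ⁻¹' W))))) ?_
  · refine key.congr ?_
    rintro _ ⟨_, ⟨y, hy, rfl⟩, rfl⟩
    simp only [J.left_inv, φ.left_inv (hVφ hy.1), J'.left_inv, ψ.left_inv (hfV hy.1)]
  · rintro _ ⟨_, ⟨y, hy, rfl⟩, rfl⟩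
    simp only [J.left_inv, φ.left_inv (hVφ hy.1)]
    exact ⟨_, ⟨_, hy.2, rfl⟩, rfl⟩

theorem SmAt.congr {f g : X → Y} {x : X} (hf : SmAt J J' f x) (h : f =ᶠ[𝓝 x] g) :
    SmAt J J' g x := by
  obtain ⟨φ, hφ, ψ, hψ, V, hV, hxV, hVφ, hfV, hs⟩ := hf
  obtain ⟨O, hOs, hO, hxO⟩ := mem_nhds_iff.1 h
  refine ⟨φ, hφ, ψ, hψ, V ∩ O, hV.inter hO, ⟨hxV, hxO⟩, inter_subset_left.trans hVφ,
    fun y hy => ?_, ?_⟩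
  · rw [← hOs hy.2]
    exact hfV hy.1
  · refine (hs.mono (image_mono (image_mono inter_subset_left))).congr ?_
    rintro _ ⟨_, ⟨y, hy, rfl⟩, rfl⟩
    simp only [J.left_inv, φ.left_inv (hVφ hy.1)]
    rw [show f y = g y from hOs hy.2]

theorem Smooth.smAt {f : X → Y} (hf : Smooth J J' f) (x : X) : SmAt J J' f x := by
  refine ⟨chartAt H x, chart_mem_atlas H x, chartAt H' (f x), chart_mem_atlas H' (f x),
    (chartAt H x).source ∩ f ⁻¹' (chartAt H' (f x)).source,
    (chartAt H x).open_source.inter ((chartAt H' (f x)).open_source.preimage hf.continuous),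
    ⟨mem_chart_source H x, mem_chart_source H' (f x)⟩, inter_subset_left, fun y hy => hy.2, ?_⟩
  rw [(chartAt H x).image_source_inter_eq']
  exact hf.smooth_charts _ (chart_mem_atlas H x) _ (chart_mem_atlas H' (f x))

theorem cInfOn_of_smAt [Compat J X] [Compat J' Y] {f : X → Y} {φ : OpenPartialHomeomorph X H}
    (hφ : φ ∈ atlas H X) {ψ : OpenPartialHomeomorph Y H'} (hψ : ψ ∈ atlas H' Y) {V : Set X}
    (hV : IsOpen V) (hVφ : V ⊆ φ.source) (hf : MapsTo f V ψ.source) (h : ∀ x ∈ V, SmAt J J' f x) :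
    CInfOn (fun e => J'.toFun (ψ (f (φ.symm (J.invFun e))))) (J.toFun '' (φ '' V)) := by
  refine CInfOn.of_local (good_chart_image J hV hVφ) ?_
  rintro _ ⟨_, ⟨x, hx, rfl⟩, rfl⟩
  obtain ⟨V', hV', hxV', hVφ', -, hs⟩ := (h x hx).exists_source_target hφ (hVφ hx) hψ (hf hx)
  refine ⟨J.invFun ⁻¹' (φ '' V'), (φ.isOpen_image_of_subset_source hV' hVφ').preimage
    J.continuous_invFun, ?_, hs.mono ?_⟩
  · simp only [mem_preimage, J.left_inv]
    exact ⟨x, hxV', rfl⟩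
  · rw [J.image_eq (φ '' V')]
    exact fun y hy => ⟨image_subset_range _ _ hy.1, hy.2⟩

/-- For compatible atlases, smoothness in a single pair of charts around each point implies it in
all charts. All later smoothness proofs therefore use `SmAt`. -/
theorem smooth_iff [Compat J X] [Compat J' Y] {f : X → Y} :
    Smooth J J' f ↔ ∀ x, SmAt J J' f x := by
  refine ⟨fun h x => h.smAt x, fun h => ?_⟩
  have hc : Continuous f := continuous_iff_continuousAt.2 fun x => (h x).continuousAt
  refine ⟨hc, fun φ hφ ψ hψ => ?_⟩
  have h1 := φ.image_source_inter_eq' (f ⁻¹' ψ.source)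
  rw [← h1]
  exact cInfOn_of_smAt hφ hψ (φ.open_source.inter (ψ.open_source.preimage hc)) inter_subset_left
    (fun y hy => hy.2) fun x _ => h x

theorem smAt_id (x : X) : SmAt J J (fun y : X => y) x := by
  refine ⟨chartAt H x, chart_mem_atlas H x, chartAt H x, chart_mem_atlas H x, _,
    (chartAt H x).open_source, mem_chart_source H x, Subset.rfl, fun y hy => hy, ?_⟩
  refine (cInfOn_id).congr ?_
  rintro _ ⟨_, ⟨y, hy, rfl⟩, rfl⟩
  simp only [J.left_inv, (chartAt H x).left_inv hy]

theorem smAt_const (c : Y) (x : X) : SmAt J J' (fun _ : X => c) x :=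
  ⟨chartAt H x, chart_mem_atlas H x, chartAt H' c, chart_mem_atlas H' c, _,
    (chartAt H x).open_source, mem_chart_source H x, Subset.rfl,
    fun _ _ => mem_chart_source H' c, cInfOn_const _⟩

instance instCompatSelf : Compat J H := by
  refine ⟨fun φ hφ ψ hψ => ?_⟩
  obtain rfl : φ = OpenPartialHomeomorph.refl H := by simpa using hφ
  obtain rfl : ψ = OpenPartialHomeomorph.refl H := by simpa using hψ
  refine cInfOn_id.congr ?_
  rintro _ ⟨y, hy, rfl⟩
  simp [J.left_inv]

theorem smAt_chart {φ : OpenPartialHomeomorph X H} (hφ : φ ∈ atlas H X) {x : X}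
    (hx : x ∈ φ.source) : SmAt J J φ x := by
  refine ⟨φ, hφ, OpenPartialHomeomorph.refl H, by simp, φ.source, φ.open_source, hx, Subset.rfl,
    fun _ _ => by simp, cInfOn_id.congr ?_⟩
  rintro _ ⟨_, ⟨y, hy, rfl⟩, rfl⟩
  simp [J.left_inv, φ.left_inv hy]

theorem smAt_chart_symm {φ : OpenPartialHomeomorph X H} (hφ : φ ∈ atlas H X) {a : H}
    (ha : a ∈ φ.target) : SmAt J J φ.symm a := by
  refine ⟨OpenPartialHomeomorph.refl H, by simp, φ, hφ, φ.target, φ.open_target, ha,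
    fun _ _ => by simp, fun y hy => φ.map_target hy, cInfOn_id.congr ?_⟩
  rintro _ ⟨_, ⟨y, hy, rfl⟩, rfl⟩
  simp [J.left_inv, φ.right_inv hy]

theorem smAt_toFun (a : H) : SmAt J (LCModel.self E) J.toFun a := by
  refine ⟨OpenPartialHomeomorph.refl H, by simp, OpenPartialHomeomorph.refl E, by simp, univ,
    isOpen_univ, mem_univ _, fun _ _ => by simp, fun _ _ => by simp, cInfOn_id.congr ?_⟩
  rintro _ ⟨_, ⟨y, hy, rfl⟩, rfl⟩
  simp [J.left_inv, LCModel.self]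

/-- Smoothness of maps into a model. -/
theorem smAt_of_toFun_comp {f : X → H'} {x : X}
    (h : SmAt J (LCModel.self E') (fun y => J'.toFun (f y)) x) : SmAt J J' f x := by
  obtain ⟨φ, hφ, ψ, hψ, V, hV, hxV, hVφ, hfV, hs⟩ := h
  obtain rfl : ψ = OpenPartialHomeomorph.refl E' := by simpa using hψ
  exact ⟨φ, hφ, OpenPartialHomeomorph.refl H', by simp, V, hV, hxV, hVφ, fun _ _ => by simp, hs⟩

end Basic

/-! ### Vector valued smooth maps on manifolds. -/

section Vector

variable {E : Type*} [AddCommGroup E] [Module ℝ E] [TopologicalSpace E] [IsLCS E]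
  {H : Type*} [TopologicalSpace H] {J : LCModel E H}
  {F : Type*} [AddCommGroup F] [Module ℝ F] [TopologicalSpace F] [IsLCS F]
  {F' : Type*} [AddCommGroup F'] [Module ℝ F'] [TopologicalSpace F'] [IsLCS F']
  {X : Type*} [TopologicalSpace X] [ChartedSpace H X]

theorem smAt_of_cInfOn_chart {f : X → F} {φ : OpenPartialHomeomorph X H} (hφ : φ ∈ atlas H X)
    {V : Set X} (hV : IsOpen V) (hVφ : V ⊆ φ.source)
    (h : CInfOn (fun e => f (φ.symm (J.invFun e))) (J.toFun '' (φ '' V))) {x : X} (hx : x ∈ V) :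
    SmAt J (LCModel.self F) f x :=
  ⟨φ, hφ, OpenPartialHomeomorph.refl F, by simp, V, hV, hx, hVφ, fun _ _ => by simp, h⟩

theorem cInfOn_chart_of_smAt [Compat J X] {f : X → F} {φ : OpenPartialHomeomorph X H}
    (hφ : φ ∈ atlas H X) {V : Set X} (hV : IsOpen V) (hVφ : V ⊆ φ.source)
    (h : ∀ x ∈ V, SmAt J (LCModel.self F) f x) :
    CInfOn (fun e => f (φ.symm (J.invFun e))) (J.toFun '' (φ '' V)) :=
  cInfOn_of_smAt (J' := LCModel.self F) (ψ := OpenPartialHomeomorph.refl F) hφ (by simp) hV hVφ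
    (fun _ _ => by simp) h

theorem SmAt.exists_cInfOn [Compat J X] {f : X → F} {x : X} (h : SmAt J (LCModel.self F) f x)
    {φ : OpenPartialHomeomorph X H} (hφ : φ ∈ atlas H X) (hx : x ∈ φ.source) :
    ∃ V : Set X, IsOpen V ∧ x ∈ V ∧ V ⊆ φ.source ∧
      CInfOn (fun e => f (φ.symm (J.invFun e))) (J.toFun '' (φ '' V)) := by
  obtain ⟨V, h1, h2, h3, -, h4⟩ := h.exists_source_target (ψ' := OpenPartialHomeomorph.refl F)
    hφ hx (by simp) (by simp)
  exact ⟨V, h1, h2, h3, h4⟩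

theorem smAt_of_cInfOn_model {f : H → F} {V : Set H} (hV : IsOpen V)
    (h : CInfOn (fun e => f (J.invFun e)) (J.toFun '' V)) {a : H} (ha : a ∈ V) :
    SmAt J (LCModel.self F) f a := by
  refine smAt_of_cInfOn_chart (φ := OpenPartialHomeomorph.refl H) (by simp) hV
    (fun _ _ => by simp) ?_ ha
  simpa using h

theorem SmAt.exists_cInfOn_model {f : H → F} {a : H} (h : SmAt J (LCModel.self F) f a) :
    ∃ V : Set H, IsOpen V ∧ a ∈ V ∧ CInfOn (fun e => f (J.invFun e)) (J.toFun '' V) := by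
  obtain ⟨V, h1, h2, -, h4⟩ := h.exists_cInfOn (φ := OpenPartialHomeomorph.refl H) (by simp)
    (by simp)
  exact ⟨V, h1, h2, by simpa using h4⟩

theorem smAt_of_cInfOn {f : E → F} {O : Set E} (hO : IsOpen O) (h : CInfOn f O) {x : E}
    (hx : x ∈ O) : SmAt (LCModel.self E) (LCModel.self F) f x :=
  smAt_of_cInfOn_model (J := LCModel.self E) hO (by simpa [LCModel.self] using h) hx

theorem smAt_clm (L : E →L[ℝ] F) (x : E) : SmAt (LCModel.self E) (LCModel.self F) L x :=
  smAt_of_cInfOn isOpen_univ (cInfOn_clm L) (mem_univ x)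

theorem SmAt.clm_comp (L : F →L[ℝ] F') {f : X → F} {x : X} (h : SmAt J (LCModel.self F) f x) :
    SmAt J (LCModel.self F') (fun y => L (f y)) x :=
  (smAt_clm L (f x)).comp h

end Vector

/-! ### Product manifolds. -/

section Prod

variable {E : Type*} [AddCommGroup E] [Module ℝ E] [TopologicalSpace E] [IsLCS E]
  {H : Type*} [TopologicalSpace H] {J : LCModel E H}
  {E' : Type*} [AddCommGroup E'] [Module ℝ E'] [TopologicalSpace E'] [IsLCS E']
  {H' : Type*} [TopologicalSpace H'] {J' : LCModel E' H'}
  {E'' : Type*} [AddCommGroup E''] [Module ℝ E''] [TopologicalSpace E''] [IsLCS E'']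
  {H'' : Type*} [TopologicalSpace H''] {J'' : LCModel E'' H''}
  {X : Type*} [TopologicalSpace X] [ChartedSpace H X]
  {Y : Type*} [TopologicalSpace Y] [ChartedSpace H' Y]
  {Z : Type*} [TopologicalSpace Z] [ChartedSpace H'' Z]
  {F : Type*} [AddCommGroup F] [Module ℝ F] [TopologicalSpace F] [IsLCS F]

theorem prod_mem_atlas {φ : OpenPartialHomeomorph X H} (hφ : φ ∈ atlas H X)
    {ψ : OpenPartialHomeomorph Y H'} (hψ : ψ ∈ atlas H' Y) :
    φ.prod ψ ∈ atlas (ModelProd H H') (X × Y) := mem_image2_of_mem hφ hψ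

theorem prod_chart_image (φ : OpenPartialHomeomorph X H) (ψ : OpenPartialHomeomorph Y H')
    (V : Set X) (W : Set Y) : (J.prod J').toFun '' ((φ.prod ψ) '' (V ×ˢ W)) =
      (J.toFun '' (φ '' V)) ×ˢ (J'.toFun '' (ψ '' W)) := by
  rw [prod_image_image_eq, prod_image_image_eq]
  rfl

instance instCompatProd [Compat J X] [Compat J' Y] : Compat (J.prod J') (X × Y) := by
  refine ⟨?_⟩
  rintro _ ⟨φ, hφ, ψ, hψ, rfl⟩ _ ⟨φ', hφ', ψ', hψ', rfl⟩
  have e : (J.prod J').toFun '' ((φ.prod ψ).target ∩ (φ.prod ψ).symm ⁻¹' (φ'.prod ψ').source) =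
      (J.toFun '' (φ.target ∩ φ.symm ⁻¹' φ'.source)) ×ˢ
        (J'.toFun '' (ψ.target ∩ ψ.symm ⁻¹' ψ'.source)) := by
    rw [prod_image_image_eq]
    ext p
    constructor
    · rintro ⟨a, ⟨h1, h2⟩, rfl⟩
      exact ⟨a, ⟨⟨h1.1, h2.1⟩, ⟨h1.2, h2.2⟩⟩, rfl⟩
    · rintro ⟨a, ⟨h1, h2⟩, rfl⟩
      exact ⟨a, ⟨⟨h1.1, h2.1⟩, ⟨h1.2, h2.2⟩⟩, rfl⟩
  rw [e]
  have g1 := J.good_image (φ.isOpen_inter_preimage_symm φ'.open_source)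
  have g2 := J'.good_image (ψ.isOpen_inter_preimage_symm ψ'.open_source)
  have h1 := CInfOn.comp g1 (g1.prod g2) (Compat.compatible (J := J) φ hφ φ' hφ') cInfOn_fst
    (fun p hp => hp.1)
  have h2 := CInfOn.comp g2 (g1.prod g2) (Compat.compatible (J := J') ψ hψ ψ' hψ') cInfOn_snd
    (fun p hp => hp.2)
  exact h1.prodMk h2

theorem SmAt.prodMk [Compat J X] {f : X → Y} {g : X → Z} {x : X} (hf : SmAt J J' f x)
    (hg : SmAt J J'' g x) : SmAt J (J'.prod J'') (fun y => (f y, g y)) x := by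
  obtain ⟨φ, hφ, ψ, hψ, V, hV, hxV, hVφ, hfV, hs⟩ := hf
  obtain ⟨φ', hφ', ψ', hψ', V', hV', hxV', hVφ', hfV', hs'⟩ := hg
  have hT := (Compat.compatible (J := J) φ hφ φ' hφ').mono (V := J.toFun '' (φ '' (V ∩ V')))
    (image_mono (by
      rintro _ ⟨y, hy, rfl⟩
      exact ⟨φ.map_source (hVφ hy.1), by simpa [φ.left_inv (hVφ hy.1)] using hVφ' hy.2⟩))
  have hsub : V ∩ V' ⊆ φ.source := inter_subset_left.trans hVφ
  refine ⟨φ, hφ, ψ.prod ψ', prod_mem_atlas hψ hψ', V ∩ V', hV.inter hV', ⟨hxV, hxV'⟩,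
    hsub, fun y hy => ⟨hfV hy.1, hfV' hy.2⟩, ?_⟩
  refine (hs.mono (image_mono (image_mono inter_subset_left))).prodMk ?_
  have key := CInfOn.comp (good_chart_image J hV' hVφ')
    (good_chart_image J (hV.inter hV') hsub) hs' hT ?_
  · refine key.congr ?_
    rintro _ ⟨_, ⟨y, hy, rfl⟩, rfl⟩
    simp only [J.left_inv, φ.left_inv (hsub hy), φ'.left_inv (hVφ' hy.2)]
    rfl
  · rintro _ ⟨_, ⟨y, hy, rfl⟩, rfl⟩
    simp only [J.left_inv, φ.left_inv (hsub hy)]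
    exact ⟨_, ⟨y, hy.2, rfl⟩, rfl⟩

theorem smAt_fst (p : X × Y) : SmAt (J.prod J') J (fun q : X × Y => q.1) p := by
  refine ⟨(chartAt H p.1).prod (chartAt H' p.2), prod_mem_atlas (chart_mem_atlas _ _)
    (chart_mem_atlas _ _), chartAt H p.1, chart_mem_atlas _ _, _,
    ((chartAt H p.1).prod (chartAt H' p.2)).open_source,
    ⟨mem_chart_source H p.1, mem_chart_source H' p.2⟩, Subset.rfl, fun q hq => hq.1, ?_⟩
  refine (cInfOn_fst).congr ?_
  rintro _ ⟨_, ⟨y, hy, rfl⟩, rfl⟩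
  simp only [(J.prod J').left_inv, OpenPartialHomeomorph.left_inv _ hy]
  rfl

theorem smAt_snd (p : X × Y) : SmAt (J.prod J') J' (fun q : X × Y => q.2) p := by
  refine ⟨(chartAt H p.1).prod (chartAt H' p.2), prod_mem_atlas (chart_mem_atlas _ _)
    (chart_mem_atlas _ _), chartAt H' p.2, chart_mem_atlas _ _, _,
    ((chartAt H p.1).prod (chartAt H' p.2)).open_source,
    ⟨mem_chart_source H p.1, mem_chart_source H' p.2⟩, Subset.rfl, fun q hq => hq.2, ?_⟩
  refine (cInfOn_snd).congr ?_
  rintro _ ⟨_, ⟨y, hy, rfl⟩, rfl⟩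
  simp only [(J.prod J').left_inv, OpenPartialHomeomorph.left_inv _ hy]
  rfl

theorem smAt_of_cInfOn_prod_model {f : H × H' → F} {V : Set H} {V' : Set H'} (hV : IsOpen V)
    (hV' : IsOpen V') (h : CInfOn (fun e : E × E' => f (J.invFun e.1, J'.invFun e.2))
      ((J.toFun '' V) ×ˢ (J'.toFun '' V'))) {p : H × H'} (hp : p ∈ V ×ˢ V') :
    SmAt (J.prod J') (LCModel.self F) f p := by
  refine smAt_of_cInfOn_chart (H := ModelProd H H') (φ := (OpenPartialHomeomorph.refl H).prod
    (OpenPartialHomeomorph.refl H')) (prod_mem_atlas (by simp) (by simp)) (hV.prod hV')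
    (fun _ _ => by simp) ?_ hp
  rw [prod_chart_image, show (OpenPartialHomeomorph.refl H) '' V = V from image_id V,
    show (OpenPartialHomeomorph.refl H') '' V' = V' from image_id V']
  exact h

/-- Smooth maps on a product of vector spaces, regarded as a product manifold. -/
theorem smAt_of_cInfOn_prod {f : E × E' → F} (h : CInfOn f univ) (p : E × E') :
    SmAt ((LCModel.self E).prod (LCModel.self E')) (LCModel.self F) f p :=
  smAt_of_cInfOn_prod_model (J := LCModel.self E) (J' := LCModel.self E') isOpen_univ isOpen_univ
    (by simpa [LCModel.self] using h) ⟨mem_univ _, mem_univ _⟩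

theorem SmAt.add [Compat J X] {f g : X → F} {x : X} (hf : SmAt J (LCModel.self F) f x)
    (hg : SmAt J (LCModel.self F) g x) : SmAt J (LCModel.self F) (fun y => f y + g y) x :=
  SmAt.comp (g := fun p : F × F => p.1 + p.2)
    (smAt_of_cInfOn_prod (cInfOn_fst.add cInfOn_snd) _) (hf.prodMk hg)

theorem SmAt.smul [Compat J X] {f : X → ℝ} {g : X → F} {x : X}
    (hf : SmAt J (LCModel.self ℝ) f x) (hg : SmAt J (LCModel.self F) g x) :
    SmAt J (LCModel.self F) (fun y => f y • g y) x :=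
  SmAt.comp (g := fun p : ℝ × F => p.1 • p.2) (smAt_of_cInfOn_prod cInfOn_smul _) (hf.prodMk hg)

theorem SmAt.sub [Compat J X] {f g : X → F} {x : X} (hf : SmAt J (LCModel.self F) f x)
    (hg : SmAt J (LCModel.self F) g x) : SmAt J (LCModel.self F) (fun y => f y - g y) x := by
  have := hf.add ((smAt_const (-1 : ℝ) x).smul hg)
  refine this.congr (Eventually.of_forall fun y => ?_)
  simp [sub_eq_add_neg]

/-- A pair of smooth vector valued maps, as a map into the product vector space. -/
theorem SmAt.prodMk_vec [Compat J X] {F' : Type*} [AddCommGroup F'] [Module ℝ F']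
    [TopologicalSpace F'] [IsLCS F'] {f : X → F} {g : X → F'} {x : X}
    (hf : SmAt J (LCModel.self F) f x) (hg : SmAt J (LCModel.self F') g x) :
    SmAt J (LCModel.self (F × F')) (fun y => (f y, g y)) x :=
  SmAt.comp (g := fun p : F × F' => p) (smAt_of_cInfOn_prod cInfOn_id _) (hf.prodMk hg)

end Prod

/-! ### Differentials of functions on model spaces. -/

section ModelDifferential

variable {E : Type*} [AddCommGroup E] [Module ℝ E] [TopologicalSpace E] [IsLCS E]
  {H : Type*} [TopologicalSpace H] {J : LCModel E H}
  {E' : Type*} [AddCommGroup E'] [Module ℝ E'] [TopologicalSpace E'] [IsLCS E']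
  {H' : Type*} [TopologicalSpace H'] {J' : LCModel E' H'}
  {F : Type*} [AddCommGroup F] [Module ℝ F] [TopologicalSpace F] [IsLCS F]

/-- The differential of a function on a model `H` with values in a vector space. -/
def mdiff (J : LCModel E H) (p : H → F) (a : H) (u : E) : F :=
  extDiff (fun y => p (J.invFun y)) (range J.toFun) (J.toFun a, u)

theorem mdiff_eq {p : H → F} {V : Set H} (hV : IsOpen V) {a : H} (ha : a ∈ V) {D : E × E → F}
    (hD : IsDifferentialOn (fun e => p (J.invFun e)) (J.toFun '' V) D) (u : E) :
    mdiff J p a u = D (J.toFun a, u) := by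
  rw [J.image_eq] at hD
  exact hD.extDiff_eq_of_inter_open J.good_range (hV.preimage J.continuous_invFun) ⟨a, rfl⟩
    (by simpa [J.left_inv] using ha) u

theorem mdiff_eq_extDiff {p : H → F} {V : Set H} (hV : IsOpen V) {a : H} (ha : a ∈ V)
    (hs : CInfOn (fun e => p (J.invFun e)) (J.toFun '' V)) (u : E) :
    mdiff J p a u = extDiff (fun e => p (J.invFun e)) (J.toFun '' V) (J.toFun a, u) :=
  mdiff_eq hV ha (hs.isDifferentialOn (J.good_image hV)) u

theorem mdiff_congr {p p' : H → F} {a : H} (hp : SmAt J (LCModel.self F) p a)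
    (h : p =ᶠ[𝓝 a] p') (u : E) : mdiff J p a u = mdiff J p' a u := by
  obtain ⟨V, hV, haV, hs⟩ := hp.exists_cInfOn_model
  obtain ⟨O, hOs, hO, haO⟩ := mem_nhds_iff.1 h
  have hD := (hs.mono (image_mono (inter_subset_left (s := V) (t := O)))).isDifferentialOn
    (J.good_image (hV.inter hO))
  rw [mdiff_eq (hV.inter hO) ⟨haV, haO⟩ hD]
  refine (mdiff_eq (hV.inter hO) ⟨haV, haO⟩ (hD.congr ?_ fun _ _ => rfl) u).symm
  rintro _ ⟨y, hy, rfl⟩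
  simp only [J.left_inv]
  exact hOs hy.2

/-- The points `y i` may be any points of the model, approaching `a` with velocity `u`; this covers
boundary points and curves defined on `[0,1]`. -/
theorem tendsto_mdiff {p : H → F} {a : H} (hp : SmAt J (LCModel.self F) p a) {ι : Type*}
    {l : Filter ι} {y : ι → H} {t : ι → ℝ} {u : E} (ht : Tendsto t l (𝓝 0))
    (ht0 : ∀ᶠ i in l, t i ≠ 0)
    (hy : Tendsto (fun i => (t i)⁻¹ • (J.toFun (y i) - J.toFun a)) l (𝓝 u)) :
    Tendsto (fun i => (t i)⁻¹ • (p (y i) - p a)) l (𝓝 (mdiff J p a u)) := by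
  obtain ⟨V, hV, haV, hs⟩ := hp.exists_cInfOn_model
  have hG := J.good_image hV
  rw [mdiff_eq_extDiff hV haV hs]
  have e : ∀ i, t i ≠ 0 →
      J.toFun a + t i • (t i)⁻¹ • (J.toFun (y i) - J.toFun a) = J.toFun (y i) := by
    intro i hi
    rw [smul_inv_smul₀ hi, add_sub_cancel]
  have hlim : Tendsto (fun i => J.toFun (y i)) l (𝓝 (J.toFun a)) := by
    have h1 : Tendsto (fun i => J.toFun a + t i • (t i)⁻¹ • (J.toFun (y i) - J.toFun a)) l
        (𝓝 (J.toFun a + (0 : ℝ) • u)) := tendsto_const_nhds.add (ht.smul hy)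
    rw [zero_smul, add_zero] at h1
    exact h1.congr' (ht0.mono e)
  have hylim : Tendsto y l (𝓝 a) := J.isInducing.tendsto_nhds_iff.2 hlim
  have key := (hs.isDifferentialOn hG).strict hG hs.continuousOn (x := J.toFun a) ⟨a, haV, rfl⟩
    (a := fun _ : ι => J.toFun a) tendsto_const_nhds hy ht (Eventually.of_forall fun _ =>
      ⟨a, haV, rfl⟩) (by
      filter_upwards [ht0, hylim (hV.mem_nhds haV)] with i hi hiV
      rw [e i hi]
      exact ⟨_, hiV, rfl⟩) ht0
  refine key.congr' ?_
  filter_upwards [ht0] with i hi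
  rw [e i hi, J.left_inv, J.left_inv]

theorem hasDirDeriv_mdiff {p : E → F} {a : E}
    (hp : SmAt (LCModel.self E) (LCModel.self F) p a) (u : E) :
    HasDirDeriv p a u (mdiff (LCModel.self E) p a u) := by
  refine tendsto_mdiff hp (tendsto_id.mono_left nhdsWithin_le_nhds) self_mem_nhdsWithin ?_
  refine Tendsto.congr' (f₁ := fun _ => u) ?_ tendsto_const_nhds
  filter_upwards [self_mem_nhdsWithin] with t ht
  have ht' : t ≠ 0 := ht
  simp [LCModel.self, inv_smul_smul₀ ht']

theorem mdiff_add_right {p : H → F} {a : H} (hp : SmAt J (LCModel.self F) p a) (u v : E) :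
    mdiff J p a (u + v) = mdiff J p a u + mdiff J p a v := by
  obtain ⟨V, hV, haV, hs⟩ := hp.exists_cInfOn_model
  have hG := J.good_image hV
  simp only [mdiff_eq_extDiff hV haV hs]
  exact (hs.isDifferentialOn hG).map_add hG hs.continuousOn ⟨a, haV, rfl⟩ u v

theorem mdiff_smul_right {p : H → F} {a : H} (hp : SmAt J (LCModel.self F) p a) (c : ℝ) (u : E) :
    mdiff J p a (c • u) = c • mdiff J p a u := by
  obtain ⟨V, hV, haV, hs⟩ := hp.exists_cInfOn_model
  have hG := J.good_image hV
  simp only [mdiff_eq_extDiff hV haV hs]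
  exact (hs.isDifferentialOn hG).map_smul hG hs.continuousOn ⟨a, haV, rfl⟩ c u

theorem mdiff_zero_right {p : H → F} {a : H} (hp : SmAt J (LCModel.self F) p a) :
    mdiff J p a 0 = 0 := by
  simpa using mdiff_smul_right hp 0 0

theorem mdiff_const (c : F) (a : H) (u : E) : mdiff J (fun _ => c) a u = 0 := by
  refine mdiff_eq (V := univ) isOpen_univ (mem_univ a) (D := 0) ⟨continuousOn_const (c := (0 : F)), ?_⟩ u
  intro x _ h
  simp [HasDirDeriv]

theorem mdiff_comp {p : H' → F} {τ : H → H'} {a : H} (hp : SmAt J' (LCModel.self F) p (τ a))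
    (hτ : SmAt J J' τ a) (u : E) :
    mdiff J (fun b => p (τ b)) a u = mdiff J' p (τ a) (mdiff J (fun b => J'.toFun (τ b)) a u) := by
  have hτ' : SmAt J (LCModel.self E') (fun b => J'.toFun (τ b)) a := (smAt_toFun (τ a)).comp hτ
  obtain ⟨V, hV, haV, hs⟩ := hp.exists_cInfOn_model
  obtain ⟨W, hW, haW, ht⟩ := hτ'.exists_cInfOn_model
  have hτc : ContinuousOn τ W := by
    have h1 : ContinuousOn (fun b => J'.toFun (τ (J.invFun (J.toFun b)))) W :=
      ht.continuousOn.comp (f := J.toFun) J.continuous_toFun.continuousOn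
        (fun b hb => ⟨b, hb, rfl⟩)
    simp only [J.left_inv] at h1
    exact J'.isInducing.continuousOn_iff.2 h1
  have hO : IsOpen (W ∩ τ ⁻¹' V) := hτc.isOpen_inter_preimage hW hV
  have hDp := hs.isDifferentialOn (J'.good_image hV)
  have ht' := ht.mono (image_mono (inter_subset_left (s := W) (t := τ ⁻¹' V)))
  have hDτ := ht'.isDifferentialOn (J.good_image hO)
  have key := hDp.comp (J'.good_image hV) hs.continuousOn ht'.continuousOn hDτ (by
    rintro _ ⟨b, hb, rfl⟩
    simp only [J.left_inv]
    exact ⟨_, hb.2, rfl⟩)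
  simp only [J'.left_inv] at key
  rw [mdiff_eq hO ⟨haW, haV⟩ key, mdiff_eq hO ⟨haW, haV⟩ hDτ, mdiff_eq hV haV hDp, J.left_inv]

theorem mdiff_toFun (a : H) (u : E) : mdiff J J.toFun a u = u := by
  refine mdiff_eq (V := univ) isOpen_univ (mem_univ a) (D := fun q => q.2)
    ((⟨by fun_prop, ?_⟩ : IsDifferentialOn (fun e => e) (J.toFun '' univ) _).congr ?_
      fun _ _ => rfl) u
  · intro x _ h
    refine Tendsto.congr' (f₁ := fun _ => h) ?_ tendsto_const_nhds
    filter_upwards [self_mem_nhdsWithin] with t ht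
    have ht' : t ≠ 0 := ht
    simp [inv_smul_smul₀ ht']
  · rintro _ ⟨b, -, rfl⟩
    simp [J.left_inv]

theorem SmAt.exists_cInfOn_prod {EX : Type*} [AddCommGroup EX] [Module ℝ EX] [TopologicalSpace EX]
    [IsLCS EX] {HX : Type*} [TopologicalSpace HX] {JX : LCModel EX HX} {X : Type*}
    [TopologicalSpace X] [ChartedSpace HX X] [Compat JX X] {P : X × H → F} {x : X} {a : H}
    (hP : SmAt (JX.prod J) (LCModel.self F) P (x, a)) {φ : OpenPartialHomeomorph X HX}
    (hφ : φ ∈ atlas HX X) (hx : x ∈ φ.source) :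
    ∃ V : Set X, ∃ W : Set H, IsOpen V ∧ IsOpen W ∧ x ∈ V ∧ a ∈ W ∧ V ⊆ φ.source ∧
      CInfOn (fun e : EX × E => P (φ.symm (JX.invFun e.1), J.invFun e.2))
        ((JX.toFun '' (φ '' V)) ×ˢ (J.toFun '' W)) := by
  obtain ⟨O, hO, hxO, hOφ, hs⟩ := hP.exists_cInfOn (H := ModelProd HX H)
    (φ := φ.prod (OpenPartialHomeomorph.refl H)) (prod_mem_atlas hφ (by simp)) ⟨hx, by simp⟩
  obtain ⟨V, W, hV, hW, hxV, haW, hVW⟩ := isOpen_prod_iff.1 hO x a hxO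
  refine ⟨V, W, hV, hW, hxV, haW, fun y hy => (hOφ (hVW (mk_mem_prod hy haW))).1, ?_⟩
  have h2 := hs.mono (image_mono (image_mono hVW))
  rw [prod_chart_image, show (OpenPartialHomeomorph.refl H) '' W = W from image_id W] at h2
  exact h2

/-- Partial differentials of smooth maps are smooth. -/
theorem SmAt.mdiff_param {EX : Type*} [AddCommGroup EX] [Module ℝ EX] [TopologicalSpace EX]
    [IsLCS EX] {HX : Type*} [TopologicalSpace HX] {JX : LCModel EX HX} {X : Type*}
    [TopologicalSpace X] [ChartedSpace HX X] [Compat JX X] {P : X × H → F} {x : X} {a : H}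
    (hP : SmAt (JX.prod J) (LCModel.self F) P (x, a)) (u : E) :
    SmAt (JX.prod (J.prod (LCModel.self E))) (LCModel.self F)
      (fun q : X × (H × E) => mdiff J (fun b => P (q.1, b)) q.2.1 q.2.2) (x, (a, u)) := by
  obtain ⟨V, W, hV, hW, hxV, haW, hVφ, hs⟩ := hP.exists_cInfOn_prod (chart_mem_atlas HX x)
    (mem_chart_source HX x)
  set φ := chartAt HX x
  have g1 := good_chart_image JX hV hVφ
  have g2 := J.good_image hW
  refine smAt_of_cInfOn_chart (H := ModelProd HX (ModelProd H E)) (V := V ×ˢ (W ×ˢ univ))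
    (φ := φ.prod ((OpenPartialHomeomorph.refl H).prod (OpenPartialHomeomorph.refl E)))
    (prod_mem_atlas (chart_mem_atlas HX x) (prod_mem_atlas (by simp) (by simp)))
    (hV.prod (hW.prod isOpen_univ)) (fun q hq => ⟨hVφ hq.1, by simp⟩) ?_
    ⟨hxV, haW, mem_univ _⟩
  rw [prod_chart_image, prod_chart_image,
    show (OpenPartialHomeomorph.refl H) '' W = W from image_id W,
    show (LCModel.self E).toFun '' ((OpenPartialHomeomorph.refl E) '' univ) = univ from
      (image_id _).trans (image_id _)]
  have hD := hs.isDifferentialOn (g1.prod g2)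
  have key := CInfOn.comp ((g1.prod g2).prod good_univ) (g1.prod (g2.prod good_univ))
    (hs.extDiff (g1.prod g2)) (cInfOn_of_linear (fun q : EX × (E × E) =>
      (((q.1, q.2.1), (0, q.2.2)) : (EX × E) × (EX × E))) (fun q q' => by ext <;> simp)
      (fun c q => by ext <;> simp) (by fun_prop))
    (U := (JX.toFun '' (φ '' V)) ×ˢ ((J.toFun '' W) ×ˢ univ))
    (fun q hq => ⟨⟨hq.1, hq.2.1⟩, mem_univ _⟩)
  refine key.congr ?_
  rintro ⟨_, _, v⟩ ⟨⟨_, ⟨y, hy, rfl⟩, rfl⟩, ⟨b, hb, rfl⟩, -⟩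
  have h1 := hD.partial_snd g1 g2 hs.continuousOn (x := JX.toFun (φ y)) ⟨_, ⟨y, hy, rfl⟩, rfl⟩
  change _ = mdiff J (fun b => P (φ.symm (JX.invFun (JX.toFun (φ y))), b))
    (J.invFun (J.toFun b)) v
  rw [J.left_inv]
  exact (mdiff_eq (p := fun b => P (φ.symm (JX.invFun (JX.toFun (φ y))), b)) hW hb h1 v).symm

/-- On a product neighbourhood both sides become iterated `extDiff`s, to which `extDiff_comm`
applies. Smoothness of the inner differentials is needed to compute the outer ones locally. -/
theorem mdiff_comm {P : H × H' → F} {a : H} {b : H'}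
    (hP : SmAt (J.prod J') (LCModel.self F) P (a, b)) (h : E) (v : E') :
    mdiff J' (fun y => mdiff J (fun x => P (x, y)) a h) b v =
      mdiff J (fun x => mdiff J' (fun y => P (x, y)) b v) a h := by
  obtain ⟨V, W, hV, hW, haV, hbW, -, hs⟩ := hP.exists_cInfOn_prod
    (φ := OpenPartialHomeomorph.refl H) (by simp) (by simp)
  rw [show (OpenPartialHomeomorph.refl H) '' V = V from image_id V] at hs
  have g1 := J.good_image hV
  have g2 := J'.good_image hW
  have hs' : CInfOn (fun e : E × E' => P (J.invFun e.1, J'.invFun e.2))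
    ((J.toFun '' V) ×ˢ (J'.toFun '' W)) := hs
  have hD := hs'.isDifferentialOn (g1.prod g2)
  have hDs := hs'.extDiff (g1.prod g2)
  have e1 : EqOn (fun y => extDiff (fun x => P (J.invFun x, J'.invFun y)) (J.toFun '' V)
      (J.toFun a, h)) (fun y => mdiff J (fun x => P (x, J'.invFun y)) a h) (J'.toFun '' W) := by
    intro y hy
    exact (mdiff_eq_extDiff (p := fun x => P (x, J'.invFun y)) hV haV
      (hs'.partial_fst g1 g2 hy) h).symm
  have e2 : EqOn (fun x => extDiff (fun y => P (J.invFun x, J'.invFun y)) (J'.toFun '' W)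
      (J'.toFun b, v)) (fun x => mdiff J' (fun y => P (J.invFun x, y)) b v) (J.toFun '' V) := by
    intro x hx
    exact (mdiff_eq_extDiff (p := fun y => P (J.invFun x, y)) hW hbW
      (hs'.partial_snd g1 g2 hx) v).symm
  have s1 : CInfOn (fun y => mdiff J (fun x => P (x, J'.invFun y)) a h) (J'.toFun '' W) := by
    refine CInfOn.congr ?_ e1
    refine (CInfOn.comp ((g1.prod g2).prod good_univ) g2 hDs
      (f := fun y => ((J.toFun a, y), (h, 0)))
      (((cInfOn_const _).prodMk cInfOn_id).prodMk (cInfOn_const _))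
      (fun y hy => ⟨⟨⟨a, haV, rfl⟩, hy⟩, mem_univ _⟩)).congr fun y hy => ?_
    exact ((hD.partial_fst g1 g2 hs'.continuousOn hy).extDiff_eq g1 ⟨a, haV, rfl⟩ h).symm
  have s2 : CInfOn (fun x => mdiff J' (fun y => P (J.invFun x, y)) b v) (J.toFun '' V) := by
    refine CInfOn.congr ?_ e2
    refine (CInfOn.comp ((g1.prod g2).prod good_univ) g1 hDs
      (f := fun x => ((x, J'.toFun b), (0, v)))
      ((cInfOn_id.prodMk (cInfOn_const _)).prodMk (cInfOn_const _))
      (fun x hx => ⟨⟨hx, ⟨b, hbW, rfl⟩⟩, mem_univ _⟩)).congr fun x hx => ?_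
    exact ((hD.partial_snd g1 g2 hs'.continuousOn hx).extDiff_eq g2 ⟨b, hbW, rfl⟩ v).symm
  rw [mdiff_eq_extDiff hW hbW s1, mdiff_eq_extDiff hV haV s2, ← extDiff_congr e1,
    ← extDiff_congr e2]
  exact extDiff_comm (g := fun e : E × E' => P (J.invFun e.1, J'.invFun e.2)) g1 g2 hs'
    ⟨a, haV, rfl⟩ ⟨b, hbW, rfl⟩ h v

end ModelDifferential

/-! ### Exponential law and smooth evaluation on manifolds. -/

section ExponentialLaw

variable {E : Type*} [AddCommGroup E] [Module ℝ E] [TopologicalSpace E] [IsLCS E]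
  {H : Type*} [TopologicalSpace H] {J : LCModel E H}
  {X : Type*} [TopologicalSpace X] [ChartedSpace H X]
  {F : Type*} [AddCommGroup F] [Module ℝ F] [TopologicalSpace F] [IsLCS F]
  {EN : Type*} [AddCommGroup EN] [Module ℝ EN] [TopologicalSpace EN] [IsLCS EN]
  {HN : Type*} [TopologicalSpace HN] {JN : LCModel EN HN}
  {N : Type*} [TopologicalSpace N] [ChartedSpace HN N]

/-- The hypothesis speaks of every chart of `X`, so compatibility of these charts is not required.
In this form the law is applied to `TM`. -/
theorem SmoothFun.smAt_of_uncurry_chart [Compat JN N] {G : N → SmoothFun J X F} {W : Set N}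
    (hW : IsOpen W) (h : ∀ n ∈ W, ∀ φ ∈ atlas H X, ∀ a ∈ φ.target, SmAt (JN.prod J)
      (LCModel.self F) (fun q : N × H => G q.1 (φ.symm q.2)) (n, a)) {n : N} (hn : n ∈ W) :
    SmAt JN (LCModel.self (SmoothFun J X F)) G n := by
  set ν := chartAt HN n
  have hV : IsOpen (W ∩ ν.source) := hW.inter ν.open_source
  refine smAt_of_cInfOn_chart (chart_mem_atlas HN n) hV inter_subset_right ?_
    ⟨hn, mem_chart_source HN n⟩
  refine SmoothFun.cInfOn_of_uncurry (good_chart_image JN hV inter_subset_right) fun φ hφ => ?_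
  have key := cInfOn_chart_of_smAt (J := JN.prod J) (H := ModelProd HN H)
    (f := fun q : N × H => G q.1 (φ.symm q.2))
    (φ := ν.prod (OpenPartialHomeomorph.refl H)) (prod_mem_atlas (chart_mem_atlas HN n) (by simp))
    (hV.prod φ.open_target) (fun q hq => ⟨hq.1.2, by simp⟩)
    (fun q hq => h q.1 hq.1.1 φ hφ q.2 hq.2)
  rw [prod_chart_image, show (OpenPartialHomeomorph.refl H) '' φ.target = φ.target from
    image_id _] at key
  exact key

theorem SmoothFun.smAt_of_uncurry [Compat JN N] [Compat J X] {G : N → SmoothFun J X F} {W : Set N}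
    (hW : IsOpen W) (h : ∀ n ∈ W, ∀ x, SmAt (JN.prod J) (LCModel.self F)
      (fun q : N × X => G q.1 q.2) (n, x)) {n : N} (hn : n ∈ W) :
    SmAt JN (LCModel.self (SmoothFun J X F)) G n := by
  refine SmoothFun.smAt_of_uncurry_chart hW (fun n hn φ hφ a ha => ?_) hn
  exact SmAt.comp (f := fun q : N × H => (q.1, φ.symm q.2)) (x := (n, a)) (h n hn _)
    ((smAt_fst _).prodMk (SmAt.comp (f := fun q : N × H => q.2) (x := (n, a))
      (smAt_chart_symm hφ ha) (smAt_snd _)))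

theorem SmoothFun.smAt_eval_chart [LocallyCompactSpace E] {φ : OpenPartialHomeomorph X H}
    (hφ : φ ∈ atlas H X) (f : SmoothFun J X F) {a : H} (ha : a ∈ φ.target) :
    SmAt ((LCModel.self (SmoothFun J X F)).prod J) (LCModel.self F)
      (fun q : SmoothFun J X F × H => q.1 (φ.symm q.2)) (f, a) := by
  refine smAt_of_cInfOn_prod_model (J := LCModel.self (SmoothFun J X F)) isOpen_univ
    φ.open_target ?_ ⟨mem_univ _, ha⟩
  rw [show (LCModel.self (SmoothFun J X F)).toFun '' univ = univ from image_id _]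
  exact SmoothFun.cInfOn_eval hφ

theorem SmoothFun.smAt_eval [LocallyCompactSpace E] [Compat J X] (f : SmoothFun J X F) (x : X) :
    SmAt ((LCModel.self (SmoothFun J X F)).prod J) (LCModel.self F)
      (fun q : SmoothFun J X F × X => q.1 q.2) (f, x) := by
  have h1 := SmAt.comp (J := (LCModel.self (SmoothFun J X F)).prod J)
    (f := fun q : SmoothFun J X F × X => (q.1, chartAt H x q.2)) (x := (f, x))
    (g := fun q : SmoothFun J X F × H => q.1 ((chartAt H x).symm q.2))
    (SmoothFun.smAt_eval_chart (chart_mem_atlas H x) f (mem_chart_target H x))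
    ((smAt_fst _).prodMk (SmAt.comp (f := fun q : SmoothFun J X F × X => q.2) (x := (f, x))
      (smAt_chart (chart_mem_atlas H x) (mem_chart_source H x)) (smAt_snd _)))
  refine h1.congr ?_
  filter_upwards [(continuous_snd.tendsto (f, x)) ((chartAt H x).open_source.mem_nhds
    (mem_chart_source H x))] with q hq
  rw [(chartAt H x).left_inv hq]

/-- Evaluation of a smooth family of smooth functions. -/
theorem SmAt.eval [LocallyCompactSpace E] [Compat J X] [Compat JN N] {G : N → SmoothFun J X F}
    {f : N → X} {n : N} (hG : SmAt JN (LCModel.self (SmoothFun J X F)) G n) (hf : SmAt JN J f n) :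
    SmAt JN (LCModel.self F) (fun n => G n (f n)) n :=
  SmAt.comp (g := fun q : SmoothFun J X F × X => q.1 q.2) (f := fun n => (G n, f n)) (x := n)
    (SmoothFun.smAt_eval (G n) (f n))
    (hG.prodMk hf)

end ExponentialLaw

/-! ### Comparison with Fréchet differentiability on normed spaces. -/

section ContDiff

theorem Good.uniqueDiffOn {E : Type*} [NormedAddCommGroup E] [NormedSpace ℝ E] {U : Set E}
    (hU : Good U) : UniqueDiffOn ℝ U := by
  obtain ⟨C, O, hC, hi, hO, rfl⟩ := hU
  exact (uniqueDiffOn_convex hC hi).inter hO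

theorem isDifferentialOn_fderivWithin {E : Type*} [NormedAddCommGroup E] [NormedSpace ℝ E]
    {F : Type*} [NormedAddCommGroup F] [NormedSpace ℝ F] {f : E → F} {U : Set E} (hU : Good U)
    (hf : ContDiffOn ℝ ∞ f U) :
    IsDifferentialOn f U (fun p => fderivWithin ℝ f U p.1 p.2) := by
  have hD : ContDiffOn ℝ ∞ (fun p : E × E => fderivWithin ℝ f U p.1 p.2) (U ×ˢ univ) := by
    have h1 : ContDiffOn ℝ ∞ (fderivWithin ℝ f U) U := hf.fderivWithin hU.uniqueDiffOn (by simp)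
    exact (h1.comp contDiffOn_fst fun p hp => hp.1).clm_apply contDiffOn_snd
  refine ⟨hD.continuousOn, fun x hx h => ?_⟩
  have hx' := mem_interior_iff_mem_nhds.1 hx
  have h1 : HasFDerivAt f (fderivWithin ℝ f U x) x :=
    ((hf.differentiableOn (by simp) x (interior_subset hx)).hasFDerivWithinAt).hasFDerivAt hx'
  have h2 := h1.hasLineDerivAt h
  rw [HasLineDerivAt, hasDerivAt_iff_tendsto_slope_zero] at h2
  simpa [HasDirDeriv] using h2

theorem ContDiffOn.cInfOn {F : Type v} [NormedAddCommGroup F] [NormedSpace ℝ F]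
    {E : Type u} [NormedAddCommGroup E] [NormedSpace ℝ E] {f : E → F} {U : Set E} (hU : Good U)
    (hf : ContDiffOn ℝ ∞ f U) : CInfOn f U := by
  intro n
  induction n generalizing E with
  | zero => exact hf.continuousOn
  | succ n ih =>
    refine ⟨hf.continuousOn, _, isDifferentialOn_fderivWithin hU hf, ih (hU.prod good_univ) ?_⟩
    have h1 : ContDiffOn ℝ ∞ (fderivWithin ℝ f U) U := hf.fderivWithin hU.uniqueDiffOn (by simp)
    exact (h1.comp contDiffOn_fst fun p hp => hp.1).clm_apply contDiffOn_snd

end ContDiff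

/-! ### Chart changes of `M` and charts of the tangent bundle. -/

section Corners

variable {EM : Type*} [NormedAddCommGroup EM] [NormedSpace ℝ EM]
  {HM : Type*} [TopologicalSpace HM] {I : ModelWithCorners ℝ EM HM}
  {M : Type*} [TopologicalSpace M] [ChartedSpace HM M] [IsManifold I ∞ M]

theorem contDiffOn_chart_change {φ ψ : OpenPartialHomeomorph M HM} (hφ : φ ∈ atlas HM M)
    (hψ : ψ ∈ atlas HM M) :
    ContDiffOn ℝ ∞ (fun x => (LCModel.ofCorners I).toFun (ψ (φ.symm ((LCModel.ofCorners I).invFun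
      x)))) ((LCModel.ofCorners I).toFun '' (φ.target ∩ φ.symm ⁻¹' ψ.source)) := by
  have h := (contDiffGroupoid ∞ I).compatible hφ hψ
  rw [contDiffGroupoid, mem_groupoid_of_pregroupoid] at h
  have h1 := h.1
  rw [LCModel.image_eq, inter_comm]
  exact h1

instance instCompatOfCorners : Compat (LCModel.ofCorners I) M :=
  ⟨fun φ hφ ψ hψ => ContDiffOn.cInfOn ((LCModel.ofCorners I).good_image
    (φ.isOpen_inter_preimage_symm ψ.open_source)) (contDiffOn_chart_change hφ hψ)⟩

/-- The tangent coordinates in the chart `i`. -/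
def tangentCoord (I : ModelWithCorners ℝ EM HM) [IsManifold I ∞ M] (i : atlas HM M)
    (v : TangentBundle I M) : EM :=
  (tangentBundleCore I M).coordChange (achart HM v.proj) i v.proj v.2

/-- Coordinate changes in the tangent bundle are derivatives of chart changes, which connects the
bundle charts with the differential calculus of the model. -/
theorem mdiff_chart_change {i : atlas HM M} {m : M} (hm : m ∈ i.1.source) (v : EM) :
    mdiff (LCModel.ofCorners I) (fun b => (LCModel.ofCorners I).toFun (i.1 ((chartAt HM m).symm b)))
      (chartAt HM m m) v = tangentCoord I i ⟨m, v⟩ := by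
  set j := chartAt HM m
  have hO : IsOpen (j.target ∩ j.symm ⁻¹' i.1.source) :=
    j.isOpen_inter_preimage_symm i.1.open_source
  have hmem : j m ∈ j.target ∩ j.symm ⁻¹' i.1.source :=
    ⟨mem_chart_target HM m, by
      rw [mem_preimage, j.left_inv (mem_chart_source HM m)]; exact hm⟩
  have hc := contDiffOn_chart_change (I := I) (chart_mem_atlas HM m) i.2
  rw [mdiff_eq hO hmem (isDifferentialOn_fderivWithin
    ((LCModel.ofCorners I).good_image hO) hc)]
  -- The bundle takes the derivative within all of `range I`, the left side only within the
  -- relatively open image of the chart overlap; these agree locally.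
  change fderivWithin ℝ _ _ _ v = fderivWithin ℝ _ (range I) _ v
  rw [LCModel.image_eq]
  rw [fderivWithin_inter]
  · rfl
  · refine (hO.preimage (LCModel.ofCorners I).continuous_invFun).mem_nhds ?_
    rw [mem_preimage, (LCModel.ofCorners I).left_inv]
    exact hmem

/-- The charts of the tangent bundle. -/
theorem exists_of_mem_atlas_tangentBundle {χ : OpenPartialHomeomorph (TangentBundle I M)
    (ModelProd HM EM)} (hχ : χ ∈ atlas (ModelProd HM EM) (TangentBundle I M)) :
    ∃ (i : atlas HM M) (c : OpenPartialHomeomorph M HM), c ∈ atlas HM M ∧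
      (∀ v, v ∈ χ.source ↔ v.proj ∈ i.1.source ∧ v.proj ∈ c.source) ∧
      ∀ v, χ v = (c v.proj, tangentCoord I i v) := by
  -- A bundle chart is a trivialization, indexed by a chart `i`, followed by a base chart `c`; the
  -- two charts are unrelated in general.
  obtain ⟨_, ⟨e, ⟨i, rfl⟩, rfl⟩, _, ⟨c, hc, r, hr, rfl⟩, rfl⟩ := hχ
  obtain rfl : r = OpenPartialHomeomorph.refl EM := by simpa using hr
  refine ⟨i, c, hc, fun v => ?_, fun v => rfl⟩
  constructor
  · rintro ⟨h1, h2⟩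
    exact ⟨((tangentBundleCore I M).mem_localTriv_source i v).1 h1, h2.1⟩
  · rintro ⟨h1, h2⟩
    exact ⟨((tangentBundleCore I M).mem_localTriv_source i v).2 h1, h2, mem_univ _⟩

/-- Trivialization and base coordinates are taken from the same chart `c`, so that velocities of
curves in `c` have the expected coordinates. -/
theorem exists_mem_atlas_tangentBundle (c : atlas HM M) :
    ∃ χ ∈ atlas (ModelProd HM EM) (TangentBundle I M),
      (∀ v, v ∈ χ.source ↔ v.proj ∈ c.1.source) ∧
      (∀ v, χ v = (c.1 v.proj, tangentCoord I c v)) ∧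
      (∀ a, ∀ u : EM, a ∈ c.1.target → ((a, u) : ModelProd HM EM) ∈ χ.target) := by
  refine ⟨_, mem_image2_of_mem (mem_image_of_mem _ ⟨c, rfl⟩)
    (mem_image2_of_mem c.2 (mem_singleton (OpenPartialHomeomorph.refl EM))), fun v => ?_,
    fun v => rfl, fun a u ha => ?_⟩
  · constructor
    · rintro ⟨h1, h2⟩
      exact h2.1
    · intro h
      exact ⟨((tangentBundleCore I M).mem_localTriv_source c v).2 h, h, mem_univ _⟩
  · refine ⟨⟨ha, mem_univ _⟩, ?_⟩
    refine ((tangentBundleCore I M).mem_localTriv_target c _).2 ?_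
    exact c.1.map_target ha

theorem tangentBundle_chart_symm {c : atlas HM M} {χ : OpenPartialHomeomorph (TangentBundle I M)
    (ModelProd HM EM)} (h1 : ∀ v, χ v = (c.1 v.proj, tangentCoord I c v))
    (h0 : ∀ v, v ∈ χ.source ↔ v.proj ∈ c.1.source)
    (h2 : ∀ a, ∀ u : EM, a ∈ c.1.target → ((a, u) : ModelProd HM EM) ∈ χ.target) {a : HM}
    (ha : a ∈ c.1.target) (u : EM) :
    (χ.symm (a, u)).proj = c.1.symm a ∧ tangentCoord I c (χ.symm (a, u)) = u := by
  have h3 := χ.right_inv (h2 a u ha)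
  rw [h1] at h3
  have h4 := (Prod.ext_iff.1 h3).1
  have h5 := (h0 _).1 (χ.map_target (h2 a u ha))
  refine ⟨?_, (Prod.ext_iff.1 h3).2⟩
  change c.1 _ = a at h4
  exact (c.1.left_inv h5).symm.trans (congrArg _ h4)

end Corners

/-! ### Projections of product models and differentials of linear maps. -/

section ModelProducts

variable {E : Type*} [AddCommGroup E] [Module ℝ E] [TopologicalSpace E] [IsLCS E]
  {H : Type*} [TopologicalSpace H] {J : LCModel E H}
  {E' : Type*} [AddCommGroup E'] [Module ℝ E'] [TopologicalSpace E'] [IsLCS E']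
  {H' : Type*} [TopologicalSpace H'] {J' : LCModel E' H'}
  {F : Type*} [AddCommGroup F] [Module ℝ F] [TopologicalSpace F] [IsLCS F]

theorem smAt_model_fst (p : ModelProd H H') :
    SmAt (J.prod J') J (fun q : ModelProd H H' => q.1) p :=
  smAt_of_toFun_comp ((smAt_toFun (J := J.prod J') p).clm_comp (ContinuousLinearMap.fst ℝ E E'))

theorem smAt_model_snd (p : ModelProd H H') :
    SmAt (J.prod J') J' (fun q : ModelProd H H' => q.2) p :=
  smAt_of_toFun_comp ((smAt_toFun (J := J.prod J') p).clm_comp (ContinuousLinearMap.snd ℝ E E'))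

theorem mdiff_clm (L : E →L[ℝ] F) (a u : E) : mdiff (LCModel.self E) L a u = L u := by
  refine (hasDirDeriv_mdiff (smAt_clm L a) u).unique ?_
  refine Tendsto.congr' (f₁ := fun _ => L u) ?_ tendsto_const_nhds
  filter_upwards [self_mem_nhdsWithin] with t ht
  have ht' : t ≠ 0 := ht
  simp [inv_smul_smul₀ ht']

end ModelProducts

/-! ### Smooth group operations. -/

section Groups

/-- The smoothness properties of a Lie group `G` modelled on `E`. -/
class SmGrp (E : Type*) [AddCommGroup E] [Module ℝ E] [TopologicalSpace E]
    (G : Type*) [Group G] [TopologicalSpace G] [ChartedSpace E G] : Prop where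
  compat : Compat (LCModel.self E) G
  smAt_mul : ∀ p : G × G, SmAt ((LCModel.self E).prod (LCModel.self E)) (LCModel.self E)
    (fun p : G × G => p.1 * p.2) p
  smAt_inv : ∀ g : G, SmAt (LCModel.self E) (LCModel.self E) (fun g : G => g⁻¹) g

instance instCompatSmGrp (E : Type*) [AddCommGroup E] [Module ℝ E] [TopologicalSpace E]
    (G : Type*) [Group G] [TopologicalSpace G] [ChartedSpace E G] [SmGrp E G] :
    Compat (LCModel.self E) G := SmGrp.compat

theorem IsLieGrp.smGrp {E : Type*} [AddCommGroup E] [Module ℝ E] [TopologicalSpace E]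
    {G : Type*} [Group G] [TopologicalSpace G] [ChartedSpace E G] [IsLCS E]
    (h : IsLieGrp E G) : SmGrp E G :=
  ⟨⟨h.isMfd.compatible⟩, h.smooth_mul.smAt, h.smooth_inv.smAt⟩

variable {𝔨 : Type*} [AddCommGroup 𝔨] [Module ℝ 𝔨] [TopologicalSpace 𝔨] [IsLCS 𝔨]
  {K : Type*} [Group K] [TopologicalSpace K] [ChartedSpace 𝔨 K] [SmGrp 𝔨 K]
  {E : Type*} [AddCommGroup E] [Module ℝ E] [TopologicalSpace E] [IsLCS E]
  {H : Type*} [TopologicalSpace H] {J : LCModel E H}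
  {X : Type*} [TopologicalSpace X] [ChartedSpace H X] [Compat J X]

theorem SmAt.mul {f g : X → K} {x : X} (hf : SmAt J (LCModel.self 𝔨) f x)
    (hg : SmAt J (LCModel.self 𝔨) g x) : SmAt J (LCModel.self 𝔨) (fun y => f y * g y) x :=
  SmAt.comp (g := fun p : K × K => p.1 * p.2) (f := fun y => (f y, g y))
    (SmGrp.smAt_mul (E := 𝔨) (f x, g x)) (hf.prodMk hg)

theorem SmAt.inv {f : X → K} {x : X} (hf : SmAt J (LCModel.self 𝔨) f x) :
    SmAt J (LCModel.self 𝔨) (fun y => (f y)⁻¹) x :=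
  SmAt.comp (g := fun p : K => p⁻¹) (SmGrp.smAt_inv (E := 𝔨) (f x)) hf

theorem SmAt.chart_one {f : X → K} {x : X} (hf : SmAt J (LCModel.self 𝔨) f x)
    (h1 : f x ∈ (chartAt 𝔨 (1 : K)).source) :
    SmAt J (LCModel.self 𝔨) (fun y => chartAt 𝔨 (1 : K) (f y)) x :=
  SmAt.comp (g := chartAt 𝔨 (1 : K)) (smAt_chart (chart_mem_atlas 𝔨 1) h1) hf

theorem SmAt.log {f g : X → K} {x : X} (hf : SmAt J (LCModel.self 𝔨) f x)
    (hg : SmAt J (LCModel.self 𝔨) g x) (h : f x = g x) :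
    SmAt J (LCModel.self 𝔨) (fun y => chartAt 𝔨 (1 : K) ((f y)⁻¹ * g y)) x := by
  refine (hf.inv.mul hg).chart_one ?_
  rw [h, inv_mul_cancel]
  exact mem_chart_source 𝔨 1

theorem smAt_chart_one_symm : SmAt (LCModel.self 𝔨) (LCModel.self 𝔨) (chartAt 𝔨 (1 : K)).symm
    (chartAt 𝔨 (1 : K) 1) :=
  smAt_chart_symm (chart_mem_atlas 𝔨 1) (mem_chart_target 𝔨 1)

theorem continuous_mul_of_smGrp (𝔨 : Type*) [AddCommGroup 𝔨] [Module ℝ 𝔨] [TopologicalSpace 𝔨]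
    [IsLCS 𝔨] {K : Type*} [Group K] [TopologicalSpace K] [ChartedSpace 𝔨 K] [SmGrp 𝔨 K] :
    IsTopologicalGroup K where
  continuous_mul := continuous_iff_continuousAt.2 fun p => (SmGrp.smAt_mul (E := 𝔨) p).continuousAt
  continuous_inv := continuous_iff_continuousAt.2 fun p => (SmGrp.smAt_inv (E := 𝔨) p).continuousAt

end Groups

/-! ### Uniqueness of evolutions in Lie groups. -/

section Evolution

/-- After affine reparametrization of `[a, b]` by `[0, 1]`, this is the mean value theorem with the
closed convex set `A = {0}`. -/
theorem eq_of_tendsto_slope_zero {F : Type*} [AddCommGroup F] [Module ℝ F] [TopologicalSpace F]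
    [IsLCS F] {τ : Icc (0 : ℝ) 1 → F} {a b : Icc (0 : ℝ) 1} (hab : a < b)
    (hc : ContinuousOn τ (Icc a b))
    (hd : ∀ t ∈ Icc a b, Tendsto (fun s : Icc (0 : ℝ) 1 => ((s : ℝ) - t)⁻¹ • (τ s - τ t))
      (𝓝[≠] t) (𝓝 0)) : τ b = τ a := by
  have hab' : (a : ℝ) < b := hab
  set d : ℝ := (b : ℝ) - a with hd'
  have hdpos : 0 < d := sub_pos.2 hab'
  set y : ℝ → Icc (0 : ℝ) 1 := fun r => projIcc 0 1 zero_le_one (a + r * d) with hy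
  have hyc : Continuous y := continuous_projIcc.comp (by fun_prop)
  have hyv : ∀ r ∈ Icc (0 : ℝ) 1, (y r : ℝ) = a + r * d := by
    intro r hr
    have h1 : (a : ℝ) + r * d ∈ Icc (0 : ℝ) 1 := by
      constructor
      · have := a.2.1
        have := mul_nonneg hr.1 hdpos.le
        linarith
      · have := b.2.2
        nlinarith [hr.2]
    simp [hy, projIcc_of_mem zero_le_one h1]
  have hymem : ∀ r ∈ Icc (0 : ℝ) 1, y r ∈ Icc a b := by
    intro r hr
    refine ⟨?_, ?_⟩
    · rw [← Subtype.coe_le_coe, hyv r hr]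
      nlinarith [hr.1]
    · rw [← Subtype.coe_le_coe, hyv r hr]
      nlinarith [hr.2]
  have key := sub_mem_of_hasDirDeriv_mem (g := fun r => τ (y r)) (g' := fun _ => 0) (A := {(0 : F)})
    (convex_singleton 0) isClosed_singleton (hc.comp hyc.continuousOn hymem) ?_
    (fun _ _ => rfl)
  · have e1 : y 1 = b := Subtype.ext (by rw [hyv 1 (by simp)]; simp [hd'])
    have e0 : y 0 = a := Subtype.ext (by rw [hyv 0 (by simp)]; simp)
    rw [e1, e0] at key
    exact sub_eq_zero.1 key
  · intro r hr
    have hr' := Ioo_subset_Icc_self hr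
    have hin : ∀ᶠ t : ℝ in 𝓝[≠] 0, r + t ∈ Ioo (0 : ℝ) 1 := by
      have : Tendsto (fun t : ℝ => r + t) (𝓝 0) (𝓝 (r + 0)) := Continuous.tendsto (by fun_prop) _
      rw [add_zero] at this
      exact this.mono_left nhdsWithin_le_nhds (isOpen_Ioo.mem_nhds hr)
    have h1 : Tendsto (fun t : ℝ => y (r + t)) (𝓝[≠] 0) (𝓝[≠] (y r)) := by
      refine tendsto_nhdsWithin_of_tendsto_nhds_of_eventually_within _ ?_ ?_
      · have : Tendsto (fun t : ℝ => y (r + t)) (𝓝 0) (𝓝 (y (r + 0))) :=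
          Continuous.tendsto (by fun_prop) _
        rw [add_zero] at this
        exact this.mono_left nhdsWithin_le_nhds
      · filter_upwards [hin, self_mem_nhdsWithin] with t ht ht0 h
        have h2 := congrArg (Subtype.val) h
        rw [hyv _ (Ioo_subset_Icc_self ht), hyv _ hr'] at h2
        have h3 : t * d = 0 := by linarith
        exact ht0 ((mul_eq_zero.1 h3).resolve_right hdpos.ne')
    have h2 := ((hd _ (hymem r hr')).comp h1).const_smul d
    rw [smul_zero] at h2
    refine h2.congr' ?_
    filter_upwards [hin, self_mem_nhdsWithin] with t ht ht0
    have ht0' : t ≠ 0 := ht0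
    simp only [Function.comp, smul_eq_mul, mul_one]
    rw [hyv _ (Ioo_subset_Icc_self ht), hyv _ hr', smul_smul]
    have hd0 : d ≠ 0 := hdpos.ne'
    congr 1
    rw [show (a : ℝ) + (r + t) * d - (a + r * d) = d * t by ring, mul_inv, ← mul_assoc,
      mul_inv_cancel₀ hd0, one_mul]

variable {𝔨 : Type*} [AddCommGroup 𝔨] [Module ℝ 𝔨] [TopologicalSpace 𝔨] [IsLCS 𝔨]
  {K : Type*} [Group K] [TopologicalSpace K] [ChartedSpace 𝔨 K] [SmGrp 𝔨 K]

/-- Up to conjugation by `γ t`, the increment of `η γ⁻¹` at `t` is the quotient of the increments of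
`η` and `γ`. These have the same derivative, and the quotient map is constant on the diagonal. -/
theorem IsEvolution.div {ξ : Icc (0 : ℝ) 1 → 𝔨} {γ η : Icc (0 : ℝ) 1 → K} (hγc : Continuous γ)
    (hηc : Continuous η) (hγ : IsEvolution ξ γ) (hη : IsEvolution ξ η) :
    IsEvolution (fun _ => (0 : 𝔨)) (fun t => η t * (γ t)⁻¹) := by
  have := continuous_mul_of_smGrp 𝔨 (K := K)
  intro t
  set k := γ t
  set c := chartAt 𝔨 (1 : K) with hcdef
  set e := c 1
  have h1s : (1 : K) ∈ c.source := mem_chart_source 𝔨 1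
  have hce : c.symm e = 1 := c.left_inv h1s
  -- At the coordinates of `(η t)⁻¹ * η s` and `(γ t)⁻¹ * γ s`, this gives the coordinates of `(η t
  -- * (γ t)⁻¹)⁻¹ * (η s * (γ s)⁻¹)`.
  let Q : 𝔨 × 𝔨 → 𝔨 := fun p => c (k * c.symm p.1 * (c.symm p.2)⁻¹ * k⁻¹)
  have hQ : SmAt (LCModel.self (𝔨 × 𝔨)) (LCModel.self 𝔨) Q (e, e) := by
    have a1 : SmAt (LCModel.self (𝔨 × 𝔨)) (LCModel.self 𝔨) (fun p : 𝔨 × 𝔨 => c.symm p.1) (e, e) :=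
      SmAt.comp (g := c.symm) (f := fun p : 𝔨 × 𝔨 => p.1) smAt_chart_one_symm
        (smAt_clm (ContinuousLinearMap.fst ℝ 𝔨 𝔨) _)
    have a2 : SmAt (LCModel.self (𝔨 × 𝔨)) (LCModel.self 𝔨) (fun p : 𝔨 × 𝔨 => c.symm p.2) (e, e) :=
      SmAt.comp (g := c.symm) (f := fun p : 𝔨 × 𝔨 => p.2) smAt_chart_one_symm
        (smAt_clm (ContinuousLinearMap.snd ℝ 𝔨 𝔨) _)
    refine ((((smAt_const k _).mul a1).mul a2.inv).mul (smAt_const k⁻¹ _)).chart_one ?_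
    simp only [hce]
    simp
  have hQ0 : mdiff (LCModel.self (𝔨 × 𝔨)) Q (e, e) (ξ t, ξ t) = 0 := by
    let L : 𝔨 →L[ℝ] 𝔨 × 𝔨 := (ContinuousLinearMap.id ℝ 𝔨).prod (ContinuousLinearMap.id ℝ 𝔨)
    have h2 := mdiff_comp (p := Q) (τ := L) (a := e) hQ (smAt_clm L e) (ξ t)
    have h3 : (fun b => Q (L b)) = fun _ => e := by
      funext b
      change c (k * c.symm b * (c.symm b)⁻¹ * k⁻¹) = e
      simp [e]
    rw [h3, mdiff_const] at h2
    rw [show (fun b => (LCModel.self (𝔨 × 𝔨)).toFun (L b)) = L from rfl, mdiff_clm] at h2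
    exact h2.symm
  have hlim := tendsto_mdiff hQ (l := 𝓝[≠] t) (t := fun s : Icc (0 : ℝ) 1 => (s : ℝ) - t)
    (y := fun s => (c ((η t)⁻¹ * η s), c ((γ t)⁻¹ * γ s))) (u := (ξ t, ξ t)) ?_ ?_
    ((hη t).prodMk_nhds (hγ t))
  · rw [hQ0] at hlim
    refine hlim.congr' ?_
    have ev : ∀ {f : Icc (0 : ℝ) 1 → K}, Continuous f →
        ∀ᶠ s in 𝓝[≠] t, (f t)⁻¹ * f s ∈ c.source := by
      intro f hf
      have h4 : Continuous fun s => (f t)⁻¹ * f s := continuous_const.mul hf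
      have h5 := h4.tendsto t
      rw [inv_mul_cancel] at h5
      exact h5.mono_left nhdsWithin_le_nhds (c.open_source.mem_nhds h1s)
    filter_upwards [ev hγc, ev hηc] with s h5 h6
    congr 2
    · simp only [Q, c.left_inv h5, c.left_inv h6]
      congr 1
      simp only [k]
      group
    · simp only [Q, hce, e]
      simp
  · have : Tendsto (fun s : Icc (0 : ℝ) 1 => (s : ℝ) - t) (𝓝 t) (𝓝 ((t : ℝ) - t)) :=
      Continuous.tendsto (by fun_prop) _
    rw [sub_self] at this
    exact this.mono_left nhdsWithin_le_nhds
  · filter_upwards [self_mem_nhdsWithin] with s hs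
    exact sub_ne_zero.2 fun h => hs (Subtype.ext h)

/-- In the chart at `1`, translated to `σ t₀`, the curve has slope zero at all nearby times, hence
is locally constant; the interval is connected. -/
theorem IsEvolution.const_of_zero {σ : Icc (0 : ℝ) 1 → K} (hc : Continuous σ)
    (hσ : IsEvolution (fun _ => (0 : 𝔨)) σ) (t : Icc (0 : ℝ) 1) : σ t = σ 0 := by
  have := continuous_mul_of_smGrp 𝔨 (K := K)
  set c := chartAt 𝔨 (1 : K) with hcdef
  have h1s : (1 : K) ∈ c.source := mem_chart_source 𝔨 1
  have hce : c.symm (c 1) = 1 := c.left_inv h1s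
  have hlc : IsLocallyConstant σ := by
    rw [IsLocallyConstant.iff_eventually_eq]
    intro t₀
    have hopen : IsOpen {t | (σ t₀)⁻¹ * σ t ∈ c.source} :=
      c.open_source.preimage (continuous_const.mul hc)
    have hmem : {t | (σ t₀)⁻¹ * σ t ∈ c.source} ∈ 𝓝 t₀ :=
      hopen.mem_nhds (by simpa using h1s)
    have hτ : ∀ t, (σ t₀)⁻¹ * σ t ∈ c.source →
        Tendsto (fun s : Icc (0 : ℝ) 1 => ((s : ℝ) - t)⁻¹ •
          (c ((σ t₀)⁻¹ * σ s) - c ((σ t₀)⁻¹ * σ t))) (𝓝[≠] t) (𝓝 0) := by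
      intro t ht
      -- Left translation by `(σ t₀)⁻¹ * σ t` in the chart; its differential carries the zero slope
      -- of the increments at `t` to the translated curve.
      let R : 𝔨 → 𝔨 := fun x => c (((σ t₀)⁻¹ * σ t) * c.symm x)
      have hR : SmAt (LCModel.self 𝔨) (LCModel.self 𝔨) R (c 1) := by
        refine ((smAt_const _ _).mul smAt_chart_one_symm).chart_one ?_
        rw [← hcdef, hce, mul_one]
        exact ht
      have hlim := tendsto_mdiff hR (l := 𝓝[≠] t) (t := fun s : Icc (0 : ℝ) 1 => (s : ℝ) - t)
        (y := fun s => c ((σ t)⁻¹ * σ s)) (u := 0) ?_ ?_ (hσ t)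
      · rw [mdiff_zero_right hR] at hlim
        refine hlim.congr' ?_
        have h4 : Continuous fun s => (σ t)⁻¹ * σ s := continuous_const.mul hc
        have h5 := h4.tendsto t
        rw [inv_mul_cancel] at h5
        filter_upwards [h5.mono_left nhdsWithin_le_nhds (c.open_source.mem_nhds h1s)] with s hs
        congr 2
        · simp only [R]
          rw [c.left_inv hs]
          congr 1
          group
        · simp only [R, hce, mul_one]
      · have : Tendsto (fun s : Icc (0 : ℝ) 1 => (s : ℝ) - t) (𝓝 t) (𝓝 ((t : ℝ) - t)) :=
          Continuous.tendsto (by fun_prop) _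
        rw [sub_self] at this
        exact this.mono_left nhdsWithin_le_nhds
      · filter_upwards [self_mem_nhdsWithin] with s hs
        exact sub_ne_zero.2 fun h => hs (Subtype.ext h)
    have hcont : ContinuousOn (fun t => c ((σ t₀)⁻¹ * σ t)) {t | (σ t₀)⁻¹ * σ t ∈ c.source} :=
      c.continuousOn.comp (continuous_const.mul hc).continuousOn fun t ht => ht
    obtain ⟨S, hS, hSc, hSsub⟩ : ∃ S ∈ 𝓝 t₀, S.OrdConnected ∧
        S ⊆ {t | (σ t₀)⁻¹ * σ t ∈ c.source} := by
      obtain ⟨ε, hε, hball⟩ := Metric.mem_nhds_iff.1 hmem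
      refine ⟨_, Metric.ball_mem_nhds t₀ hε, ?_, hball⟩
      have : Metric.ball t₀ ε = Subtype.val ⁻¹' (Metric.ball (t₀ : ℝ) ε) := rfl
      rw [this, Real.ball_eq_Ioo]
      exact ordConnected_Ioo.preimage_mono (fun _ _ h => h)
    filter_upwards [hS] with t ht
    have ht₀ := mem_of_mem_nhds hS
    have hval : c ((σ t₀)⁻¹ * σ t) = c ((σ t₀)⁻¹ * σ t₀) := by
      rcases lt_trichotomy t₀ t with h | h | h
      · exact eq_of_tendsto_slope_zero h (hcont.mono ((hSc.out ht₀ ht).trans hSsub))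
          fun s hs => hτ s (hSsub (hSc.out ht₀ ht hs))
      · rw [h]
      · exact (eq_of_tendsto_slope_zero h (hcont.mono ((hSc.out ht ht₀).trans hSsub))
          fun s hs => hτ s (hSsub (hSc.out ht ht₀ hs))).symm
    have h6 := c.injOn (hSsub ht) (hSsub ht₀) hval
    exact mul_left_cancel h6
  have : PreconnectedSpace (Icc (0 : ℝ) 1) := Subtype.preconnectedSpace isPreconnected_Icc
  exact hlc.apply_eq_of_preconnectedSpace t 0

theorem IsEvolution.unique {ξ : Icc (0 : ℝ) 1 → 𝔨} {γ η : Icc (0 : ℝ) 1 → K} (hγc : Continuous γ)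
    (hηc : Continuous η) (hγ : IsEvolution ξ γ) (hη : IsEvolution ξ η) (t : Icc (0 : ℝ) 1) :
    (γ 0)⁻¹ * γ t = (η 0)⁻¹ * η t := by
  have := continuous_mul_of_smGrp 𝔨 (K := K)
  have h : η t * (γ t)⁻¹ = η 0 * (γ 0)⁻¹ :=
    (IsEvolution.div hγc hηc hγ hη).const_of_zero (hηc.mul hγc.inv) t
  have h2 : η t = η 0 * (γ 0)⁻¹ * γ t := by
    rw [← h]
    group
  rw [h2]
  group

end Evolution

/-! ### Logarithmic derivatives of smooth families. -/

section LogDeriv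

variable {EM : Type*} [NormedAddCommGroup EM] [NormedSpace ℝ EM]
  {HM : Type*} [TopologicalSpace HM] {I : ModelWithCorners ℝ EM HM}
  {M : Type*} [TopologicalSpace M] [ChartedSpace HM M] [IsManifold I ∞ M]
  {𝔨 : Type*} [AddCommGroup 𝔨] [Module ℝ 𝔨] [TopologicalSpace 𝔨] [IsLCS 𝔨]
  {K : Type*} [Group K] [TopologicalSpace K] [ChartedSpace 𝔨 K] [SmGrp 𝔨 K]
  {EN : Type*} [AddCommGroup EN] [Module ℝ EN] [TopologicalSpace EN] [IsLCS EN]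
  {HN : Type*} [TopologicalSpace HN] {JN : LCModel EN HN}
  {N : Type*} [TopologicalSpace N] [ChartedSpace HN N] [Compat JN N]

theorem SmAt.log_chart {f : M → K} {m : M}
    (hf : SmAt (LCModel.ofCorners I) (LCModel.self 𝔨) f m) {i : OpenPartialHomeomorph M HM}
    (hi : i ∈ atlas HM M) (hm : m ∈ i.source) :
    SmAt (LCModel.ofCorners I) (LCModel.self 𝔨)
      (fun a => chartAt 𝔨 (1 : K) ((f m)⁻¹ * f (i.symm a))) (i m) := by
  refine SmAt.log (smAt_const (f m) _) (SmAt.comp (f := i.symm) (x := i m) (g := f) ?_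
    (smAt_chart_symm hi (i.map_source hm))) ?_
  · rw [i.left_inv hm]
    exact hf
  · rw [i.left_inv hm]

/-- The logarithmic derivative can be computed in any chart. -/
theorem leftLogDeriv_eq {f : M → K} {v : TangentBundle I M}
    (hf : SmAt (LCModel.ofCorners I) (LCModel.self 𝔨) f v.proj) {i : atlas HM M}
    (hv : v.proj ∈ i.1.source) :
    leftLogDeriv I 𝔨 f v = mdiff (LCModel.ofCorners I)
      (fun a => chartAt 𝔨 (1 : K) ((f v.proj)⁻¹ * f (i.1.symm a))) (i.1 v.proj)
      (tangentCoord I i v) := by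
  obtain ⟨m, v⟩ := v
  simp only at hf hv ⊢
  set j := chartAt HM m with hj
  have hjm : m ∈ j.source := mem_chart_source HM m
  suffices h : ∀ u : EM, mdiff (LCModel.ofCorners I)
      (fun a => chartAt 𝔨 (1 : K) ((f m)⁻¹ * f (j.symm a))) (j m) u =
      mdiff (LCModel.ofCorners I) (fun a => chartAt 𝔨 (1 : K) ((f m)⁻¹ * f (i.1.symm a))) (i.1 m)
      (tangentCoord I i ⟨m, u⟩) from h v
  intro u
  have h0 := hf.log_chart i.2 hv
  have e : i.1 (j.symm (j m)) = i.1 m := by rw [j.left_inv hjm]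
  have h1 := mdiff_comp (τ := fun b => i.1 (j.symm b)) (a := j m) (J := LCModel.ofCorners I)
    (by rw [e]; exact h0) (SmAt.comp (f := j.symm) (x := j m) (g := i.1)
      (by rw [j.left_inv hjm]; exact smAt_chart i.2 hv)
      (smAt_chart_symm (chart_mem_atlas HM m) (mem_chart_target HM m))) u
  rw [mdiff_chart_change hv, e] at h1
  rw [← h1]
  refine mdiff_congr (hf.log_chart (chart_mem_atlas HM m) hjm) ?_ u
  have h2 : ContinuousAt j.symm (j m) := j.symm.continuousAt (mem_chart_target HM m)
  have h3 : i.1.source ∈ 𝓝 (j.symm (j m)) := by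
    rw [j.left_inv hjm]
    exact i.1.open_source.mem_nhds hv
  filter_upwards [h2 h3] with b hb
  rw [i.1.left_inv hb]

theorem SmAt.slice {f : N × M → K} {n : N} {m : M}
    (hf : SmAt (JN.prod (LCModel.ofCorners I)) (LCModel.self 𝔨) f (n, m)) :
    SmAt (LCModel.ofCorners I) (LCModel.self 𝔨) (fun m => f (n, m)) m :=
  SmAt.comp (g := f) (f := fun m => (n, m)) hf ((smAt_const n m).prodMk (smAt_id m))

/-- In bundle coordinates, the logarithmic derivative is a partial differential of a smooth map
depending on `n` and the base point, so `SmAt.mdiff_param` applies. -/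
theorem smAt_leftLogDeriv {f : N × M → K} {n : N}
    {χ : OpenPartialHomeomorph (TangentBundle I M) (ModelProd HM EM)}
    (hχ : χ ∈ atlas (ModelProd HM EM) (TangentBundle I M)) {z : ModelProd HM EM}
    (hz : z ∈ χ.target)
    (hf : SmAt (JN.prod (LCModel.ofCorners I)) (LCModel.self 𝔨) f (n, (χ.symm z).proj)) :
    SmAt (JN.prod (LCModel.ofCorners I.tangent)) (LCModel.self 𝔨)
      (fun q : N × ModelProd HM EM => leftLogDeriv I 𝔨 (fun m => f (q.1, m)) (χ.symm q.2))
      (n, z) := by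
  obtain ⟨i, c, hc, hs, hval⟩ := exists_of_mem_atlas_tangentBundle hχ
  let J := LCModel.ofCorners I
  have hJ : LCModel.ofCorners I.tangent = J.prod (LCModel.self EM) := rfl
  rw [hJ]
  have hproj : ∀ w ∈ χ.target, (χ.symm w).proj ∈ i.1.source ∧ (χ.symm w).proj ∈ c.source ∧
      c (χ.symm w).proj = w.1 ∧ tangentCoord I i (χ.symm w) = w.2 ∧
      c.symm w.1 = (χ.symm w).proj ∧ w.1 ∈ c.target := by
    intro w hw
    have h1 := (hs _).1 (χ.map_target hw)
    have h2 := χ.right_inv hw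
    rw [hval] at h2
    have h3 : c (χ.symm w).proj = w.1 := (Prod.ext_iff.1 h2).1
    refine ⟨h1.1, h1.2, h3, (Prod.ext_iff.1 h2).2, ?_, ?_⟩
    · rw [← h3, c.left_inv h1.2]
    · rw [← h3]
      exact c.map_source h1.2
  obtain ⟨hi, -, -, -, hcz, hzt⟩ := hproj z hz
  have hq1 : SmAt (JN.prod (J.prod (LCModel.self EM))) J
      (fun q : N × ModelProd HM EM => q.2.1) (n, z) :=
    SmAt.comp (g := fun w : ModelProd HM EM => w.1) (f := fun q : N × ModelProd HM EM => q.2)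
      (x := (n, z)) (smAt_model_fst z) (smAt_snd (n, z))
  have hq2 : SmAt (JN.prod (J.prod (LCModel.self EM))) (LCModel.self EM)
      (fun q : N × ModelProd HM EM => q.2.2) (n, z) :=
    SmAt.comp (g := fun w : ModelProd HM EM => w.2) (f := fun q : N × ModelProd HM EM => q.2)
      (x := (n, z)) (smAt_model_snd z) (smAt_snd (n, z))
  have hq3 : SmAt (JN.prod (J.prod (LCModel.self EM))) J
      (fun q : N × ModelProd HM EM => c.symm q.2.1) (n, z) :=
    SmAt.comp (g := c.symm) (f := fun q : N × ModelProd HM EM => q.2.1) (x := (n, z))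
      (smAt_chart_symm hc hzt) hq1
  have hq4 : SmAt (JN.prod (J.prod (LCModel.self EM))) J
      (fun q : N × ModelProd HM EM => i.1 (c.symm q.2.1)) (n, z) :=
    SmAt.comp (g := i.1) (f := fun q : N × ModelProd HM EM => c.symm q.2.1) (x := (n, z))
      (smAt_chart i.2 (by simp only [hcz]; exact hi)) hq3
  -- The base point `x.1.2` and the differentiated variable `x.2` are kept apart, and in different
  -- charts; afterwards `x.2` is set to the image of the base point.
  let P : (N × HM) × HM → 𝔨 := fun x =>
    chartAt 𝔨 (1 : K) ((f (x.1.1, c.symm x.1.2))⁻¹ * f (x.1.1, i.1.symm x.2))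
  have hP : SmAt ((JN.prod J).prod J) (LCModel.self 𝔨) P ((n, z.1), i.1 (c.symm z.1)) := by
    have a1 : SmAt ((JN.prod J).prod J) JN (fun x : (N × HM) × HM => x.1.1)
        ((n, z.1), i.1 (c.symm z.1)) :=
      SmAt.comp (g := fun y : N × HM => y.1) (f := fun x : (N × HM) × HM => x.1)
        (x := ((n, z.1), i.1 (c.symm z.1))) (smAt_fst _) (smAt_fst _)
    have a2 : SmAt ((JN.prod J).prod J) J (fun x : (N × HM) × HM => x.1.2)
        ((n, z.1), i.1 (c.symm z.1)) :=
      SmAt.comp (g := fun y : N × HM => y.2) (f := fun x : (N × HM) × HM => x.1)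
        (x := ((n, z.1), i.1 (c.symm z.1))) (smAt_snd _) (smAt_fst _)
    have a3 : SmAt ((JN.prod J).prod J) J (fun x : (N × HM) × HM => c.symm x.1.2)
        ((n, z.1), i.1 (c.symm z.1)) :=
      SmAt.comp (g := c.symm) (f := fun x : (N × HM) × HM => x.1.2)
        (x := ((n, z.1), i.1 (c.symm z.1))) (smAt_chart_symm hc hzt) a2
    have a4 : SmAt ((JN.prod J).prod J) J (fun x : (N × HM) × HM => i.1.symm x.2)
        ((n, z.1), i.1 (c.symm z.1)) :=
      SmAt.comp (g := i.1.symm) (f := fun x : (N × HM) × HM => x.2)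
        (x := ((n, z.1), i.1 (c.symm z.1)))
        (smAt_chart_symm i.2 (i.1.map_source (by rw [hcz]; exact hi))) (smAt_snd _)
    have e4 : i.1.symm (i.1 (c.symm z.1)) = (χ.symm z).proj := by rw [hcz, i.1.left_inv hi]
    refine SmAt.log (SmAt.comp (g := f) (f := fun x : (N × HM) × HM => (x.1.1, c.symm x.1.2))
      (x := ((n, z.1), i.1 (c.symm z.1))) ?_ (a1.prodMk a3))
      (SmAt.comp (g := f) (f := fun x : (N × HM) × HM => (x.1.1, i.1.symm x.2))
      (x := ((n, z.1), i.1 (c.symm z.1))) ?_ (a1.prodMk a4)) ?_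
    · simp only [hcz]
      exact hf
    · simp only [e4]
      exact hf
    · simp only [e4]
      rw [hcz]
  have key := SmAt.comp (f := fun q : N × ModelProd HM EM =>
      (((q.1, q.2.1), (i.1 (c.symm q.2.1), q.2.2)) : (N × HM) × (HM × EM))) (x := (n, z))
      (hP.mdiff_param z.2) (((smAt_fst _).prodMk hq1).prodMk (hq4.prodMk hq2))
  refine key.congr ?_
  have hev : ∀ᶠ q : N × ModelProd HM EM in 𝓝 (n, z), SmAt (JN.prod J) (LCModel.self 𝔨) f
      (q.1, c.symm q.2.1) := by
    have h1 := hf.eventually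
    rw [← hcz] at h1
    exact (((smAt_fst _).prodMk hq3).continuousAt).eventually h1
  have hevt : ∀ᶠ q : N × ModelProd HM EM in 𝓝 (n, z), q.2 ∈ χ.target :=
    (continuous_snd.tendsto (n, z)) (χ.open_target.mem_nhds hz)
  filter_upwards [hev, hevt] with q hq hqt
  obtain ⟨b1, -, -, b4, b5, -⟩ := hproj q.2 hqt
  rw [b5] at hq
  rw [leftLogDeriv_eq hq.slice b1, b4, ← b5]

theorem leftLogDeriv_smooth (f : MapGroup I M 𝔨 K) :
    Smooth (LCModel.ofCorners I.tangent) (LCModel.self 𝔨) (leftLogDeriv I 𝔨 f) := by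
  refine smooth_of_cInfOn_chart fun χ hχ => ?_
  have h := cInfOn_chart_of_smAt (J := LCModel.ofCorners I.tangent)
    (f := fun z => leftLogDeriv I 𝔨 f (χ.symm z))
    (φ := OpenPartialHomeomorph.refl (ModelProd HM EM)) (by simp) χ.open_target (by simp)
    (fun z hz => ?_)
  · rw [show (OpenPartialHomeomorph.refl (ModelProd HM EM)) '' χ.target = χ.target
      from image_id _] at h
    exact h
  -- A single map is regarded as a family with a dummy real parameter.
  · have h1 := smAt_leftLogDeriv (JN := LCModel.self ℝ) (f := fun p : ℝ × M => f p.2) (n := 0)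
      hχ hz (SmAt.comp (g := f) (f := fun p : ℝ × M => p.2) (x := (0, (χ.symm z).proj))
        (f.smooth.smAt _) (smAt_snd _))
    exact SmAt.comp (f := fun z => ((0 : ℝ), z)) (x := z) h1 ((smAt_const _ _).prodMk (smAt_id _))

theorem leftLogDeriv_isLinearMap {f : M → K} {m : M}
    (hf : SmAt (LCModel.ofCorners I) (LCModel.self 𝔨) f m) :
    IsLinearMap ℝ (fun v : TangentSpace I m => leftLogDeriv I 𝔨 f ⟨m, v⟩) := by
  have h := hf.log_chart (chart_mem_atlas HM m) (mem_chart_source HM m)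
  exact ⟨fun v w => mdiff_add_right h v w, fun c v => mdiff_smul_right h c v⟩

/-- The logarithmic derivative as a one-form. -/
def logForm (f : MapGroup I M 𝔨 K) : OneForm I M 𝔨 :=
  ⟨⟨leftLogDeriv I 𝔨 f, leftLogDeriv_smooth f⟩, fun m => leftLogDeriv_isLinearMap (f.smooth.smAt m)⟩

/-- Linearity on each tangent space is a family of equations between continuous point evaluations.
-/
theorem isClosed_oneForm : IsClosed (OneForm I M 𝔨 :
    Set (SmoothFun (LCModel.ofCorners I.tangent) (TangentBundle I M) 𝔨)) := by
  have h : (OneForm I M 𝔨 : Set (SmoothFun (LCModel.ofCorners I.tangent) (TangentBundle I M) 𝔨)) =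
      (⋂ (m : M) (v : TangentSpace I m) (w : TangentSpace I m),
        {α : SmoothFun (LCModel.ofCorners I.tangent) (TangentBundle I M) 𝔨 |
          α ⟨m, v + w⟩ = α ⟨m, v⟩ + α ⟨m, w⟩}) ∩
      ⋂ (m : M) (c : ℝ) (v : TangentSpace I m),
        {α : SmoothFun (LCModel.ofCorners I.tangent) (TangentBundle I M) 𝔨 |
          α ⟨m, c • v⟩ = c • α ⟨m, v⟩} := by
    ext α
    simp only [mem_inter_iff, mem_iInter]
    exact ⟨fun h => ⟨fun m => (h m).map_add, fun m => (h m).map_smul⟩,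
      fun h m => ⟨h.1 m, h.2 m⟩⟩
  rw [h]
  refine IsClosed.inter ?_ ?_
  · refine isClosed_iInter fun m => isClosed_iInter fun v => isClosed_iInter fun w => ?_
    exact isClosed_eq (SmoothFun.continuous_eval_const _)
      ((SmoothFun.continuous_eval_const _).add (SmoothFun.continuous_eval_const _))
  · refine isClosed_iInter fun m => isClosed_iInter fun c => isClosed_iInter fun v => ?_
    exact isClosed_eq (SmoothFun.continuous_eval_const _)
      ((SmoothFun.continuous_eval_const _).const_smul c)

theorem SmAt.codRestrict {F : Type*} [AddCommGroup F] [Module ℝ F] [TopologicalSpace F] [IsLCS F]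
    {S : Submodule ℝ F} (hS : IsClosed (S : Set F)) {g : N → S} {n : N}
    (h : SmAt JN (LCModel.self F) (fun n => (g n : F)) n) : SmAt JN (LCModel.self S) g n := by
  obtain ⟨V, hV, hn, hVs, hc⟩ := h.exists_cInfOn (chart_mem_atlas HN n) (mem_chart_source HN n)
  exact smAt_of_cInfOn_chart (chart_mem_atlas HN n) hV hVs
    (CInfOn.codRestrict hS (good_chart_image JN hV hVs) hc) hn

/-- The family of logarithmic derivatives is jointly smooth on `N` and the charts of `TM`. The
exponential law applies, followed by restriction to the closed subspace of forms. -/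
theorem smAt_logForm {f : N → MapGroup I M 𝔨 K} (hf : ∀ p : N × M,
    SmAt (JN.prod (LCModel.ofCorners I)) (LCModel.self 𝔨) (fun p : N × M => f p.1 p.2) p) (n : N) :
    SmAt JN (LCModel.self (OneForm I M 𝔨)) (fun n => logForm (f n)) n := by
  refine SmAt.codRestrict isClosed_oneForm ?_
  exact SmoothFun.smAt_of_uncurry_chart isOpen_univ
    (fun n _ χ hχ z hz => smAt_leftLogDeriv (f := fun p : N × M => f p.1 p.2) hχ hz (hf _))
    (mem_univ n)

/-- The factor `k` cancels in `(k * f m)⁻¹ * (k * f x)`. -/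
theorem leftLogDeriv_mul_left (k : K) (f : M → K) (v : TangentBundle I M) :
    leftLogDeriv I 𝔨 (fun m => k * f m) v = leftLogDeriv I 𝔨 f v := by
  unfold leftLogDeriv
  congr 1
  funext y
  congr 1
  group

end LogDeriv

/-! ### Segments in model spaces. -/

section Line

variable {E : Type*} [AddCommGroup E] [Module ℝ E] [TopologicalSpace E]
  {H : Type*} [TopologicalSpace H]

/-- The affine segment from `a` to `b` in a model `H`. -/
def LCModel.line (J : LCModel E H) (a b : H) (s : ℝ) : H :=
  J.invFun (J.toFun a + s • (J.toFun b - J.toFun a))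

theorem LCModel.toFun_line (J : LCModel E H) (a b : H) {s : ℝ} (hs : s ∈ Icc (0 : ℝ) 1) :
    J.toFun (J.line a b s) = J.toFun a + s • (J.toFun b - J.toFun a) := by
  have h : J.toFun a + s • (J.toFun b - J.toFun a) ∈ range J.toFun :=
    J.convex_range.add_smul_sub_mem ⟨a, rfl⟩ ⟨b, rfl⟩ hs
  obtain ⟨x, hx⟩ := h
  rw [LCModel.line, ← hx, J.left_inv]

@[simp]
theorem LCModel.line_zero (J : LCModel E H) (a b : H) : J.line a b 0 = a := by
  simp [LCModel.line, J.left_inv]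

@[simp]
theorem LCModel.line_one (J : LCModel E H) (a b : H) : J.line a b 1 = b := by
  simp [LCModel.line, J.left_inv]

theorem LCModel.continuous_line [ContinuousAdd E] [ContinuousSMul ℝ E] (J : LCModel E H)
    (a b : H) : Continuous (J.line a b) :=
  J.continuous_invFun.comp (by fun_prop)

end Line

/-! ### Evolution along segments and injectivity of the logarithmic derivative. -/

section Segment

variable {EM : Type*} [NormedAddCommGroup EM] [NormedSpace ℝ EM]
  {HM : Type*} [TopologicalSpace HM] {I : ModelWithCorners ℝ EM HM}
  {M : Type*} [TopologicalSpace M] [ChartedSpace HM M] [IsManifold I ∞ M]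
  {𝔨 : Type*} [AddCommGroup 𝔨] [Module ℝ 𝔨] [TopologicalSpace 𝔨] [IsLCS 𝔨]
  {K : Type*} [Group K] [TopologicalSpace K] [ChartedSpace 𝔨 K] [SmGrp 𝔨 K]

/-- A ball intersected with the convex range of the model is convex. -/
theorem exists_convex_nhds (I : ModelWithCorners ℝ EM HM) {T : Set HM} (hT : IsOpen T) {a : HM}
    (ha : a ∈ T) : ∃ B : Set HM, IsOpen B ∧ a ∈ B ∧ B ⊆ T ∧ ∀ x ∈ B, ∀ y ∈ B, ∀ s ∈ Icc (0 : ℝ) 1,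
      (LCModel.ofCorners I).line x y s ∈ B := by
  let J := LCModel.ofCorners I
  obtain ⟨r, hr, hball⟩ := Metric.mem_nhds_iff.1
    ((hT.preimage J.continuous_invFun).mem_nhds (x := J.toFun a) (by simpa [J.left_inv] using ha))
  refine ⟨J.toFun ⁻¹' Metric.ball (J.toFun a) r, Metric.isOpen_ball.preimage J.continuous_toFun,
    Metric.mem_ball_self hr, fun x hx => ?_, fun x hx y hy s hs => ?_⟩
  · have := hball hx
    simpa [J.left_inv] using this
  · rw [mem_preimage, J.toFun_line x y hs]
    exact (convex_ball _ _).add_smul_sub_mem hx hy hs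

/-- The derivative of `f` along the segment is the value of `δ(f)` on its velocity `I b - I a`.
Hence `δ(f)` alone determines `f` along the segment up to left translation. -/
theorem isEvolution_line {f : M → K}
    (hf : ∀ m, SmAt (LCModel.ofCorners I) (LCModel.self 𝔨) f m) {c : atlas HM M}
    {χ : OpenPartialHomeomorph (TangentBundle I M) (ModelProd HM EM)}
    (hχ : ∀ a ∈ c.1.target, ∀ u : EM,
      (χ.symm (a, u)).proj = c.1.symm a ∧ tangentCoord I c (χ.symm (a, u)) = u)
    {a b : HM} (hab : ∀ s ∈ Icc (0 : ℝ) 1, (LCModel.ofCorners I).line a b s ∈ c.1.target) :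
    IsEvolution (fun s : Icc (0 : ℝ) 1 => leftLogDeriv I 𝔨 f (χ.symm
      ((LCModel.ofCorners I).line a b s, I b - I a)))
      (fun s => f (c.1.symm ((LCModel.ofCorners I).line a b s))) := by
  intro t
  set J := LCModel.ofCorners I
  have ht := hab t t.2
  obtain ⟨h1, h2⟩ := hχ _ ht (I b - I a)
  have hs : (χ.symm (J.line a b t, I b - I a)).proj ∈ c.1.source := by
    rw [h1]
    exact c.1.map_target ht
  beta_reduce
  rw [leftLogDeriv_eq (hf _) hs, h1, h2, c.1.right_inv ht]
  have hsm := (hf (c.1.symm (J.line a b t))).log_chart c.2 (c.1.map_target ht)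
  rw [c.1.right_inv ht] at hsm
  have key := tendsto_mdiff hsm (l := 𝓝[≠] t) (t := fun s : Icc (0 : ℝ) 1 => (s : ℝ) - t)
    (y := fun s => J.line a b s) (u := I b - I a) ?_ ?_ ?_
  · refine key.congr fun s => ?_
    rw [inv_mul_cancel]
  · have : Tendsto (fun s : Icc (0 : ℝ) 1 => (s : ℝ) - t) (𝓝 t) (𝓝 ((t : ℝ) - t)) :=
      Continuous.tendsto (by fun_prop) _
    rw [sub_self] at this
    exact this.mono_left nhdsWithin_le_nhds
  · filter_upwards [self_mem_nhdsWithin] with s hs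
    exact sub_ne_zero.2 fun h => hs (Subtype.ext h)
  · refine Tendsto.congr' (f₁ := fun _ => I b - I a) ?_ tendsto_const_nhds
    filter_upwards [self_mem_nhdsWithin] with s hs
    have h0 : (s : ℝ) - t ≠ 0 := sub_ne_zero.2 fun h => hs (Subtype.ext h)
    rw [J.toFun_line a b s.2, J.toFun_line a b t.2, add_sub_add_left_eq_sub, ← sub_smul,
      inv_smul_smul₀ h0]
    rfl

theorem continuous_line_comp {f : M → K}
    (hf : ∀ m, SmAt (LCModel.ofCorners I) (LCModel.self 𝔨) f m) {c : atlas HM M}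
    {a b : HM} (hab : ∀ s ∈ Icc (0 : ℝ) 1, (LCModel.ofCorners I).line a b s ∈ c.1.target) :
    Continuous fun s : Icc (0 : ℝ) 1 => f (c.1.symm ((LCModel.ofCorners I).line a b s)) := by
  have hfc : Continuous f := continuous_iff_continuousAt.2 fun m => (hf m).continuousAt
  refine hfc.comp ?_
  exact c.1.symm.continuousOn.comp_continuous
    (((LCModel.ofCorners I).continuous_line a b).comp continuous_subtype_val) fun s => hab s s.2

theorem exists_tangentBundle_chart (c : atlas HM M) :
    ∃ χ ∈ atlas (ModelProd HM EM) (TangentBundle I M),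
      (∀ a ∈ c.1.target, ∀ u : EM, ((a, u) : ModelProd HM EM) ∈ χ.target) ∧
      ∀ a ∈ c.1.target, ∀ u : EM,
        (χ.symm (a, u)).proj = c.1.symm a ∧ tangentCoord I c (χ.symm (a, u)) = u := by
  obtain ⟨χ, hχ, h0, h1, h2⟩ := exists_mem_atlas_tangentBundle (I := I) c
  exact ⟨χ, hχ, fun a ha u => h2 a u ha, fun a ha u => tangentBundle_chart_symm h1 h0 h2 ha u⟩

/-- Smooth maps with the same logarithmic derivative differ by a left translation. -/
theorem eq_of_leftLogDeriv_eq [ConnectedSpace M] {f g : M → K}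
    (hf : ∀ m, SmAt (LCModel.ofCorners I) (LCModel.self 𝔨) f m)
    (hg : ∀ m, SmAt (LCModel.ofCorners I) (LCModel.self 𝔨) g m)
    (h : ∀ v : TangentBundle I M, leftLogDeriv I 𝔨 f v = leftLogDeriv I 𝔨 g v)
    {m₀ : M} (h0 : f m₀ = g m₀) : f = g := by
  have hlc : IsLocallyConstant fun m => g m * (f m)⁻¹ := by
    rw [IsLocallyConstant.iff_eventually_eq]
    intro m
    set c : atlas HM M := achart HM m
    have hm : m ∈ c.1.source := mem_chart_source HM m
    obtain ⟨χ, -, -, hχ⟩ := exists_tangentBundle_chart (I := I) c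
    obtain ⟨B, hB, hmB, hBT, hconv⟩ := exists_convex_nhds I c.1.open_target (c.1.map_source hm)
    filter_upwards [(c.1.continuousAt hm) (hB.mem_nhds hmB), c.1.open_source.mem_nhds hm]
      with x hx hxs
    have hl : ∀ s ∈ Icc (0 : ℝ) 1, (LCModel.ofCorners I).line (c.1 m) (c.1 x) s ∈ c.1.target :=
      fun s hs => hBT (hconv _ hmB _ hx s hs)
    -- Along the chart segment from `m` to `x` both maps are evolutions of the same path, so their
    -- increments agree.
    have e1 := isEvolution_line (𝔨 := 𝔨) hf hχ hl
    have e2 := isEvolution_line (𝔨 := 𝔨) hg hχ hl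
    simp only [← h] at e2
    have e3 := IsEvolution.unique (continuous_line_comp hf hl) (continuous_line_comp hg hl) e1 e2 1
    simp only [Icc.coe_zero, Icc.coe_one, LCModel.line_zero, LCModel.line_one, c.1.left_inv hm,
      c.1.left_inv hxs] at e3
    have e4 : g x = g m * (f m)⁻¹ * f x := by
      rw [mul_assoc, e3]
      group
    rw [e4]
    group
  funext m
  have h1 := hlc.apply_eq_of_preconnectedSpace m m₀
  simp only [h0, mul_inv_cancel] at h1
  exact (mul_inv_eq_one.1 h1).symm

end Segment

/-! ### Smooth maps into manifolds with adapted charts. -/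

section AdaptedAtlas

variable {E : Type*} [AddCommGroup E] [Module ℝ E] [TopologicalSpace E] [IsLCS E]
  {F : Type*} [AddCommGroup F] [Module ℝ F] [TopologicalSpace F] [IsLCS F]
  {EN : Type*} [AddCommGroup EN] [Module ℝ EN] [TopologicalSpace EN] [IsLCS EN]
  {HN : Type*} [TopologicalSpace HN] {JN : LCModel EN HN}
  {N : Type*} [TopologicalSpace N] [ChartedSpace HN N] [Compat JN N]

/-- The codomain can be restricted to the closed range of `L`, on which `L` has a continuous linear
inverse. -/
theorem SmAt.of_closedEmbedding_comp {L : E →L[ℝ] F} (hL : IsClosedEmbedding L) {g : N → E} {n : N}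
    (h : SmAt JN (LCModel.self F) (fun n => L (g n)) n) : SmAt JN (LCModel.self E) g n := by
  let S : Submodule ℝ F := LinearMap.range (L : E →ₗ[ℝ] F)
  have hS : IsClosed (S : Set F) := by
    have : (S : Set F) = range L := LinearMap.coe_range _
    rw [this]
    exact hL.isClosed_range
  let e : E ≃ₗ[ℝ] S := LinearEquiv.ofInjective (L : E →ₗ[ℝ] F) hL.injective
  have he : ∀ x : S, L (e.symm x) = x := fun x => congrArg Subtype.val (e.apply_symm_apply x)
  let R : S →L[ℝ] E := ⟨e.symm.toLinearMap, by
    refine hL.isInducing.continuous_iff.2 ?_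
    exact continuous_subtype_val.congr fun x => (he x).symm⟩
  have h1 : SmAt JN (LCModel.self S) (fun n => e (g n)) n := SmAt.codRestrict hS h
  refine (h1.clm_comp R).congr (Eventually.of_forall fun y => ?_)
  exact e.symm_apply_apply (g y)

variable {HZ : Type*} [TopologicalSpace HZ]
  {Z : Type*} [TopologicalSpace Z] [ChartedSpace HZ Z]
  {X : Type*} [TopologicalSpace X] [ChartedSpace E X]

/-- The charts of `X` are the restrictions of smooth charts of `Z` along the injection
`e : X → Z`; the model space `E` of `X` is embedded in the one of `Z` by `L`. -/
structure IsAdaptedAtlas (JZ : LCModel F HZ) (L : E →L[ℝ] F) (e : X → Z) : Prop where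
  closedEmbedding : IsClosedEmbedding L
  isInducing : IsInducing e
  exists_chart : ∀ c ∈ atlas E X, ∃ ψ : OpenPartialHomeomorph Z HZ,
    (∀ z ∈ ψ.source, SmAt JZ JZ ψ z) ∧ (∀ y ∈ ψ.target, SmAt JZ JZ ψ.symm y) ∧
    c.source = e ⁻¹' ψ.source ∧ ∀ x ∈ c.source, L (c x) = JZ.toFun (ψ (e x))

variable {JZ : LCModel F HZ} {L : E →L[ℝ] F} {e : X → Z}

theorem IsAdaptedAtlas.smAt_chart_comp (h : IsAdaptedAtlas JZ L e) [Compat JZ Z] {f : N → X} {n : N}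
    (hf : SmAt JN JZ (fun n => e (f n)) n) (hfc : ContinuousAt f n)
    {c : OpenPartialHomeomorph X E} (hc : c ∈ atlas E X) (hn : f n ∈ c.source) :
    SmAt JN (LCModel.self E) (fun n => c (f n)) n := by
  obtain ⟨ψ, hψ, -, hs, hv⟩ := h.exists_chart c hc
  refine SmAt.of_closedEmbedding_comp h.closedEmbedding ?_
  have hn' : e (f n) ∈ ψ.source := by
    rw [hs] at hn
    exact hn
  have h1 : SmAt JN JZ (fun n => ψ (e (f n))) n :=
    SmAt.comp (g := ψ) (f := fun n => e (f n)) (hψ _ hn') hf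
  have h2 : SmAt JN (LCModel.self F) (fun n => JZ.toFun (ψ (e (f n)))) n :=
    SmAt.comp (g := JZ.toFun) (f := fun n => ψ (e (f n))) (smAt_toFun _) h1
  refine h2.congr ?_
  filter_upwards [hfc (c.open_source.mem_nhds hn)] with y hy
  exact (hv _ hy).symm

theorem IsAdaptedAtlas.smAt_of_comp (h : IsAdaptedAtlas JZ L e) [Compat JZ Z] {f : N → X} {n : N}
    (hf : SmAt JN JZ (fun n => e (f n)) n) : SmAt JN (LCModel.self E) f n := by
  have hfc : ContinuousAt f n := h.isInducing.continuousAt_iff.2 hf.continuousAt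
  have h1 := h.smAt_chart_comp hf hfc (chart_mem_atlas E (f n)) (mem_chart_source E (f n))
  have h2 : SmAt JN (LCModel.self E) (fun y => (chartAt E (f n)).symm (chartAt E (f n) (f y))) n :=
    SmAt.comp (g := (chartAt E (f n)).symm) (f := fun y => chartAt E (f n) (f y))
      (smAt_chart_symm (chart_mem_atlas E (f n)) (mem_chart_target E (f n))) h1
  refine h2.congr ?_
  filter_upwards [hfc ((chartAt E (f n)).open_source.mem_nhds (mem_chart_source E (f n)))] with y hy
  exact (chartAt E (f n)).left_inv hy

/-- The inverse chart followed by `e` is `L` followed by the inverse of an adapted chart of `Z`.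
Invertibility of the model map makes `JZ.invFun ∘ L` smooth. -/
theorem IsAdaptedAtlas.smAt_comp_symm (h : IsAdaptedAtlas JZ L e)
    (hJZ : ∀ y, JZ.toFun (JZ.invFun y) = y) {c : OpenPartialHomeomorph X E} (hc : c ∈ atlas E X)
    {y : E} (hy : y ∈ c.target) : SmAt (LCModel.self E) JZ (fun y => e (c.symm y)) y := by
  obtain ⟨ψ, hψ, hψ', hs, hv⟩ := h.exists_chart c hc
  have hval : ∀ y ∈ c.target, JZ.invFun (L y) ∈ ψ.target ∧
      ψ.symm (JZ.invFun (L y)) = e (c.symm y) := by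
    intro y hy
    have h1 := c.map_target hy
    have h2 := hv _ h1
    rw [c.right_inv hy] at h2
    rw [hs] at h1
    rw [h2, JZ.left_inv]
    exact ⟨ψ.map_source h1, ψ.left_inv h1⟩
  have h1 : SmAt (LCModel.self E) JZ (fun y => JZ.invFun (L y)) y :=
    smAt_of_toFun_comp ((smAt_clm L y).congr (Eventually.of_forall fun y => (hJZ _).symm))
  have h2 : SmAt (LCModel.self E) JZ (fun y => ψ.symm (JZ.invFun (L y))) y :=
    SmAt.comp (g := ψ.symm) (f := fun y => JZ.invFun (L y)) (hψ' _ (hval y hy).1) h1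
  refine h2.congr ?_
  filter_upwards [c.open_target.mem_nhds hy] with z hz
  exact (hval z hz).2

/-- Chart changes of `X` are smooth because smoothness into a chart of `X` can be tested after
composing with `e`. -/
theorem IsAdaptedAtlas.compat (h : IsAdaptedAtlas JZ L e) [Compat JZ Z]
    (hJZ : ∀ y, JZ.toFun (JZ.invFun y) = y) : Compat (LCModel.self E) X := by
  refine ⟨fun c hc c' hc' => ?_⟩
  have hO : IsOpen (c.target ∩ c.symm ⁻¹' c'.source) :=
    c.isOpen_inter_preimage_symm c'.open_source
  have h1 := cInfOn_chart_of_smAt (J := LCModel.self E) (f := fun y => c' (c.symm y))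
    (φ := OpenPartialHomeomorph.refl E) (by simp) hO (by simp) fun y hy =>
      h.smAt_chart_comp (f := c.symm) (h.smAt_comp_symm hJZ hc hy.1) (c.symm.continuousAt hy.1)
        hc' hy.2
  rw [show (OpenPartialHomeomorph.refl E) '' _ = _ from image_id _] at h1
  exact h1

theorem IsAdaptedAtlas.smAt (h : IsAdaptedAtlas JZ L e)
    (hJZ : ∀ y, JZ.toFun (JZ.invFun y) = y) (x : X) : SmAt (LCModel.self E) JZ e x := by
  have h2 : SmAt (LCModel.self E) JZ (fun y => e ((chartAt E x).symm (chartAt E x y))) x :=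
    SmAt.comp (g := fun y => e ((chartAt E x).symm y)) (f := chartAt E x)
      (h.smAt_comp_symm hJZ (chart_mem_atlas E x) (mem_chart_target E x))
      (smAt_chart (chart_mem_atlas E x) (mem_chart_source E x))
  refine h2.congr ?_
  filter_upwards [(chartAt E x).open_source.mem_nhds (mem_chart_source E x)] with y hy
  rw [(chartAt E x).left_inv hy]

theorem IsAdaptedAtlas.smAt_iff (h : IsAdaptedAtlas JZ L e) [Compat JZ Z]
    (hJZ : ∀ y, JZ.toFun (JZ.invFun y) = y) {f : N → X} {n : N} :
    SmAt JN (LCModel.self E) f n ↔ SmAt JN JZ (fun n => e (f n)) n := by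
  have := h.compat hJZ
  exact ⟨fun hf => SmAt.comp (g := e) (f := f) (h.smAt hJZ _) hf, h.smAt_of_comp⟩

end AdaptedAtlas

/-! ### Adapted charts for based maps and for products. -/

section Structures

theorem isAdaptedAtlas_transport {V : Type*} [AddCommGroup V] [Module ℝ V] [TopologicalSpace V]
    [IsLCS V] {S : Set V} {F : Submodule ℝ V} (hS : IsSubmanifold S F) {X : Type*} (δ : X ≃ S) :
    letI : ChartedSpace F S := hS.chartedSpace
    letI : TopologicalSpace X := TopologicalSpace.induced δ inferInstance
    letI : ChartedSpace F X := transportCharts δ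
    IsAdaptedAtlas (LCModel.self V) F.subtypeL (fun x => (δ x : V)) := by
  let _ : ChartedSpace F S := hS.chartedSpace
  let _ : TopologicalSpace X := TopologicalSpace.induced δ inferInstance
  let _ : ChartedSpace F X := transportCharts δ
  refine ⟨hS.isClosed.isClosedEmbedding_subtypeVal, IsInducing.subtypeVal.comp ⟨rfl⟩, ?_⟩
  rintro _ ⟨c, ⟨φ, hφ, hs, hv⟩, rfl⟩
  refine ⟨φ, fun z hz => smAt_of_cInfOn φ.open_source hφ.smooth hz,
    fun z hz => smAt_of_cInfOn φ.open_target hφ.smooth_symm hz, ?_, ?_⟩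
  · ext x
    have h : δ x ∈ c.source ↔ (δ x : V) ∈ φ.source := by rw [hs]; rfl
    simpa using h
  · intro x hx
    exact hv (δ x) (by simpa using hx)

/-- The product of a chart of `K` with an adapted chart of `V` is adapted to `K × X`; the factor `K`
contributes the identity to the embedding of model spaces. -/
theorem isAdaptedAtlas_prod {V : Type*} [AddCommGroup V] [Module ℝ V] [TopologicalSpace V]
    [IsLCS V] {E : Type*} [AddCommGroup E] [Module ℝ E] [TopologicalSpace E] [IsLCS E]
    {𝔨 : Type*} [AddCommGroup 𝔨] [Module ℝ 𝔨] [TopologicalSpace 𝔨] [IsLCS 𝔨]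
    {K : Type*} [TopologicalSpace K] [ChartedSpace 𝔨 K] [Compat (LCModel.self 𝔨) K]
    {X : Type*} [TopologicalSpace X] [ChartedSpace E X] {L : E →L[ℝ] V} {e : X → V}
    (he : IsAdaptedAtlas (LCModel.self V) L e) {G : Type*} (Φ : G ≃ K × X) :
    letI : ChartedSpace (𝔨 × E) (K × X) := prodCharts 𝔨 E K X
    letI : TopologicalSpace G := TopologicalSpace.induced Φ inferInstance
    letI : ChartedSpace (𝔨 × E) G := transportCharts Φ
    IsAdaptedAtlas ((LCModel.self 𝔨).prod (LCModel.self V))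
      ((ContinuousLinearMap.id ℝ 𝔨).prodMap L) (fun g => ((Φ g).1, e (Φ g).2)) := by
  let _ : ChartedSpace (𝔨 × E) (K × X) := prodCharts 𝔨 E K X
  let _ : TopologicalSpace G := TopologicalSpace.induced Φ inferInstance
  let _ : ChartedSpace (𝔨 × E) G := transportCharts Φ
  refine ⟨?_, (IsInducing.id.prodMap he.isInducing).comp ⟨rfl⟩, ?_⟩
  · exact IsClosedEmbedding.prodMap .id he.closedEmbedding
  rintro _ ⟨_, ⟨κ, hκ, c, hc, rfl⟩, rfl⟩
  obtain ⟨ψ, h1, h2, h3, h4⟩ := he.exists_chart c hc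
  refine ⟨κ.prod ψ, ?_, ?_, ?_, ?_⟩
  · rintro ⟨k, v⟩ ⟨hk, hv⟩
    have a1 : SmAt ((LCModel.self 𝔨).prod (LCModel.self V)) (LCModel.self 𝔨)
        (fun z : K × V => κ z.1) (k, v) :=
      SmAt.comp (g := κ) (f := fun z : K × V => z.1) (x := (k, v)) (smAt_chart hκ hk) (smAt_fst _)
    have a2 : SmAt ((LCModel.self 𝔨).prod (LCModel.self V)) (LCModel.self V)
        (fun z : K × V => ψ z.2) (k, v) :=
      SmAt.comp (g := ψ) (f := fun z : K × V => z.2) (x := (k, v)) (h1 v hv) (smAt_snd _)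
    exact smAt_of_toFun_comp (a1.prodMk_vec a2)
  · rintro ⟨k, v⟩ ⟨hk, hv⟩
    have a1 : SmAt ((LCModel.self 𝔨).prod (LCModel.self V)) (LCModel.self 𝔨)
        (fun z : ModelProd 𝔨 V => κ.symm z.1) (k, v) :=
      SmAt.comp (g := κ.symm) (f := fun z : ModelProd 𝔨 V => z.1) (x := (k, v))
        (smAt_chart_symm hκ hk) (smAt_model_fst _)
    have a2 : SmAt ((LCModel.self 𝔨).prod (LCModel.self V)) (LCModel.self V)
        (fun z : ModelProd 𝔨 V => ψ.symm z.2) (k, v) :=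
      SmAt.comp (g := ψ.symm) (f := fun z : ModelProd 𝔨 V => z.2) (x := (k, v)) (h2 v hv)
        (smAt_model_snd _)
    exact a1.prodMk a2
  · ext g
    have h : (Φ g).2 ∈ c.source ↔ e (Φ g).2 ∈ ψ.source := by rw [h3]; rfl
    simp [h]
  · intro g hg
    have hg' : (Φ g).2 ∈ c.source := by
      simp at hg
      exact hg.2
    exact Prod.ext rfl (h4 _ hg')

end Structures

/-! ### Evolution maps. -/

section Regular

variable {𝔨 : Type*} [AddCommGroup 𝔨] [Module ℝ 𝔨] [TopologicalSpace 𝔨] [IsLCS 𝔨]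
  {K : Type*} [Group K] [TopologicalSpace K] [ChartedSpace 𝔨 K] [SmGrp 𝔨 K]

/-- The space `C^∞([0,1], 𝔨)`. -/
abbrev Paths (𝔨 : Type*) [AddCommGroup 𝔨] [Module ℝ 𝔨] [TopologicalSpace 𝔨] [IsLCS 𝔨] : Type _ :=
  SmoothFun LCModel.unitInterval (Icc (0 : ℝ) 1) 𝔨

/-- `evol` is a smooth evolution map of the Lie group `K`. -/
structure IsEvol (evol : Paths 𝔨 → K) : Prop where
  smAt : ∀ ξ, SmAt (LCModel.self (Paths 𝔨)) (LCModel.self 𝔨) evol ξ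
  exists_curve : ∀ ξ : Paths 𝔨, ∃ γ : Icc (0 : ℝ) 1 → K, Continuous γ ∧ γ 0 = 1 ∧
    IsEvolution ξ γ ∧ evol ξ = γ 1

/-- Of the smoothness of the curves only continuity is kept, which is all that uniqueness of
evolutions uses. -/
theorem IsRegularGrp.exists_isEvol (h : IsRegularGrp 𝔨 K) :
    ∃ evol : Paths 𝔨 → K, IsEvol evol := by
  obtain ⟨evol, hs, h⟩ := h
  refine ⟨evol, hs.smAt, fun ξ => ?_⟩
  obtain ⟨γ, h1, h2, h3, h4⟩ := h ξ
  exact ⟨γ, h1.continuous, h2, h3, h4⟩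

theorem IsEvol.eq_mul {evol : Paths 𝔨 → K} (h : IsEvol evol) {ξ : Paths 𝔨}
    {η : Icc (0 : ℝ) 1 → K} (hc : Continuous η) (hη : IsEvolution ξ η) :
    η 1 = η 0 * evol ξ := by
  obtain ⟨γ, h1, h2, h3, h4⟩ := h.exists_curve ξ
  have h5 := IsEvolution.unique hc h1 hη h3 1
  rw [h2, inv_one, one_mul, ← h4] at h5
  rw [← h5, mul_inv_cancel_left]

end Regular

/-! ### One-forms along segments. -/

section SegmentForms

variable {EM : Type*} [NormedAddCommGroup EM] [NormedSpace ℝ EM] [FiniteDimensional ℝ EM]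
  {HM : Type*} [TopologicalSpace HM] {I : ModelWithCorners ℝ EM HM}
  {M : Type*} [TopologicalSpace M] [ChartedSpace HM M] [IsManifold I ∞ M]
  {𝔨 : Type*} [AddCommGroup 𝔨] [Module ℝ 𝔨] [TopologicalSpace 𝔨] [IsLCS 𝔨]

theorem locallyCompactSpace_of_finiteDimensional (E : Type*) [NormedAddCommGroup E]
    [NormedSpace ℝ E] [FiniteDimensional ℝ E] : LocallyCompactSpace E := by
  have := FiniteDimensional.proper_real E
  infer_instance

/-- The position and velocity of the segment are smooth in its end points and the time, and
evaluation of functions on `TM` is smooth in both arguments since `TM` has a finite-dimensional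
model. -/
theorem smAt_segmentForm {c : atlas HM M}
    {χ : OpenPartialHomeomorph (TangentBundle I M) (ModelProd HM EM)}
    (hχ : χ ∈ atlas (ModelProd HM EM) (TangentBundle I M))
    (hχt : ∀ a ∈ c.1.target, ∀ u : EM, ((a, u) : ModelProd HM EM) ∈ χ.target)
    (α : OneForm I M 𝔨) {a b : HM} {s : Icc (0 : ℝ) 1}
    (hab : (LCModel.ofCorners I).line a b s ∈ c.1.target) :
    SmAt (((LCModel.self (OneForm I M 𝔨)).prod
      ((LCModel.ofCorners I).prod (LCModel.ofCorners I))).prod LCModel.unitInterval)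
      (LCModel.self 𝔨)
      (fun q : (OneForm I M 𝔨 × (HM × HM)) × Icc (0 : ℝ) 1 =>
        q.1.1.1 (χ.symm ((LCModel.ofCorners I).line q.1.2.1 q.1.2.2 q.2, I q.1.2.2 - I q.1.2.1)))
      ((α, (a, b)), s) := by
  set J := LCModel.ofCorners I
  have : LocallyCompactSpace EM := locallyCompactSpace_of_finiteDimensional EM
  set JJ := ((LCModel.self (OneForm I M 𝔨)).prod (J.prod J)).prod LCModel.unitInterval
  set q₀ : (OneForm I M 𝔨 × (HM × HM)) × Icc (0 : ℝ) 1 := ((α, (a, b)), s)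
  have b1 : SmAt JJ ((LCModel.self (OneForm I M 𝔨)).prod (J.prod J))
      (fun q : (OneForm I M 𝔨 × (HM × HM)) × Icc (0 : ℝ) 1 => q.1) q₀ := smAt_fst _
  have b2 : SmAt JJ (LCModel.self (OneForm I M 𝔨))
      (fun q : (OneForm I M 𝔨 × (HM × HM)) × Icc (0 : ℝ) 1 => q.1.1) q₀ :=
    SmAt.comp (g := fun p : OneForm I M 𝔨 × (HM × HM) => p.1) (smAt_fst _) b1
  have b3 : SmAt JJ (J.prod J)
      (fun q : (OneForm I M 𝔨 × (HM × HM)) × Icc (0 : ℝ) 1 => q.1.2) q₀ :=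
    SmAt.comp (g := fun p : OneForm I M 𝔨 × (HM × HM) => p.2) (smAt_snd _) b1
  have b4 : SmAt JJ (LCModel.self EM)
      (fun q : (OneForm I M 𝔨 × (HM × HM)) × Icc (0 : ℝ) 1 => J.toFun q.1.2.1) q₀ :=
    SmAt.comp (g := J.toFun) (f := fun q : (OneForm I M 𝔨 × (HM × HM)) × Icc (0 : ℝ) 1 => q.1.2.1)
      (smAt_toFun _) (SmAt.comp (g := fun p : HM × HM => p.1) (smAt_fst _) b3)
  have b5 : SmAt JJ (LCModel.self EM)
      (fun q : (OneForm I M 𝔨 × (HM × HM)) × Icc (0 : ℝ) 1 => J.toFun q.1.2.2) q₀ :=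
    SmAt.comp (g := J.toFun) (f := fun q : (OneForm I M 𝔨 × (HM × HM)) × Icc (0 : ℝ) 1 => q.1.2.2)
      (smAt_toFun _) (SmAt.comp (g := fun p : HM × HM => p.2) (smAt_snd _) b3)
  have b6 : SmAt JJ (LCModel.self ℝ)
      (fun q : (OneForm I M 𝔨 × (HM × HM)) × Icc (0 : ℝ) 1 => (q.2 : ℝ)) q₀ :=
    SmAt.comp (g := LCModel.unitInterval.toFun)
      (f := fun q : (OneForm I M 𝔨 × (HM × HM)) × Icc (0 : ℝ) 1 => q.2)
      (smAt_toFun _) (smAt_snd _)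
  let ρ : (OneForm I M 𝔨 × (HM × HM)) × Icc (0 : ℝ) 1 → ModelProd HM EM := fun q =>
    (J.line q.1.2.1 q.1.2.2 q.2, I q.1.2.2 - I q.1.2.1)
  have b7 : SmAt JJ (LCModel.ofCorners I.tangent) ρ q₀ := by
    refine smAt_of_toFun_comp ?_
    refine ((b4.add (b6.smul (b5.sub b4))).prodMk_vec (b5.sub b4)).congr
      (Eventually.of_forall fun q => ?_)
    refine Prod.ext ?_ rfl
    exact (J.toFun_line q.1.2.1 q.1.2.2 q.2.2).symm
  have b8 : SmAt JJ (LCModel.self (SmoothFun (LCModel.ofCorners I.tangent) (TangentBundle I M) 𝔨))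
      (fun q : (OneForm I M 𝔨 × (HM × HM)) × Icc (0 : ℝ) 1 => (q.1.1 : SmoothFun
        (LCModel.ofCorners I.tangent) (TangentBundle I M) 𝔨)) q₀ :=
    b2.clm_comp (OneForm I M 𝔨).subtypeL
  exact SmAt.comp (f := fun q : (OneForm I M 𝔨 × (HM × HM)) × Icc (0 : ℝ) 1 =>
      ((q.1.1 : SmoothFun (LCModel.ofCorners I.tangent) (TangentBundle I M) 𝔨), ρ q))
      (SmoothFun.smAt_eval_chart (J := LCModel.ofCorners I.tangent) hχ α.1 (hχt _ hab _))
      (b8.prodMk b7)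

/-- The integrands for the evolution along the segments in a convex chart domain `B`. -/
theorem exists_segmentPath {c : atlas HM M}
    {χ : OpenPartialHomeomorph (TangentBundle I M) (ModelProd HM EM)}
    (hχ : χ ∈ atlas (ModelProd HM EM) (TangentBundle I M))
    (hχt : ∀ a ∈ c.1.target, ∀ u : EM, ((a, u) : ModelProd HM EM) ∈ χ.target)
    {B : Set HM} (hB : IsOpen B) (hconv : ∀ x ∈ B, ∀ y ∈ B, ∀ s ∈ Icc (0 : ℝ) 1,
      (LCModel.ofCorners I).line x y s ∈ c.1.target) :
    ∃ Ξ : OneForm I M 𝔨 × (HM × HM) → Paths 𝔨,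
      (∀ α, ∀ a ∈ B, ∀ b ∈ B, SmAt ((LCModel.self (OneForm I M 𝔨)).prod
        ((LCModel.ofCorners I).prod (LCModel.ofCorners I))) (LCModel.self (Paths 𝔨)) Ξ
          (α, (a, b))) ∧
      ∀ α, ∀ a ∈ B, ∀ b ∈ B, ∀ s : Icc (0 : ℝ) 1, Ξ (α, (a, b)) s =
        α.1 (χ.symm ((LCModel.ofCorners I).line a b s, I b - I a)) := by
  classical
  have hsm : ∀ p : OneForm I M 𝔨 × (HM × HM), p.2.1 ∈ B ∧ p.2.2 ∈ B →
      Smooth LCModel.unitInterval (LCModel.self 𝔨) (fun s : Icc (0 : ℝ) 1 =>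
        p.1.1 (χ.symm ((LCModel.ofCorners I).line p.2.1 p.2.2 s, I p.2.2 - I p.2.1))) := by
    intro p hp
    refine smooth_iff.2 fun s => ?_
    exact SmAt.comp (f := fun s : Icc (0 : ℝ) 1 => (p, s))
      (smAt_segmentForm (c := c) hχ hχt p.1 (hconv _ hp.1 _ hp.2 s s.2))
      ((smAt_const p s).prodMk (smAt_id s))
  -- Outside the open set of admissible end points the integrand is set to `0`; only germs on that
  -- set matter.
  let Ξ : OneForm I M 𝔨 × (HM × HM) → Paths 𝔨 := fun p =>
    if hp : p.2.1 ∈ B ∧ p.2.2 ∈ B then ⟨_, hsm p hp⟩ else 0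
  have hΞ : ∀ α, ∀ a ∈ B, ∀ b ∈ B, ∀ s : Icc (0 : ℝ) 1, Ξ (α, (a, b)) s =
        α.1 (χ.symm ((LCModel.ofCorners I).line a b s, I b - I a)) := by
    intro α a ha b hb s
    have : Ξ (α, (a, b)) = ⟨_, hsm (α, (a, b)) ⟨ha, hb⟩⟩ := dif_pos ⟨ha, hb⟩
    rw [this]
  refine ⟨Ξ, fun α a ha b hb => ?_, hΞ⟩
  have hW : IsOpen ((univ : Set (OneForm I M 𝔨)) ×ˢ (B ×ˢ B)) := isOpen_univ.prod (hB.prod hB)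
  refine SmoothFun.smAt_of_uncurry hW ?_ ⟨mem_univ _, ha, hb⟩
  rintro ⟨α, a, b⟩ ⟨-, ha, hb⟩ s
  refine (smAt_segmentForm (c := c) hχ hχt α (hconv _ ha _ hb s s.2)).congr ?_
  have : ∀ᶠ q : (OneForm I M 𝔨 × (HM × HM)) × Icc (0 : ℝ) 1 in 𝓝 ((α, (a, b)), s),
      q.1 ∈ (univ : Set (OneForm I M 𝔨)) ×ˢ (B ×ˢ B) :=
    (continuous_fst.tendsto ((α, (a, b)), s)) (hW.mem_nhds ⟨mem_univ _, ha, hb⟩)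
  filter_upwards [this] with q hq
  exact (hΞ q.1.1 q.1.2.1 hq.2.1 q.1.2.2 hq.2.2 q.2).symm

end SegmentForms

/-! ### Reconstruction of smooth families from their logarithmic derivatives. -/

section Families

variable {EM : Type*} [NormedAddCommGroup EM] [NormedSpace ℝ EM] [FiniteDimensional ℝ EM]
  {HM : Type*} [TopologicalSpace HM] {I : ModelWithCorners ℝ EM HM}
  {M : Type*} [TopologicalSpace M] [ChartedSpace HM M] [IsManifold I ∞ M] [ConnectedSpace M]
  {𝔨 : Type*} [AddCommGroup 𝔨] [Module ℝ 𝔨] [TopologicalSpace 𝔨] [IsLCS 𝔨]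
  {K : Type*} [Group K] [TopologicalSpace K] [ChartedSpace 𝔨 K] [SmGrp 𝔨 K]
  {EN : Type*} [AddCommGroup EN] [Module ℝ EN] [TopologicalSpace EN] [IsLCS EN]
  {HN : Type*} [TopologicalSpace HN] {JN : LCModel EN HN}
  {N : Type*} [TopologicalSpace N] [ChartedSpace HN N] [Compat JN N]

/-- A smooth map to `K` is locally determined by its logarithmic derivative and one value, in a
smooth way. -/
theorem exists_local_evolution {evol : Paths 𝔨 → K} (hevol : IsEvol evol) (m : M) :
    ∃ U : Set M, IsOpen U ∧ m ∈ U ∧ ∃ Θ : OneForm I M 𝔨 × (M × M) → K,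
      (∀ α, ∀ x ∈ U, ∀ y ∈ U, SmAt ((LCModel.self (OneForm I M 𝔨)).prod
        ((LCModel.ofCorners I).prod (LCModel.ofCorners I))) (LCModel.self 𝔨) Θ (α, (x, y))) ∧
      ∀ f : MapGroup I M 𝔨 K, ∀ x ∈ U, ∀ y ∈ U, f y = f x * Θ (logForm f, (x, y)) := by
  set J := LCModel.ofCorners I
  set c : atlas HM M := achart HM m
  have hm : m ∈ c.1.source := mem_chart_source HM m
  obtain ⟨χ, hχ, hχt, hχs⟩ := exists_tangentBundle_chart (I := I) c
  obtain ⟨B, hB, hmB, hBT, hconv⟩ := exists_convex_nhds I c.1.open_target (c.1.map_source hm)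
  have hconv' : ∀ x ∈ B, ∀ y ∈ B, ∀ s ∈ Icc (0 : ℝ) 1, J.line x y s ∈ c.1.target :=
    fun x hx y hy s hs => hBT (hconv x hx y hy s hs)
  obtain ⟨Ξ, hΞ, hΞv⟩ := exists_segmentPath (𝔨 := 𝔨) hχ hχt hB hconv'
  refine ⟨c.1.source ∩ c.1 ⁻¹' B, c.1.isOpen_inter_preimage hB, ⟨hm, hmB⟩,
    fun p => evol (Ξ (p.1, (c.1 p.2.1, c.1 p.2.2))), ?_, ?_⟩
  · rintro α x ⟨hx, hxB⟩ y ⟨hy, hyB⟩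
    have a1 : SmAt ((LCModel.self (OneForm I M 𝔨)).prod (J.prod J)) (J.prod J)
        (fun p : OneForm I M 𝔨 × (M × M) => p.2) (α, (x, y)) := smAt_snd _
    have a2 : SmAt ((LCModel.self (OneForm I M 𝔨)).prod (J.prod J)) J
        (fun p : OneForm I M 𝔨 × (M × M) => c.1 p.2.1) (α, (x, y)) :=
      SmAt.comp (g := c.1) (f := fun p : OneForm I M 𝔨 × (M × M) => p.2.1)
        (smAt_chart c.2 hx) (SmAt.comp (g := fun p : M × M => p.1) (smAt_fst _) a1)
    have a3 : SmAt ((LCModel.self (OneForm I M 𝔨)).prod (J.prod J)) J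
        (fun p : OneForm I M 𝔨 × (M × M) => c.1 p.2.2) (α, (x, y)) :=
      SmAt.comp (g := c.1) (f := fun p : OneForm I M 𝔨 × (M × M) => p.2.2)
        (smAt_chart c.2 hy) (SmAt.comp (g := fun p : M × M => p.2) (smAt_snd _) a1)
    have a4 : SmAt ((LCModel.self (OneForm I M 𝔨)).prod (J.prod J)) (LCModel.self (Paths 𝔨))
        (fun p : OneForm I M 𝔨 × (M × M) => Ξ (p.1, (c.1 p.2.1, c.1 p.2.2))) (α, (x, y)) :=
      SmAt.comp (g := Ξ) (f := fun p : OneForm I M 𝔨 × (M × M) => (p.1, (c.1 p.2.1, c.1 p.2.2)))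
        (x := (α, (x, y))) (hΞ α _ hxB _ hyB) ((smAt_fst _).prodMk (a2.prodMk a3))
    exact SmAt.comp (g := evol) (hevol.smAt _) a4
  · rintro f x ⟨hx, hxB⟩ y ⟨hy, hyB⟩
    have hl := hconv' _ hxB _ hyB
    have h1 := isEvolution_line (𝔨 := 𝔨) f.smooth.smAt hχs hl
    have h2 := hevol.eq_mul (ξ := Ξ (logForm f, (c.1 x, c.1 y)))
      (continuous_line_comp f.smooth.smAt hl) (by
        convert h1 using 1
        funext s
        exact hΞv (logForm f) _ hxB _ hyB s)
    simpa [c.1.left_inv hx, c.1.left_inv hy] using h2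

/-- This is the substantial half of the exponential law. The formula `f y = f x * Θ (logForm f, (x,
y))` first transports smoothness in `n` from one point of `M` to another, and then gives joint
smoothness with `x` fixed and `y` variable. -/
theorem smAt_uncurry_of_logForm {evol : Paths 𝔨 → K} (hevol : IsEvol evol)
    {f : N → MapGroup I M 𝔨 K} {m₀ : M}
    (h0 : ∀ n, SmAt JN (LCModel.self 𝔨) (fun n => f n m₀) n)
    (h1 : ∀ n, SmAt JN (LCModel.self (OneForm I M 𝔨)) (fun n => logForm (f n)) n) (p : N × M) :
    SmAt (JN.prod (LCModel.ofCorners I)) (LCModel.self 𝔨) (fun p : N × M => f p.1 p.2) p := by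
  set J := LCModel.ofCorners I
  have hall : ∀ m : M, ∀ n, SmAt JN (LCModel.self 𝔨) (fun n => f n m) n := by
    -- The truth value of smoothness in `n` is locally constant in `m`, as `step` works in both
    -- directions; so it is the same as at `m₀`.
    have hlc : IsLocallyConstant fun m : M => ∀ n, SmAt JN (LCModel.self 𝔨) (fun n => f n m) n := by
      rw [IsLocallyConstant.iff_eventually_eq]
      intro m
      obtain ⟨U, hU, hm, Θ, hΘ, hfΘ⟩ := exists_local_evolution (I := I) hevol m
      have step : ∀ x ∈ U, ∀ y ∈ U, (∀ n, SmAt JN (LCModel.self 𝔨) (fun n => f n x) n) →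
          ∀ n, SmAt JN (LCModel.self 𝔨) (fun n => f n y) n := by
        intro x hx y hy h n
        have a1 : SmAt JN (LCModel.self 𝔨) (fun n => Θ (logForm (f n), (x, y))) n :=
          SmAt.comp (g := Θ) (f := fun n => (logForm (f n), (x, y))) (hΘ _ x hx y hy)
            ((h1 n).prodMk (smAt_const _ _))
        exact ((h n).mul a1).congr (Eventually.of_forall fun n => (hfΘ (f n) x hx y hy).symm)
      filter_upwards [hU.mem_nhds hm] with x hx
      exact propext ⟨step x hx m hm, step m hm x hx⟩
    intro m
    have := hlc.apply_eq_of_preconnectedSpace m m₀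
    rw [this]
    exact h0
  obtain ⟨n, m⟩ := p
  obtain ⟨U, hU, hm, Θ, hΘ, hfΘ⟩ := exists_local_evolution (I := I) hevol m
  have a0 : SmAt (JN.prod J) JN (fun p : N × M => p.1) (n, m) := smAt_fst _
  have a1 : SmAt (JN.prod J) (LCModel.self 𝔨) (fun p : N × M => f p.1 m) (n, m) :=
    SmAt.comp (g := fun n => f n m) (hall m n) a0
  have a2 : SmAt (JN.prod J) (LCModel.self (OneForm I M 𝔨)) (fun p : N × M => logForm (f p.1))
      (n, m) := SmAt.comp (g := fun n => logForm (f n)) (h1 n) a0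
  have a3 : SmAt (JN.prod J) (LCModel.self 𝔨) (fun p : N × M => Θ (logForm (f p.1), (m, p.2)))
      (n, m) :=
    SmAt.comp (g := Θ) (f := fun p : N × M => (logForm (f p.1), (m, p.2))) (x := (n, m))
      (hΘ _ m hm m hm) (a2.prodMk ((smAt_const m _).prodMk (smAt_snd _)))
  refine (a1.mul a3).congr ?_
  filter_upwards [(continuous_snd.tendsto (n, m)) (hU.mem_nhds hm)] with p hp
  exact (hfΘ (f p.1) m hm p.2 hp).symm

end Families

/-! ### Reparametrization and the exponential map. -/

section Exponential

variable {𝔨 : Type*} [AddCommGroup 𝔨] [Module ℝ 𝔨] [TopologicalSpace 𝔨] [IsLCS 𝔨]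
  {K : Type*} [Group K] [TopologicalSpace K] [ChartedSpace 𝔨 K] [SmGrp 𝔨 K]

theorem continuous_mul_unitInterval (t : Icc (0 : ℝ) 1) :
    Continuous fun s : Icc (0 : ℝ) 1 => t * s := by
  refine Continuous.subtype_mk (f := fun s : Icc (0 : ℝ) 1 => (t : ℝ) * s) ?_ _
  fun_prop

theorem IsEvolution.reparam {β : Icc (0 : ℝ) 1 → 𝔨} {γ : Icc (0 : ℝ) 1 → K}
    (h : IsEvolution β γ) (t : Icc (0 : ℝ) 1) :
    IsEvolution (fun s => (t : ℝ) • β (t * s)) (fun s => γ (t * s)) := by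
  intro s
  -- For `t = 0` the reparametrized curve is constant, and the substitution `s' ↦ t * s'` is not
  -- injective.
  by_cases ht : (t : ℝ) = 0
  · have h0 : ∀ s', t * s' = 0 := fun s' => Subtype.ext (by simp [ht])
    simp only [h0, ht, zero_smul, inv_mul_cancel, sub_self, smul_zero]
    exact tendsto_const_nhds
  have h1 : Tendsto (fun s' => t * s') (𝓝[≠] s) (𝓝[≠] (t * s)) := by
    refine tendsto_nhdsWithin_of_tendsto_nhds_of_eventually_within _
      (((continuous_mul_unitInterval t).tendsto s).mono_left nhdsWithin_le_nhds) ?_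
    filter_upwards [self_mem_nhdsWithin] with s' hs' heq
    refine hs' (Subtype.ext ?_)
    have := congrArg Subtype.val heq
    simpa [ht] using this
  refine (((h (t * s)).comp h1).const_smul (t : ℝ)).congr fun s' => ?_
  simp only [Function.comp, smul_smul, Set.Icc.coe_mul]
  congr 1
  rw [← mul_sub, mul_inv, ← mul_assoc, mul_inv_cancel₀ ht, one_mul]

/-- The value at time `t` is the value at time `1` of the evolution of a rescaled path. Thus
smoothness of `evol` controls the whole curve. -/
theorem IsEvol.eq_of_reparam {evol : Paths 𝔨 → K} (h : IsEvol evol) {β : Icc (0 : ℝ) 1 → 𝔨}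
    {γ : Icc (0 : ℝ) 1 → K} (hc : Continuous γ) (h0 : γ 0 = 1) (hγ : IsEvolution β γ)
    (t : Icc (0 : ℝ) 1) {ξ : Paths 𝔨} (hξ : ∀ s, ξ s = (t : ℝ) • β (t * s)) :
    evol ξ = γ t := by
  have h1 := h.eq_mul (ξ := ξ) (hc.comp (continuous_mul_unitInterval t)) (by
    convert hγ.reparam t using 1
    · funext s
      exact hξ s
    · rfl)
  simp only [Function.comp, mul_zero, mul_one, h0, one_mul] at h1
  exact h1.symm

/-- The constant paths. -/
def constPath (x : 𝔨) : Paths 𝔨 := ⟨fun _ => x, smooth_iff.2 fun s => smAt_const x s⟩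

theorem smAt_constPath (x : 𝔨) :
    SmAt (LCModel.self 𝔨) (LCModel.self (Paths 𝔨)) constPath x :=
  SmoothFun.smAt_of_uncurry isOpen_univ (fun y _ s => smAt_fst (y, s)) (mem_univ x)

theorem IsEvol.smAt_exp {evol : Paths 𝔨 → K} (h : IsEvol evol) (x : 𝔨) :
    SmAt (LCModel.self 𝔨) (LCModel.self 𝔨) (fun x => evol (constPath x)) x :=
  SmAt.comp (g := evol) (h.smAt _) (smAt_constPath x)

theorem IsEvol.exp_zero {evol : Paths 𝔨 → K} (h : IsEvol evol) : evol (constPath 0) = 1 := by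
  obtain ⟨γ, h1, h2, h3, h4⟩ := h.exists_curve (constPath 0)
  rw [h.eq_of_reparam h1 h2 h3 0 (fun s => ?_), h2]
  simp [constPath]

instance instNeBotUnitInterval (t : Icc (0 : ℝ) 1) : (𝓝[≠] t).NeBot := by
  have : ConnectedSpace (Icc (0 : ℝ) 1) := Subtype.connectedSpace (isConnected_Icc zero_le_one)
  infer_instance

theorem tendsto_sub_unitInterval (t : Icc (0 : ℝ) 1) :
    Tendsto (fun s : Icc (0 : ℝ) 1 => (s : ℝ) - t) (𝓝[≠] t) (𝓝 0) := by
  have : Tendsto (fun s : Icc (0 : ℝ) 1 => (s : ℝ) - t) (𝓝 t) (𝓝 ((t : ℝ) - t)) :=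
    Continuous.tendsto (by fun_prop) _
  rw [sub_self] at this
  exact this.mono_left nhdsWithin_le_nhds

theorem eventually_sub_ne_zero (t : Icc (0 : ℝ) 1) :
    ∀ᶠ s : Icc (0 : ℝ) 1 in 𝓝[≠] t, (s : ℝ) - t ≠ 0 := by
  filter_upwards [self_mem_nhdsWithin] with s hs
  exact sub_ne_zero.2 fun h => hs (Subtype.ext h)

/-- By rescaling, `s ↦ evol (constPath (s • x))` is the evolution of the constant path `x`, whose
derivative at `0` is `x`. -/
theorem IsEvol.mdiff_exp {evol : Paths 𝔨 → K} (h : IsEvol evol) (x : 𝔨) :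
    mdiff (LCModel.self 𝔨) (fun y => chartAt 𝔨 (1 : K) (evol (constPath y))) 0 x = x := by
  obtain ⟨γ, h1, h2, h3, h4⟩ := h.exists_curve (constPath x)
  have hs : SmAt (LCModel.self 𝔨) (LCModel.self 𝔨)
      (fun y => chartAt 𝔨 (1 : K) (evol (constPath y))) 0 :=
    (h.smAt_exp 0).chart_one (by rw [h.exp_zero]; exact mem_chart_source 𝔨 1)
  have h5 := tendsto_mdiff hs (l := 𝓝[≠] (0 : Icc (0 : ℝ) 1))
    (t := fun s => (s : ℝ) - ((0 : Icc (0 : ℝ) 1) : ℝ)) (y := fun s => (s : ℝ) • x) (u := x)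
    (tendsto_sub_unitInterval 0) (eventually_sub_ne_zero 0) (by
      refine Tendsto.congr' (f₁ := fun _ => x) ?_ tendsto_const_nhds
      filter_upwards [eventually_sub_ne_zero 0] with s hs
      simp only [Icc.coe_zero, sub_zero] at hs ⊢
      change x = (s : ℝ)⁻¹ • ((s : ℝ) • x - 0)
      rw [sub_zero, inv_smul_smul₀ hs])
  refine tendsto_nhds_unique h5 ((h3 0).congr fun s => ?_)
  rw [h2, h.exp_zero, inv_one, one_mul, h.eq_of_reparam h1 h2 h3 s (fun _ => rfl)]

end Exponential

/-! ### Second differentials and derivatives along vector fields. -/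

section Bracket

variable {E : Type*} [AddCommGroup E] [Module ℝ E] [TopologicalSpace E] [IsLCS E]
  {F : Type*} [AddCommGroup F] [Module ℝ F] [TopologicalSpace F] [IsLCS F]

/-- Both iterated differentials are mixed partial differentials of `(x, y) ↦ p (x + y - a)` at `(a,
a)`. -/
theorem mdiff_mdiff_symm {p : E → F} {a : E} (hp : SmAt (LCModel.self E) (LCModel.self F) p a)
    (h v : E) : mdiff (LCModel.self E) (fun b => mdiff (LCModel.self E) p b h) a v =
      mdiff (LCModel.self E) (fun b => mdiff (LCModel.self E) p b v) a h := by
  let P : E × E → F := fun q => p (q.1 + q.2 - a)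
  have hP : SmAt ((LCModel.self E).prod (LCModel.self E)) (LCModel.self F) P (a, a) := by
    refine SmAt.comp (g := p) (f := fun q : E × E => q.1 + q.2 - a) (x := (a, a)) ?_
      (((smAt_fst _).add (smAt_snd _)).sub (smAt_const a _))
    simpa using hp
  have key := mdiff_comm hP h v
  have e1 : ∀ y : E, SmAt (LCModel.self E) (LCModel.self F) p y → ∀ u,
      mdiff (LCModel.self E) (fun x => P (x, y)) a u = mdiff (LCModel.self E) p y u := by
    intro y hy u
    have hτ : SmAt (LCModel.self E) (LCModel.self E) (fun x => x + (y - a)) a :=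
      (smAt_id a).add (smAt_const _ a)
    have h1 := mdiff_comp (p := p) (τ := fun x => x + (y - a)) (a := a)
      (by simpa using hy) hτ u
    have h2 : mdiff (LCModel.self E) (fun b => (LCModel.self E).toFun (b + (y - a))) a u = u := by
      refine (hasDirDeriv_mdiff hτ u).unique ?_
      refine Tendsto.congr' (f₁ := fun _ => u) ?_ tendsto_const_nhds
      filter_upwards [self_mem_nhdsWithin] with t ht
      have ht' : t ≠ 0 := ht
      rw [show a + t • u + (y - a) - (a + (y - a)) = t • u by abel, inv_smul_smul₀ ht']
    rw [h2] at h1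
    simp only [add_sub_cancel] at h1
    simp only [P, add_sub_assoc]
    exact h1
  have e2 : ∀ x : E, SmAt (LCModel.self E) (LCModel.self F) p x → ∀ u,
      mdiff (LCModel.self E) (fun y => P (x, y)) a u = mdiff (LCModel.self E) p x u := by
    intro x hx u
    rw [← e1 x hx u]
    simp only [P, add_comm]
  have sm : ∀ u, SmAt (LCModel.self E) (LCModel.self F)
      (fun b => mdiff (LCModel.self E) p b u) a := by
    intro u
    have h1 : SmAt ((LCModel.self E).prod (LCModel.self E)) (LCModel.self F)
        (fun q : E × E => p q.2) (a, a) := SmAt.comp (g := p) (f := fun q : E × E => q.2) hp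
          (smAt_snd _)
    exact SmAt.comp (f := fun b => (a, (b, u))) (x := a) (h1.mdiff_param u)
      ((smAt_const a a).prodMk ((smAt_id a).prodMk (smAt_const u a)))
  rw [mdiff_congr (sm h) (hp.eventually.mono fun y hy => (e1 y hy h).symm) v, key,
    mdiff_congr (sm v) (hp.eventually.mono fun y hy => (e2 y hy v).symm) h]

theorem mdiff_clm_comp {EX : Type*} [AddCommGroup EX] [Module ℝ EX] [TopologicalSpace EX] [IsLCS EX]
    {H : Type*} [TopologicalSpace H] {J : LCModel EX H} (L : E →L[ℝ] F) {p : H → E} {a : H}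
    (hp : SmAt J (LCModel.self E) p a) (u : EX) :
    mdiff J (fun b => L (p b)) a u = L (mdiff J p a u) := by
  rw [mdiff_comp (p := L) (τ := p) (smAt_clm L _) hp, mdiff_clm]
  rfl

theorem mdiff_prodMk {EX : Type*} [AddCommGroup EX] [Module ℝ EX] [TopologicalSpace EX] [IsLCS EX]
    {H : Type*} [TopologicalSpace H] {J : LCModel EX H} {p : H → E} {q : H → F} {a : H}
    (hp : SmAt J (LCModel.self E) p a) (hq : SmAt J (LCModel.self F) q a) (u : EX) :
    mdiff J (fun b => (p b, q b)) a u = (mdiff J p a u, mdiff J q a u) := by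
  have h := hp.prodMk_vec hq
  exact Prod.ext (mdiff_clm_comp (ContinuousLinearMap.fst ℝ E F) h u).symm
    (mdiff_clm_comp (ContinuousLinearMap.snd ℝ E F) h u).symm

theorem mdiff_id (a u : E) : mdiff (LCModel.self E) (fun b => b) a u = u :=
  mdiff_toFun (J := LCModel.self E) a u

/-- The derivative of `b ↦ dp(b)(X(b))`. -/
theorem mdiff_mdiff_field {p : E → F} {X : E → E} {a : E}
    (hp : SmAt (LCModel.self E) (LCModel.self F) p a)
    (hX : SmAt (LCModel.self E) (LCModel.self E) X a) (w : E) :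
    mdiff (LCModel.self E) (fun b => mdiff (LCModel.self E) p b (X b)) a w =
      mdiff (LCModel.self E) (fun b => mdiff (LCModel.self E) p b (X a)) a w +
        mdiff (LCModel.self E) p a (mdiff (LCModel.self E) X a w) := by
  let D : E × E → F := fun q => mdiff (LCModel.self E) p q.1 q.2
  have hD : SmAt (LCModel.self (E × E)) (LCModel.self F) D (a, X a) := by
    have h1 : SmAt ((LCModel.self E).prod (LCModel.self E)) (LCModel.self F)
        (fun q : E × E => p q.2) (a, a) := SmAt.comp (g := p) (f := fun q : E × E => q.2) hp
          (smAt_snd _)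
    exact SmAt.comp (f := fun q : E × E => (a, (q.1, q.2))) (x := (a, X a)) (h1.mdiff_param (X a))
      ((smAt_const a _).prodMk ((smAt_clm (ContinuousLinearMap.fst ℝ E E) _).prodMk
        (smAt_clm (ContinuousLinearMap.snd ℝ E E) _)))
  -- The chain rule is applied along `(b, X b)`, `(b, X a)` and `(a, b)`; the velocity of the first
  -- curve is the sum of the other two.
  have e1 := mdiff_comp (p := D) (τ := fun b => (b, X b)) (a := a) hD
    ((smAt_id a).prodMk_vec hX) w
  have e2 := mdiff_comp (p := D) (τ := fun b => (b, X a)) (a := a) hD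
    ((smAt_id a).prodMk_vec (smAt_const (X a) a)) w
  have e3 := mdiff_comp (p := D) (τ := fun b => (a, b)) (a := X a) hD
    ((smAt_const a _).prodMk_vec (smAt_id _)) (mdiff (LCModel.self E) X a w)
  change _ = mdiff (LCModel.self (E × E)) D (a, X a) (mdiff (LCModel.self E) (fun b => (b, X b)) a w)
    at e1
  change _ = mdiff (LCModel.self (E × E)) D (a, X a) (mdiff (LCModel.self E) (fun b => (b, X a)) a w)
    at e2
  change _ = mdiff (LCModel.self (E × E)) D (a, X a) (mdiff (LCModel.self E) (fun b => (a, b)) (X a)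
    (mdiff (LCModel.self E) X a w)) at e3
  rw [mdiff_prodMk (smAt_id a) hX, mdiff_id] at e1
  rw [mdiff_prodMk (smAt_id a) (smAt_const _ _), mdiff_id, mdiff_const] at e2
  rw [mdiff_prodMk (smAt_const _ _) (smAt_id _), mdiff_id, mdiff_const] at e3
  have e4 : mdiff (LCModel.self E) (fun b => D (a, b)) (X a) (mdiff (LCModel.self E) X a w) =
      mdiff (LCModel.self E) p a (mdiff (LCModel.self E) X a w) := by
    have hs : SmAt (LCModel.self E) (LCModel.self F) (fun b => D (a, b)) (X a) :=
      SmAt.comp (g := D) (f := fun b => (a, b)) hD ((smAt_const a _).prodMk_vec (smAt_id _))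
    refine (hasDirDeriv_mdiff hs _).unique ?_
    refine Tendsto.congr' (f₁ := fun _ => mdiff (LCModel.self E) p a
      (mdiff (LCModel.self E) X a w)) ?_ tendsto_const_nhds
    filter_upwards [self_mem_nhdsWithin] with t ht
    have ht' : t ≠ 0 := ht
    simp only [D]
    rw [mdiff_add_right hp, mdiff_smul_right hp, add_sub_cancel_left, inv_smul_smul₀ ht']
  rw [e4] at e3
  rw [e3]
  refine e1.trans ?_
  rw [show mdiff (LCModel.self E) (fun b => mdiff (LCModel.self E) p b (X a)) a w = _ from e2,
    ← mdiff_add_right hD]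
  simp

end Bracket

theorem chart_one_symm {E : Type*} [TopologicalSpace E] {G : Type*} [Group G] [TopologicalSpace G]
    [ChartedSpace E G] : (chartAt E (1 : G)).symm (chartAt E (1 : G) 1) = 1 :=
  (chartAt E (1 : G)).left_inv (mem_chart_source E 1)

/-! ### Left invariant vector fields and smooth homomorphisms. -/

section GroupBracket

variable {E : Type*} [AddCommGroup E] [Module ℝ E] [TopologicalSpace E] [IsLCS E]
  {G : Type*} [Group G] [TopologicalSpace G] [ChartedSpace E G] [SmGrp E G]
  {𝔨 : Type*} [AddCommGroup 𝔨] [Module ℝ 𝔨] [TopologicalSpace 𝔨] [IsLCS 𝔨]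
  {K : Type*} [Group K] [TopologicalSpace K] [ChartedSpace 𝔨 K] [SmGrp 𝔨 K]

theorem smAt_chart_mul {p : E} (hp : p ∈ (chartAt E (1 : G)).target) :
    SmAt ((LCModel.self E).prod (LCModel.self E)) (LCModel.self E)
      (fun z : E × E => chartAt E (1 : G) ((chartAt E (1 : G)).symm z.1 *
        (chartAt E (1 : G)).symm z.2)) (p, chartAt E (1 : G) 1) := by
  have a1 : SmAt ((LCModel.self E).prod (LCModel.self E)) (LCModel.self E)
      (fun z : E × E => (chartAt E (1 : G)).symm z.1) (p, chartAt E (1 : G) 1) :=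
    SmAt.comp (g := (chartAt E (1 : G)).symm) (f := fun z : E × E => z.1)
      (x := (p, chartAt E (1 : G) 1)) (smAt_chart_symm (chart_mem_atlas E 1) hp) (smAt_fst _)
  have a2 : SmAt ((LCModel.self E).prod (LCModel.self E)) (LCModel.self E)
      (fun z : E × E => (chartAt E (1 : G)).symm z.2) (p, chartAt E (1 : G) 1) :=
    SmAt.comp (g := (chartAt E (1 : G)).symm) (f := fun z : E × E => z.2)
      (x := (p, chartAt E (1 : G) 1)) smAt_chart_one_symm (smAt_snd _)
  refine (a1.mul a2).chart_one ?_
  rw [chart_one_symm, mul_one]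
  exact (chartAt E (1 : G)).map_target hp

theorem smAt_chart_mul_left {p : E} (hp : p ∈ (chartAt E (1 : G)).target) :
    SmAt (LCModel.self E) (LCModel.self E)
      (fun q => chartAt E (1 : G) ((chartAt E (1 : G)).symm p * (chartAt E (1 : G)).symm q))
      (chartAt E (1 : G) 1) :=
  SmAt.comp (f := fun q => (p, q)) (smAt_chart_mul hp) ((smAt_const _ _).prodMk (smAt_id _))

theorem leftInvField_eq {p : E} (hp : p ∈ (chartAt E (1 : G)).target) (x : E) :
    leftInvField E G x p = mdiff (LCModel.self E) (fun q => chartAt E (1 : G)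
      ((chartAt E (1 : G)).symm p * (chartAt E (1 : G)).symm q)) (chartAt E (1 : G) 1) x :=
  (hasDirDeriv_mdiff (smAt_chart_mul_left hp) x).dirDeriv_eq

theorem smAt_leftInvField (x : E) :
    SmAt (LCModel.self E) (LCModel.self E) (leftInvField E G x) (chartAt E (1 : G) 1) := by
  have h := (smAt_chart_mul (mem_chart_target E (1 : G))).mdiff_param x
  refine (SmAt.comp (f := fun p : E => (p, (chartAt E (1 : G) 1, x))) (x := chartAt E (1 : G) 1) h
    ((smAt_id _).prodMk (smAt_const _ _))).congr ?_
  filter_upwards [(chartAt E (1 : G)).open_target.mem_nhds (mem_chart_target E (1 : G))] with p hp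
  exact (leftInvField_eq hp x).symm

theorem leftInvField_one (x : E) : leftInvField E G x (chartAt E (1 : G) 1) = x := by
  rw [leftInvField_eq (mem_chart_target E (1 : G)), ← mdiff_congr (smAt_id _) ?_ x, mdiff_id]
  filter_upwards [(chartAt E (1 : G)).open_target.mem_nhds (mem_chart_target E (1 : G))] with p hp
  rw [chart_one_symm, one_mul, (chartAt E (1 : G)).right_inv hp]

theorem lieBracket_eq (x y : E) : lieBracket E G x y =
    mdiff (LCModel.self E) (leftInvField E G y) (chartAt E (1 : G) 1) x -
      mdiff (LCModel.self E) (leftInvField E G x) (chartAt E (1 : G) 1) y := by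
  rw [lieBracket, (hasDirDeriv_mdiff (smAt_leftInvField y) x).dirDeriv_eq,
    (hasDirDeriv_mdiff (smAt_leftInvField x) y).dirDeriv_eq]

/-- Smooth homomorphisms are compatible with Lie brackets. -/
theorem mdiff_lieBracket (φ : G →* K) (hφ : ∀ g, SmAt (LCModel.self E) (LCModel.self 𝔨) φ g)
    {T : E → 𝔨} (hT : ∀ x, T x = mdiff (LCModel.self E)
      (fun y => chartAt 𝔨 (1 : K) (φ ((chartAt E (1 : G)).symm y))) (chartAt E (1 : G) 1) x)
    (x y : E) : T (lieBracket E G x y) = lieBracket 𝔨 K (T x) (T y) := by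
  set CG := chartAt E (1 : G) with hCG
  set CK := chartAt 𝔨 (1 : K) with hCK
  set ε : E → 𝔨 := fun y => CK (φ (CG.symm y)) with hε
  have hGs : (1 : G) ∈ CG.source := mem_chart_source E 1
  have hGt : CG 1 ∈ CG.target := mem_chart_target E 1
  have hKs : (1 : K) ∈ CK.source := mem_chart_source 𝔨 1
  have hG1 : CG.symm (CG 1) = 1 := CG.left_inv hGs
  have hε1 : ε (CG 1) = CK 1 := by simp [hε, hG1]
  have hφε : ∀ p ∈ CG.target, φ (CG.symm p) ∈ CK.source →
      SmAt (LCModel.self E) (LCModel.self 𝔨) ε p := fun p hp hp' =>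
    (SmAt.comp (g := φ) (f := CG.symm) (hφ _)
      (smAt_chart_symm (chart_mem_atlas E 1) hp)).chart_one hp'
  have hnear : ∀ᶠ p in 𝓝 (CG 1), p ∈ CG.target ∧ φ (CG.symm p) ∈ CK.source := by
    have h1 : ContinuousAt (fun p => φ (CG.symm p)) (CG 1) :=
      (SmAt.comp (g := φ) (f := CG.symm) (hφ _)
        (smAt_chart_symm (J := LCModel.self E) (chart_mem_atlas E 1) hGt)).continuousAt
    refine Filter.Eventually.and (CG.open_target.mem_nhds hGt) (h1 (CK.open_source.mem_nhds ?_))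
    beta_reduce
    rw [hG1, map_one]
    exact hKs
  have hεs : SmAt (LCModel.self E) (LCModel.self 𝔨) ε (CG 1) :=
    hφε _ hGt (by rw [hG1, map_one]; exact hKs)
  -- The left invariant fields of `x` and `T x` are related by `φ` near `1`, since `φ` intertwines
  -- left translations.
  have rel : ∀ x : E, ∀ᶠ p in 𝓝 (CG 1), leftInvField 𝔨 K (T x) (ε p) =
      mdiff (LCModel.self E) ε p (leftInvField E G x p) := by
    intro x
    filter_upwards [hnear] with p hp
    have hεt : ε p ∈ CK.target := CK.map_source hp.2
    let τ : E → E := fun q => CG (CG.symm p * CG.symm q)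
    have hτ1 : τ (CG 1) = p := by
      simp only [τ]
      rw [hG1, mul_one, CG.right_inv hp.1]
    have hτs : SmAt (LCModel.self E) (LCModel.self E) τ (CG 1) := smAt_chart_mul_left hp.1
    have e1 := mdiff_comp (p := ε) (τ := τ) (a := CG 1) (by rw [hτ1]; exact hφε p hp.1 hp.2) hτs x
    have e2 := mdiff_comp (p := fun q => CK (CK.symm (ε p) * CK.symm q)) (τ := ε) (a := CG 1)
      (by rw [hε1]; exact smAt_chart_mul_left hεt) hεs x
    rw [leftInvField_eq hp.1, leftInvField_eq hεt, hT x]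
    rw [hτ1] at e1
    rw [hε1] at e2
    refine e2.symm.trans (Eq.trans ?_ e1)
    refine mdiff_congr (SmAt.comp (g := fun q => CK (CK.symm (ε p) * CK.symm q)) (f := ε)
      (by rw [hε1]; exact smAt_chart_mul_left hεt) hεs) ?_ x
    have hc : ContinuousAt (fun q => CG.symm p * CG.symm q) (CG 1) :=
      ((smAt_const (J := LCModel.self E) (J' := LCModel.self E) (CG.symm p) (CG 1)).mul
        (smAt_chart_symm (chart_mem_atlas E 1) hGt)).continuousAt
    have hc' : ∀ᶠ q in 𝓝 (CG 1), CG.symm p * CG.symm q ∈ CG.source := by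
      refine hc (CG.open_source.mem_nhds ?_)
      beta_reduce
      rw [hG1, mul_one]
      exact CG.map_target hp.1
    filter_upwards [hnear, hc'] with q hq hq'
    simp only [hε, τ]
    rw [CK.left_inv hp.2, CK.left_inv hq.2, CG.left_inv hq', map_mul]
  -- Differentiating this relation yields `T` of a derivative and a second differential of `ε`; the
  -- latter is symmetric and cancels in the bracket.
  have deriv : ∀ x w : E, mdiff (LCModel.self 𝔨) (leftInvField 𝔨 K (T x)) (CK 1) (T w) =
      mdiff (LCModel.self E) (fun b => mdiff (LCModel.self E) ε b x) (CG 1) w +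
        T (mdiff (LCModel.self E) (leftInvField E G x) (CG 1) w) := by
    intro x w
    have h1 : SmAt (LCModel.self 𝔨) (LCModel.self 𝔨) (leftInvField 𝔨 K (T x)) (ε (CG 1)) := by
      rw [hε1]
      exact smAt_leftInvField (T x)
    have e1 := mdiff_comp (p := leftInvField 𝔨 K (T x)) (τ := ε) (a := CG 1) h1 hεs w
    rw [mdiff_congr (SmAt.comp (f := ε) h1 hεs) (rel x) w,
      mdiff_mdiff_field hεs (smAt_leftInvField x), leftInvField_one, hε1] at e1
    rw [hT w, hT (mdiff _ _ _ _)]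
    exact e1.symm
  have Tsub : ∀ a b, T (a - b) = T a - T b := by
    intro a b
    rw [sub_eq_add_neg, ← neg_one_smul ℝ b, hT, mdiff_add_right hεs, mdiff_smul_right hεs, ← hT,
      ← hT, neg_one_smul, ← sub_eq_add_neg]
  rw [lieBracket_eq, lieBracket_eq, ← hCG, ← hCK, Tsub, deriv y x, deriv x y,
    mdiff_mdiff_symm hεs x y]
  abel

end GroupBracket

/-! ### The group of smooth maps. -/

section MapGroup

variable {EM : Type*} [NormedAddCommGroup EM] [NormedSpace ℝ EM]
  {HM : Type*} [TopologicalSpace HM] {I : ModelWithCorners ℝ EM HM}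
  {M : Type*} [TopologicalSpace M] [ChartedSpace HM M] [IsManifold I ∞ M]
  {𝔨 : Type*} [AddCommGroup 𝔨] [Module ℝ 𝔨] [TopologicalSpace 𝔨] [IsLCS 𝔨]
  {K : Type*} [Group K] [TopologicalSpace K] [ChartedSpace 𝔨 K] [SmGrp 𝔨 K]

/-- The pointwise group structure on `C^∞(M,K)`. -/
instance instGroupMapGroup : Group (MapGroup I M 𝔨 K) where
  mul f g := ⟨fun m => f m * g m, smooth_iff.2 fun m => (f.smooth.smAt m).mul (g.smooth.smAt m)⟩
  one := ⟨fun _ => 1, smooth_iff.2 fun m => smAt_const 1 m⟩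
  inv f := ⟨fun m => (f m)⁻¹, smooth_iff.2 fun m => (f.smooth.smAt m).inv⟩
  mul_assoc f g h := SmoothMap.ext (funext fun m => mul_assoc (f m) (g m) (h m))
  one_mul f := SmoothMap.ext (funext fun m => one_mul (f m))
  mul_one f := SmoothMap.ext (funext fun m => mul_one (f m))
  inv_mul_cancel f := SmoothMap.ext (funext fun m => inv_mul_cancel (f m))

/-- Evaluation in a point is a homomorphism. -/
def evalHom (m : M) : MapGroup I M 𝔨 K →* K where
  toFun f := f m
  map_one' := rfl
  map_mul' _ _ := rfl

theorem logForm_injective [ConnectedSpace M] {f g : MapGroup I M 𝔨 K} {m₀ : M}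
    (h0 : f m₀ = g m₀) (h : logForm f = logForm g) : f = g :=
  SmoothMap.ext (eq_of_leftLogDeriv_eq f.smooth.smAt g.smooth.smAt
    (fun v => congrArg (fun α : OneForm I M 𝔨 => α.1 v) h) h0)

theorem logForm_mul_left (k : K) (f g : MapGroup I M 𝔨 K) (h : ∀ m, g m = k * f m) :
    logForm g = logForm f := by
  refine Subtype.ext (SmoothFun.ext fun v => ?_)
  change leftLogDeriv I 𝔨 g v = leftLogDeriv I 𝔨 f v
  rw [← leftLogDeriv_mul_left k f, funext h]

end MapGroup

/-! ### Exponential law and Lie group structure of `C^∞(M,K)`. -/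

section Structure

variable {EM : Type*} [NormedAddCommGroup EM] [NormedSpace ℝ EM] [FiniteDimensional ℝ EM]
  {HM : Type*} [TopologicalSpace HM] {I : ModelWithCorners ℝ EM HM}
  {M : Type*} [TopologicalSpace M] [ChartedSpace HM M] [IsManifold I ∞ M] [ConnectedSpace M]
  {𝔨 : Type*} [AddCommGroup 𝔨] [Module ℝ 𝔨] [TopologicalSpace 𝔨] [IsLCS 𝔨]
  {K : Type*} [Group K] [TopologicalSpace K] [ChartedSpace 𝔨 K] [SmGrp 𝔨 K]
  {EG : Type*} [AddCommGroup EG] [Module ℝ EG] [TopologicalSpace EG] [IsLCS EG]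
  [TopologicalSpace (MapGroup I M 𝔨 K)] [ChartedSpace EG (MapGroup I M 𝔨 K)]
  {EN : Type*} [AddCommGroup EN] [Module ℝ EN] [TopologicalSpace EN] [IsLCS EN]
  {HN : Type*} [TopologicalSpace HN] {JN : LCModel EN HN}
  {N : Type*} [TopologicalSpace N] [ChartedSpace HN N] [Compat JN N]

/-- The manifold structure on `C^∞(M,K)` given by `f ↦ (f(m₀), δ(f))`, and an evolution map of
`K`. -/
structure IsMapMfd (L : EG →L[ℝ] 𝔨 × OneForm I M 𝔨) (m₀ : M) (evol : Paths 𝔨 → K) : Prop where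
  adapted : IsAdaptedAtlas ((LCModel.self 𝔨).prod (LCModel.self (OneForm I M 𝔨))) L
    (fun g : MapGroup I M 𝔨 K => (g m₀, logForm g))
  isEvol : IsEvol evol

variable {L : EG →L[ℝ] 𝔨 × OneForm I M 𝔨} {m₀ : M} {evol : Paths 𝔨 → K}

theorem IsMapMfd.compat (h : IsMapMfd L m₀ evol) :
    Compat (LCModel.self EG) (MapGroup I M 𝔨 K) := h.adapted.compat fun _ => rfl

theorem IsMapMfd.smAt_iff (h : IsMapMfd L m₀ evol) {f : N → MapGroup I M 𝔨 K} {n : N} :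
    SmAt JN (LCModel.self EG) f n ↔ SmAt JN (LCModel.self 𝔨) (fun n => f n m₀) n ∧
      SmAt JN (LCModel.self (OneForm I M 𝔨)) (fun n => logForm (f n)) n := by
  rw [h.adapted.smAt_iff fun _ => rfl]
  constructor
  · intro hf
    exact ⟨SmAt.comp (g := fun z : K × OneForm I M 𝔨 => z.1) (smAt_fst _) hf,
      SmAt.comp (g := fun z : K × OneForm I M 𝔨 => z.2) (smAt_snd _) hf⟩
  · rintro ⟨h1, h2⟩
    exact h1.prodMk h2

theorem IsMapMfd.smAt_curry (h : IsMapMfd L m₀ evol) {f : N → MapGroup I M 𝔨 K}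
    (hf : ∀ p : N × M, SmAt (JN.prod (LCModel.ofCorners I)) (LCModel.self 𝔨)
      (fun p : N × M => f p.1 p.2) p) (n : N) : SmAt JN (LCModel.self EG) f n :=
  h.smAt_iff.2 ⟨SmAt.comp (g := fun p : N × M => f p.1 p.2) (f := fun n => (n, m₀)) (hf (n, m₀))
    ((smAt_id n).prodMk (smAt_const m₀ n)), smAt_logForm hf n⟩

theorem IsMapMfd.smAt_uncurry (h : IsMapMfd L m₀ evol) {f : N → MapGroup I M 𝔨 K}
    (hf : ∀ n, SmAt JN (LCModel.self EG) f n) (p : N × M) :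
    SmAt (JN.prod (LCModel.ofCorners I)) (LCModel.self 𝔨) (fun p : N × M => f p.1 p.2) p :=
  smAt_uncurry_of_logForm h.isEvol (fun n => (h.smAt_iff.1 (hf n)).1)
    (fun n => (h.smAt_iff.1 (hf n)).2) p

theorem IsMapMfd.smooth_iff (h : IsMapMfd L m₀ evol) (f : N × M → K) :
    Smooth (JN.prod (LCModel.ofCorners I)) (LCModel.self 𝔨) f ↔
      ∃ hf : ∀ n, Smooth (LCModel.ofCorners I) (LCModel.self 𝔨) (fun m => f (n, m)),
        Smooth JN (LCModel.self EG) (fun n => (⟨fun m => f (n, m), hf n⟩ :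
          MapGroup I M 𝔨 K)) := by
  have := h.compat
  constructor
  · intro hf
    refine ⟨fun n => LC.smooth_iff.2 fun m => (hf.smAt (n, m)).slice, LC.smooth_iff.2 fun n => ?_⟩
    exact h.smAt_curry hf.smAt n
  · rintro ⟨hf, hs⟩
    exact LC.smooth_iff.2 (h.smAt_uncurry hs.smAt)

/-- Joint evaluation is the uncurried form of the identity map of `C^∞(M,K)`. -/
theorem IsMapMfd.smAt_ev (h : IsMapMfd L m₀ evol) (p : MapGroup I M 𝔨 K × M) :
    SmAt ((LCModel.self EG).prod (LCModel.ofCorners I)) (LCModel.self 𝔨)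
      (fun p : MapGroup I M 𝔨 K × M => p.1 p.2) p := by
  have := h.compat
  exact h.smAt_uncurry (f := fun g => g) smAt_id p

theorem IsMapMfd.smAt_evalHom (h : IsMapMfd L m₀ evol) (m : M) (g : MapGroup I M 𝔨 K) :
    SmAt (LCModel.self EG) (LCModel.self 𝔨) (evalHom m) g := by
  have := h.compat
  exact SmAt.comp (g := fun p : MapGroup I M 𝔨 K × M => p.1 p.2) (f := fun g => (g, m))
    (h.smAt_ev (g, m)) ((smAt_id g).prodMk (smAt_const m g))

/-- By the exponential law it suffices that `(f, g, m) ↦ f m * g m` and `(f, m) ↦ (f m)⁻¹` are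
smooth, which follows from smoothness of joint evaluation. -/
theorem IsMapMfd.smGrp (h : IsMapMfd L m₀ evol) : SmGrp EG (MapGroup I M 𝔨 K) := by
  have := h.compat
  refine ⟨this, h.smAt_curry ?_, h.smAt_curry ?_⟩
  · rintro ⟨⟨f, g⟩, m⟩
    have a0 : SmAt (((LCModel.self EG).prod (LCModel.self EG)).prod (LCModel.ofCorners I))
        ((LCModel.self EG).prod (LCModel.self EG))
        (fun p : (MapGroup I M 𝔨 K × MapGroup I M 𝔨 K) × M => p.1) ((f, g), m) := smAt_fst _
    have a1 : SmAt (((LCModel.self EG).prod (LCModel.self EG)).prod (LCModel.ofCorners I))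
        (LCModel.self EG) (fun p : (MapGroup I M 𝔨 K × MapGroup I M 𝔨 K) × M => p.1.1)
        ((f, g), m) :=
      SmAt.comp (g := fun p : MapGroup I M 𝔨 K × MapGroup I M 𝔨 K => p.1) (smAt_fst _) a0
    have a2 : SmAt (((LCModel.self EG).prod (LCModel.self EG)).prod (LCModel.ofCorners I))
        (LCModel.self EG) (fun p : (MapGroup I M 𝔨 K × MapGroup I M 𝔨 K) × M => p.1.2)
        ((f, g), m) :=
      SmAt.comp (g := fun p : MapGroup I M 𝔨 K × MapGroup I M 𝔨 K => p.2) (smAt_snd _) a0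
    have b1 := SmAt.comp (g := fun p : MapGroup I M 𝔨 K × M => p.1 p.2)
      (f := fun p : (MapGroup I M 𝔨 K × MapGroup I M 𝔨 K) × M => (p.1.1, p.2)) (x := ((f, g), m))
      (h.smAt_ev _) (a1.prodMk (smAt_snd _))
    have b2 := SmAt.comp (g := fun p : MapGroup I M 𝔨 K × M => p.1 p.2)
      (f := fun p : (MapGroup I M 𝔨 K × MapGroup I M 𝔨 K) × M => (p.1.2, p.2)) (x := ((f, g), m))
      (h.smAt_ev _) (a2.prodMk (smAt_snd _))
    exact b1.mul b2
  · intro p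
    exact (h.smAt_ev p).inv

/-- The Hausdorff property comes from the continuous injection `g ↦ (g m₀, logForm g)`. -/
theorem IsMapMfd.isLieGrp (h : IsMapMfd L m₀ evol) [T2Space K] :
    IsLieGrp EG (MapGroup I M 𝔨 K) := by
  have := h.compat
  have h1 := h.smGrp
  refine ⟨⟨?_, this.compatible⟩, LC.smooth_iff.2 h1.smAt_mul, LC.smooth_iff.2 h1.smAt_inv⟩
  refine T2Space.of_injective_continuous (f := fun g : MapGroup I M 𝔨 K => (g m₀, logForm g)) ?_
    h.adapted.isInducing.continuous
  intro f g hfg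
  exact logForm_injective (congrArg Prod.fst hfg) (congrArg Prod.snd hfg)

end Structure

/-! ### The action of `K` on based maps. -/

section Conjugation

variable {EM : Type*} [NormedAddCommGroup EM] [NormedSpace ℝ EM] [FiniteDimensional ℝ EM]
  {HM : Type*} [TopologicalSpace HM] {I : ModelWithCorners ℝ EM HM}
  {M : Type*} [TopologicalSpace M] [ChartedSpace HM M] [IsManifold I ∞ M] [ConnectedSpace M]
  {𝔨 : Type*} [AddCommGroup 𝔨] [Module ℝ 𝔨] [TopologicalSpace 𝔨] [IsLCS 𝔨]
  {K : Type*} [Group K] [TopologicalSpace K] [ChartedSpace 𝔨 K] [SmGrp 𝔨 K]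
  {EG : Type*} [AddCommGroup EG] [Module ℝ EG] [TopologicalSpace EG] [IsLCS EG]
  {m₀ : M} {evol : Paths 𝔨 → K}

/-- Evaluation of based maps is jointly smooth because their value at `m₀` is constant. The
conjugated family is then jointly smooth, and so is its logarithmic derivative. -/
theorem smooth_conj {B : Type*} [TopologicalSpace B] [ChartedSpace EG B]
    {b : B → MapGroup I M 𝔨 K} (hb : ∀ x, b x m₀ = 1) {L' : EG →L[ℝ] OneForm I M 𝔨}
    (hB : IsAdaptedAtlas (LCModel.self (OneForm I M 𝔨)) L' (fun x => logForm (b x)))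
    (hevol : IsEvol evol) {c : K × B → B} (hc : ∀ p m, b (c p) m = p.1 * b p.2 m * p.1⁻¹) :
    Smooth ((LCModel.self 𝔨).prod (LCModel.self EG)) (LCModel.self EG) c := by
  have := hB.compat fun _ => rfl
  refine LC.smooth_iff.2 fun p => (hB.smAt_iff fun _ => rfl).2 ?_
  have hev : ∀ q : B × M, SmAt ((LCModel.self EG).prod (LCModel.ofCorners I)) (LCModel.self 𝔨)
      (fun q : B × M => b q.1 q.2) q :=
    smAt_uncurry_of_logForm hevol (m₀ := m₀) (fun x => by
      simp only [hb]
      exact smAt_const 1 x) fun x => hB.smAt (fun _ => rfl) x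
  refine smAt_logForm (f := fun p => b (c p)) ?_ p
  rintro ⟨⟨k, x⟩, m⟩
  simp only [hc]
  have a0 : SmAt (((LCModel.self 𝔨).prod (LCModel.self EG)).prod (LCModel.ofCorners I))
      ((LCModel.self 𝔨).prod (LCModel.self EG)) (fun p : (K × B) × M => p.1) ((k, x), m) :=
    smAt_fst _
  have a1 : SmAt (((LCModel.self 𝔨).prod (LCModel.self EG)).prod (LCModel.ofCorners I))
      (LCModel.self 𝔨) (fun p : (K × B) × M => p.1.1) ((k, x), m) :=
    SmAt.comp (g := fun p : K × B => p.1) (smAt_fst _) a0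
  have a2 : SmAt (((LCModel.self 𝔨).prod (LCModel.self EG)).prod (LCModel.ofCorners I))
      (LCModel.self EG) (fun p : (K × B) × M => p.1.2) ((k, x), m) :=
    SmAt.comp (g := fun p : K × B => p.2) (smAt_snd _) a0
  have b1 := SmAt.comp (g := fun p : B × M => b p.1 p.2)
      (f := fun p : (K × B) × M => (p.1.2, p.2)) (x := ((k, x), m))
      (hev _) (a2.prodMk (smAt_snd _))
  exact (a1.mul b1).mul a1.inv

end Conjugation

/-! ### The differential as a continuous linear map. -/

section MdiffCLM

variable {E : Type*} [AddCommGroup E] [Module ℝ E] [TopologicalSpace E] [IsLCS E]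
  {H : Type*} [TopologicalSpace H] {J : LCModel E H}
  {F : Type*} [AddCommGroup F] [Module ℝ F] [TopologicalSpace F] [IsLCS F]

theorem SmAt.mdiff_direction {p : H → F} {a : H} (hp : SmAt J (LCModel.self F) p a) (u : E) :
    SmAt (LCModel.self E) (LCModel.self F) (fun u => mdiff J p a u) u := by
  have h1 : SmAt (J.prod J) (LCModel.self F) (fun q : H × H => p q.2) (a, a) :=
    SmAt.comp (g := p) (f := fun q : H × H => q.2) hp (smAt_snd _)
  exact SmAt.comp (f := fun u => (a, (a, u))) (x := u) (h1.mdiff_param u)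
    ((smAt_const a u).prodMk ((smAt_const a u).prodMk (smAt_id u)))

/-- The differential of a smooth map, as a continuous linear map. -/
def SmAt.mdiffCLM {p : H → F} {a : H} (hp : SmAt J (LCModel.self F) p a) : E →L[ℝ] F where
  toFun u := mdiff J p a u
  map_add' := mdiff_add_right hp
  map_smul' := mdiff_smul_right hp
  cont := continuous_iff_continuousAt.2 fun u => (hp.mdiff_direction u).continuousAt

end MdiffCLM

/-! ### The Lie algebra of `C^∞(M,K)`. -/

section LieAlgebra

variable {EM : Type*} [NormedAddCommGroup EM] [NormedSpace ℝ EM] [FiniteDimensional ℝ EM]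
  {HM : Type*} [TopologicalSpace HM] {I : ModelWithCorners ℝ EM HM}
  {M : Type*} [TopologicalSpace M] [ChartedSpace HM M] [IsManifold I ∞ M] [ConnectedSpace M]
  {𝔨 : Type*} [AddCommGroup 𝔨] [Module ℝ 𝔨] [TopologicalSpace 𝔨] [IsLCS 𝔨]
  {K : Type*} [Group K] [TopologicalSpace K] [ChartedSpace 𝔨 K] [SmGrp 𝔨 K]
  {EG : Type*} [AddCommGroup EG] [Module ℝ EG] [TopologicalSpace EG] [IsLCS EG]
  [TopologicalSpace (MapGroup I M 𝔨 K)] [ChartedSpace EG (MapGroup I M 𝔨 K)]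

variable (I M 𝔨 K) in
/-- The evaluation maps in the charts at the unit elements. -/
def evChart (y : EG) (m : M) : 𝔨 :=
  chartAt 𝔨 (1 : K) ((chartAt EG (1 : MapGroup I M 𝔨 K)).symm y m)

variable {L : EG →L[ℝ] 𝔨 × OneForm I M 𝔨} {m₀ : M} {evol : Paths 𝔨 → K}

theorem evChart_one (m : M) :
    evChart I M 𝔨 K (chartAt EG (1 : MapGroup I M 𝔨 K) 1) m = chartAt 𝔨 (1 : K) 1 := by
  rw [evChart, chart_one_symm]
  rfl

theorem IsMapMfd.smAt_ev_chart_symm (h : IsMapMfd L m₀ evol) (m : M) :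
    SmAt ((LCModel.self EG).prod (LCModel.ofCorners I)) (LCModel.self 𝔨)
      (fun q : EG × M => (chartAt EG (1 : MapGroup I M 𝔨 K)).symm q.1 q.2)
      (chartAt EG (1 : MapGroup I M 𝔨 K) 1, m) := by
  have := h.smGrp
  refine SmAt.comp (g := fun p : MapGroup I M 𝔨 K × M => p.1 p.2)
    (f := fun q : EG × M => ((chartAt EG (1 : MapGroup I M 𝔨 K)).symm q.1, q.2))
    (x := (chartAt EG (1 : MapGroup I M 𝔨 K) 1, m)) (h.smAt_ev _) (SmAt.prodMk ?_ (smAt_snd _))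
  exact SmAt.comp (g := (chartAt EG (1 : MapGroup I M 𝔨 K)).symm) (f := fun q : EG × M => q.1)
    (x := (chartAt EG (1 : MapGroup I M 𝔨 K) 1, m)) smAt_chart_one_symm (smAt_fst _)

theorem IsMapMfd.smAt_evChart_uncurry (h : IsMapMfd L m₀ evol) (m : M) :
    SmAt ((LCModel.ofCorners I).prod (LCModel.self EG)) (LCModel.self 𝔨)
      (fun q : M × EG => evChart I M 𝔨 K q.2 q.1) (m, chartAt EG (1 : MapGroup I M 𝔨 K) 1) := by
  have h1 := SmAt.comp (f := fun q : M × EG => (q.2, q.1))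
    (x := (m, chartAt EG (1 : MapGroup I M 𝔨 K) 1)) (h.smAt_ev_chart_symm m)
    ((smAt_snd _).prodMk (smAt_fst _))
  refine h1.chart_one ?_
  simp only [chart_one_symm]
  exact mem_chart_source 𝔨 (1 : K)

theorem IsMapMfd.smAt_evChart (h : IsMapMfd L m₀ evol) (m : M) :
    SmAt (LCModel.self EG) (LCModel.self 𝔨) (fun y => evChart I M 𝔨 K y m)
      (chartAt EG (1 : MapGroup I M 𝔨 K) 1) :=
  SmAt.comp (f := fun y => (m, y)) (h.smAt_evChart_uncurry m)
    ((smAt_const m _).prodMk (smAt_id _))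

theorem IsMapMfd.eventually_mem_source (h : IsMapMfd L m₀ evol) (m : M) :
    ∀ᶠ y in 𝓝 (chartAt EG (1 : MapGroup I M 𝔨 K) 1),
      (chartAt EG (1 : MapGroup I M 𝔨 K)).symm y m ∈ (chartAt 𝔨 (1 : K)).source := by
  have h1 := SmAt.comp (f := fun y => (y, m)) (x := chartAt EG (1 : MapGroup I M 𝔨 K) 1)
    (h.smAt_ev_chart_symm m) ((smAt_id _).prodMk (smAt_const m _))
  refine h1.continuousAt ((chartAt 𝔨 (1 : K)).open_source.mem_nhds ?_)
  simp only [chart_one_symm]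
  exact mem_chart_source 𝔨 (1 : K)

/-- The differential of the evaluation maps at the unit element. -/
theorem IsMapMfd.exists_tangentEval (h : IsMapMfd L m₀ evol) :
    ∃ Ψ : EG →L[ℝ] SmoothFun (LCModel.ofCorners I) M 𝔨, ∀ x m, Ψ x m =
      mdiff (LCModel.self EG) (fun y => evChart I M 𝔨 K y m)
        (chartAt EG (1 : MapGroup I M 𝔨 K) 1) x := by
  set e₀ := chartAt EG (1 : MapGroup I M 𝔨 K) 1
  have hs : ∀ q : EG × M, SmAt ((LCModel.self EG).prod (LCModel.ofCorners I)) (LCModel.self 𝔨)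
      (fun q : EG × M => mdiff (LCModel.self EG) (fun y => evChart I M 𝔨 K y q.2) e₀ q.1) q := by
    rintro ⟨x, m⟩
    exact SmAt.comp (f := fun q : EG × M => (q.2, (e₀, q.1))) (x := (x, m))
      ((h.smAt_evChart_uncurry m).mdiff_param x)
      ((smAt_snd _).prodMk ((smAt_const e₀ _).prodMk (smAt_fst _)))
  let Ψ₀ : EG → SmoothFun (LCModel.ofCorners I) M 𝔨 := fun x =>
    ⟨fun m => mdiff (LCModel.self EG) (fun y => evChart I M 𝔨 K y m) e₀ x, LC.smooth_iff.2 fun m =>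
      SmAt.comp (f := fun m => (x, m)) (hs (x, m)) ((smAt_const x m).prodMk (smAt_id m))⟩
  refine ⟨⟨⟨⟨Ψ₀, fun x y => ?_⟩, fun c x => ?_⟩, ?_⟩, fun x m => rfl⟩
  · exact SmoothFun.ext fun m => mdiff_add_right (h.smAt_evChart m) x y
  · exact SmoothFun.ext fun m => mdiff_smul_right (h.smAt_evChart m) c x
  · refine continuous_iff_continuousAt.2 fun x => ?_
    exact (SmoothFun.smAt_of_uncurry (JN := LCModel.self EG) (G := Ψ₀) isOpen_univ
      (fun n _ m => hs (n, m)) (mem_univ x)).continuousAt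

theorem IsMapMfd.smAt_logForm_chart_symm (h : IsMapMfd L m₀ evol) :
    SmAt (LCModel.self EG) (LCModel.self (OneForm I M 𝔨))
      (fun y => logForm ((chartAt EG (1 : MapGroup I M 𝔨 K)).symm y))
      (chartAt EG (1 : MapGroup I M 𝔨 K) 1) := by
  have := h.smGrp
  exact (h.smAt_iff.1 smAt_chart_one_symm).2

/-- The logarithmic derivative is itself a derivative of evaluations, in the variable of `M`.
Exchanging it with the derivative in direction `x` leaves the derivative of zero. -/
theorem IsMapMfd.mdiff_logForm_eq_zero (h : IsMapMfd L m₀ evol) {x : EG}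
    (hx : ∀ m, mdiff (LCModel.self EG) (fun y => evChart I M 𝔨 K y m)
      (chartAt EG (1 : MapGroup I M 𝔨 K) 1) x = 0) :
    mdiff (LCModel.self EG) (fun y => logForm ((chartAt EG (1 : MapGroup I M 𝔨 K)).symm y))
      (chartAt EG (1 : MapGroup I M 𝔨 K) 1) x = 0 := by
  have := h.smGrp
  refine Subtype.ext (SmoothFun.ext fun v => ?_)
  have h1 := mdiff_clm_comp ((SmoothFun.evalCLM v).comp (OneForm I M 𝔨).subtypeL)
    h.smAt_logForm_chart_symm x
  refine h1.symm.trans ?_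
  set CG := chartAt EG (1 : MapGroup I M 𝔨 K) with hCG
  set CK := chartAt 𝔨 (1 : K) with hCK
  obtain ⟨m, u⟩ := v
  set c := chartAt HM m
  suffices hsuff : ∀ u : EM, mdiff (LCModel.self EG) (fun y => mdiff (LCModel.ofCorners I)
      (fun a => CK ((CG.symm y m)⁻¹ * CG.symm y (c.symm a))) (c m) u) (CG 1) x = 0 from hsuff u
  intro u
  let Q : EG × HM → 𝔨 := fun q => CK ((CG.symm q.1 m)⁻¹ * CG.symm q.1 (c.symm q.2))
  have hcm : c.symm (c m) = m := c.left_inv (mem_chart_source HM m)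
  have hQ : SmAt ((LCModel.self EG).prod (LCModel.ofCorners I)) (LCModel.self 𝔨) Q
      (CG 1, c m) := by
    refine SmAt.log ?_ ?_ ?_
    · exact SmAt.comp (f := fun q : EG × HM => (q.1, m)) (x := (CG 1, c m))
        (h.smAt_ev_chart_symm m) ((smAt_fst _).prodMk (smAt_const m _))
    · refine SmAt.comp (f := fun q : EG × HM => (q.1, c.symm q.2)) (x := (CG 1, c m))
        (h.smAt_ev_chart_symm _) ((smAt_fst _).prodMk ?_)
      exact SmAt.comp (g := c.symm) (f := fun q : EG × HM => q.2) (x := (CG 1, c m))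
        (smAt_chart_symm (chart_mem_atlas HM m) (mem_chart_target HM m)) (smAt_snd _)
    · simp only [hcm]
  refine (mdiff_comm hQ x u).symm.trans ?_
  have hin : ∀ a : HM, mdiff (LCModel.self EG) (fun y => Q (y, a)) (CG 1) x = 0 := by
    intro a
    -- Near the unit, `Q (·, a)` factors through the evaluations at `m` and at `c.symm a`, whose
    -- derivatives in direction `x` vanish.
    let W : 𝔨 × 𝔨 → 𝔨 := fun p => CK ((CK.symm p.1)⁻¹ * CK.symm p.2)
    have hW : SmAt (LCModel.self (𝔨 × 𝔨)) (LCModel.self 𝔨) W (CK 1, CK 1) :=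
      SmAt.log (SmAt.comp (g := CK.symm) (f := fun p : 𝔨 × 𝔨 => p.1) (x := (CK 1, CK 1))
        smAt_chart_one_symm (smAt_clm (ContinuousLinearMap.fst ℝ 𝔨 𝔨) _))
        (SmAt.comp (g := CK.symm) (f := fun p : 𝔨 × 𝔨 => p.2) (x := (CK 1, CK 1))
        smAt_chart_one_symm (smAt_clm (ContinuousLinearMap.snd ℝ 𝔨 𝔨) _)) rfl
    let τ : EG → 𝔨 × 𝔨 := fun y => (evChart I M 𝔨 K y m, evChart I M 𝔨 K y (c.symm a))
    have hτ : SmAt (LCModel.self EG) (LCModel.self (𝔨 × 𝔨)) τ (CG 1) :=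
      (h.smAt_evChart m).prodMk_vec (h.smAt_evChart _)
    have hτ1 : τ (CG 1) = (CK 1, CK 1) := Prod.ext (evChart_one m) (evChart_one _)
    have hW' : SmAt (LCModel.self (𝔨 × 𝔨)) (LCModel.self 𝔨) W (τ (CG 1)) := by rw [hτ1]; exact hW
    have e1 := mdiff_comp (p := W) (τ := τ) hW' hτ x
    have e2 : mdiff (LCModel.self EG) (fun b => (LCModel.self (𝔨 × 𝔨)).toFun (τ b)) (CG 1) x = 0 :=
      (mdiff_prodMk (h.smAt_evChart m) (h.smAt_evChart _) x).trans (Prod.ext (hx m) (hx _))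
    rw [e2, mdiff_zero_right hW'] at e1
    rw [← e1]
    refine (mdiff_congr (SmAt.comp (g := W) (f := τ) hW' hτ) ?_ x).symm
    filter_upwards [h.eventually_mem_source m, h.eventually_mem_source (c.symm a)] with y h2 h3
    simp only [W, τ, Q, evChart]
    rw [CK.left_inv h2, CK.left_inv h3]
  simp only [hin]
  exact mdiff_const 0 _ _

/-- The embedding `L` of the model space is, near the unit, a smooth function of the value at `m₀`
and the logarithmic derivative. Both have derivative zero in direction `x`, so `L x = 0`. -/
theorem IsMapMfd.eq_zero_of_mdiff_evChart (h : IsMapMfd L m₀ evol) {x : EG}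
    (hx : ∀ m, mdiff (LCModel.self EG) (fun y => evChart I M 𝔨 K y m)
      (chartAt EG (1 : MapGroup I M 𝔨 K) 1) x = 0) : x = 0 := by
  have := h.smGrp
  have h0 := h.mdiff_logForm_eq_zero hx
  have hl := h.smAt_logForm_chart_symm
  set CG := chartAt EG (1 : MapGroup I M 𝔨 K) with hCG
  set CK := chartAt 𝔨 (1 : K) with hCK
  obtain ⟨ψ, h1, -, h3, h4⟩ := h.adapted.exists_chart CG (chart_mem_atlas EG _)
  set JZ := (LCModel.self 𝔨).prod (LCModel.self (OneForm I M 𝔨))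
  have hG1 : CG.symm (CG 1) = 1 := chart_one_symm
  -- The adapted chart `ψ` with the component in `K` written in the chart at `1`; `L` agrees with `Z
  -- ∘ τ` near `CG 1`.
  let Z : 𝔨 × OneForm I M 𝔨 → 𝔨 × OneForm I M 𝔨 := fun q => JZ.toFun (ψ (CK.symm q.1, q.2))
  let τ : EG → 𝔨 × OneForm I M 𝔨 := fun y => (evChart I M 𝔨 K y m₀, logForm (CG.symm y))
  have hτ : SmAt (LCModel.self EG) (LCModel.self (𝔨 × OneForm I M 𝔨)) τ (CG 1) :=
    (h.smAt_evChart m₀).prodMk_vec hl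
  have hZ : SmAt (LCModel.self (𝔨 × OneForm I M 𝔨)) (LCModel.self (𝔨 × OneForm I M 𝔨)) Z
      (τ (CG 1)) := by
    refine SmAt.comp (g := JZ.toFun) (f := fun q => ψ (CK.symm q.1, q.2)) (x := τ (CG 1))
      (smAt_toFun _) ?_
    refine SmAt.comp (g := ψ) (J' := JZ)
      (f := fun q : 𝔨 × OneForm I M 𝔨 => ((CK.symm q.1, q.2) : K × OneForm I M 𝔨))
      (x := τ (CG 1)) (h1 _ ?_) (SmAt.prodMk ?_
        (smAt_clm (ContinuousLinearMap.snd ℝ 𝔨 (OneForm I M 𝔨)) _))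
    · have h5 : (1 : MapGroup I M 𝔨 K) ∈ CG.source := mem_chart_source EG _
      rw [h3] at h5
      have h6 : CK.symm (τ (CG 1)).1 = 1 := by
        simp only [τ]
        rw [evChart_one]
        exact chart_one_symm
      rw [h6]
      simp only [τ]
      rw [hG1]
      exact h5
    · refine SmAt.comp (g := CK.symm) (f := fun q : 𝔨 × OneForm I M 𝔨 => q.1) (x := τ (CG 1)) ?_
        (smAt_clm (ContinuousLinearMap.fst ℝ 𝔨 (OneForm I M 𝔨)) _)
      simp only [τ]
      rw [evChart_one]
      exact smAt_chart_one_symm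
  have e1 := mdiff_comp (p := Z) (τ := τ) hZ hτ x
  have e2 : mdiff (LCModel.self EG) (fun b => (LCModel.self (𝔨 × OneForm I M 𝔨)).toFun (τ b))
      (CG 1) x = 0 :=
    (mdiff_prodMk (h.smAt_evChart m₀) hl x).trans (Prod.ext (hx m₀) h0)
  rw [e2, mdiff_zero_right hZ] at e1
  have e3 : mdiff (LCModel.self EG) L (CG 1) x = 0 := by
    rw [← e1]
    refine mdiff_congr (smAt_clm L _) ?_ x
    filter_upwards [h.eventually_mem_source m₀, CG.open_target.mem_nhds (mem_chart_target EG _)]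
      with y h5 h6
    have h7 := h4 _ (CG.map_target h6)
    rw [CG.right_inv h6] at h7
    rw [h7]
    simp only [Z, τ, evChart]
    rw [CK.left_inv h5]
  rw [mdiff_clm] at e3
  exact h.adapted.closedEmbedding.injective (e3.trans (map_zero L).symm)

/-- The pointwise exponential map. -/
def IsEvol.expMap (h : IsEvol evol) (f : SmoothFun (LCModel.ofCorners I) M 𝔨) :
    MapGroup I M 𝔨 K :=
  ⟨fun m => evol (constPath (f m)), LC.smooth_iff.2 fun m =>
    SmAt.comp (g := fun x => evol (constPath x)) (h.smAt_exp _) (Smooth.smAt f.2 m)⟩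

theorem IsMapMfd.smAt_expMap (h : IsMapMfd L m₀ evol)
    (f : SmoothFun (LCModel.ofCorners I) M 𝔨) :
    SmAt (LCModel.self (SmoothFun (LCModel.ofCorners I) M 𝔨)) (LCModel.self EG)
      h.isEvol.expMap f := by
  have := locallyCompactSpace_of_finiteDimensional EM
  refine h.smAt_curry ?_ f
  rintro ⟨f, m⟩
  exact SmAt.comp (g := fun x => evol (constPath x))
    (f := fun p : SmoothFun (LCModel.ofCorners I) M 𝔨 × M => p.1 p.2) (x := (f, m))
    (h.isEvol.smAt_exp _) (SmoothFun.smAt_eval f m)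

/-- The Lie algebra of `C^∞(M,K)` is `C^∞(M,𝔨)`. -/
theorem IsMapMfd.exists_lieAlgebra_equiv (h : IsMapMfd L m₀ evol) :
    ∃ Ψ : EG ≃L[ℝ] SmoothFun (LCModel.ofCorners I) M 𝔨, ∀ x m, Ψ x m =
      mdiff (LCModel.self EG) (fun y => evChart I M 𝔨 K y m)
        (chartAt EG (1 : MapGroup I M 𝔨 K) 1) x := by
  have := h.smGrp
  obtain ⟨Ψ, hΨ⟩ := h.exists_tangentEval
  set CG := chartAt EG (1 : MapGroup I M 𝔨 K) with hCG
  set SF := SmoothFun (LCModel.ofCorners I) M 𝔨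
  have hexp0 : h.isEvol.expMap (0 : SF) = 1 :=
    SmoothMap.ext (funext fun m => h.isEvol.exp_zero)
  have hρ : SmAt (LCModel.self SF) (LCModel.self EG) (fun f : SF => CG (h.isEvol.expMap f)) 0 :=
    (h.smAt_expMap 0).chart_one (by rw [hexp0]; exact mem_chart_source EG _)
  -- By the chain rule, the differential of `f ↦ evol (constPath (f m))` at `0` appears, and the
  -- exponential map has identity differential at `0`.
  have hright : ∀ f : SF, Ψ (hρ.mdiffCLM f) = f := by
    intro f
    refine SmoothFun.ext fun m => ?_
    rw [hΨ]
    change mdiff (LCModel.self EG) (fun y => evChart I M 𝔨 K y m) (CG 1)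
      (mdiff (LCModel.self SF) (fun f : SF => CG (h.isEvol.expMap f)) 0 f) = f m
    have hev : SmAt (LCModel.self EG) (LCModel.self 𝔨) (fun y => evChart I M 𝔨 K y m)
        (CG (h.isEvol.expMap (0 : SF))) := by
      rw [hexp0]
      exact h.smAt_evChart m
    have e1 := mdiff_comp (p := fun y => evChart I M 𝔨 K y m)
      (τ := fun f : SF => CG (h.isEvol.expMap f)) (a := 0) hev hρ f
    rw [hexp0] at e1
    refine e1.symm.trans ?_
    have hE : SmAt (LCModel.self 𝔨) (LCModel.self 𝔨)
        (fun y => chartAt 𝔨 (1 : K) (evol (constPath y))) ((0 : SF) m) := by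
      rw [SmoothFun.zero_apply]
      exact (h.isEvol.smAt_exp 0).chart_one (by rw [h.isEvol.exp_zero]; exact mem_chart_source 𝔨 1)
    have e2 := mdiff_comp (p := fun y => chartAt 𝔨 (1 : K) (evol (constPath y)))
      (τ := fun f : SF => f m) (a := 0) hE (smAt_clm (SmoothFun.evalCLM m) 0) f
    rw [SmoothFun.zero_apply, h.isEvol.mdiff_exp] at e2
    refine Eq.trans ?_ (e2.trans (mdiff_clm (SmoothFun.evalCLM m) 0 f))
    refine mdiff_congr (SmAt.comp (f := fun f : SF => CG (h.isEvol.expMap f)) (x := 0) hev hρ) ?_ f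
    have hc := (h.smAt_expMap (0 : SF)).continuousAt
    filter_upwards [hc (CG.open_source.mem_nhds (by rw [hexp0]; exact mem_chart_source EG _))]
      with f' hf'
    simp only [evChart]
    rw [← hCG, CG.left_inv hf']
    rfl
  have hinj : Function.Injective Ψ := by
    refine (injective_iff_map_eq_zero Ψ).2 fun x hx => h.eq_zero_of_mdiff_evChart fun m => ?_
    rw [← hΨ, hx, SmoothFun.zero_apply]
  -- For the injective map `Ψ` a right inverse is also a left inverse, and it is continuous as the
  -- differential of a smooth map.
  exact ⟨ContinuousLinearEquiv.equivOfInverse Ψ hρ.mdiffCLM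
    (fun x => hinj (hright (Ψ x))) hright, hΨ⟩

theorem IsMapMfd.compatibleWithEvaluations (h : IsMapMfd L m₀ evol) :
    CompatibleWithEvaluations I M 𝔨 K EG (MapGroup I M 𝔨 K) (fun f => f) := by
  have := h.smGrp
  refine ⟨fun m => LC.smooth_iff.2 (h.smAt_evalHom m), ?_⟩
  obtain ⟨Ψ, hΨ⟩ := h.exists_lieAlgebra_equiv
  refine ⟨Ψ, fun x m => ?_, fun x y m => ?_⟩
  · rw [hΨ]
    exact hasDirDeriv_mdiff (h.smAt_evChart m) x
  · exact mdiff_lieBracket (evalHom m) (h.smAt_evalHom m) (T := fun x => Ψ x m)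
      (fun x => hΨ x m) x y

end LieAlgebra

/-! ### Regularity of `C^∞(M,K)`. -/

section Regularity

theorem smAt_mul_unitInterval (p : Icc (0 : ℝ) 1 × Icc (0 : ℝ) 1) :
    SmAt (LCModel.unitInterval.prod LCModel.unitInterval) LCModel.unitInterval
      (fun p : Icc (0 : ℝ) 1 × Icc (0 : ℝ) 1 => p.1 * p.2) p := by
  refine smAt_of_toFun_comp ?_
  have a1 : SmAt (LCModel.unitInterval.prod LCModel.unitInterval) (LCModel.self ℝ)
      (fun p : Icc (0 : ℝ) 1 × Icc (0 : ℝ) 1 => (p.1 : ℝ)) p :=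
    SmAt.comp (g := LCModel.unitInterval.toFun)
      (f := fun p : Icc (0 : ℝ) 1 × Icc (0 : ℝ) 1 => p.1) (smAt_toFun _) (smAt_fst _)
  have a2 : SmAt (LCModel.unitInterval.prod LCModel.unitInterval) (LCModel.self ℝ)
      (fun p : Icc (0 : ℝ) 1 × Icc (0 : ℝ) 1 => (p.2 : ℝ)) p :=
    SmAt.comp (g := LCModel.unitInterval.toFun)
      (f := fun p : Icc (0 : ℝ) 1 × Icc (0 : ℝ) 1 => p.2) (smAt_toFun _) (smAt_snd _)
  exact a1.smul a2

variable {EM : Type*} [NormedAddCommGroup EM] [NormedSpace ℝ EM] [FiniteDimensional ℝ EM]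
  {HM : Type*} [TopologicalSpace HM] {I : ModelWithCorners ℝ EM HM}
  {M : Type*} [TopologicalSpace M] [ChartedSpace HM M] [IsManifold I ∞ M] [ConnectedSpace M]
  {𝔨 : Type*} [AddCommGroup 𝔨] [Module ℝ 𝔨] [TopologicalSpace 𝔨] [IsLCS 𝔨]
  {K : Type*} [Group K] [TopologicalSpace K] [ChartedSpace 𝔨 K] [SmGrp 𝔨 K]
  {EG : Type*} [AddCommGroup EG] [Module ℝ EG] [TopologicalSpace EG] [IsLCS EG]

/-- Evaluation of paths and of functions on `M` is smooth, as `[0,1]` and `M` have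
finite-dimensional models. The factor `t` belongs to the rescaling that expresses time `t` by time
`1`. -/
theorem smAt_pathIntegrand (Ψ : EG →L[ℝ] SmoothFun (LCModel.ofCorners I) M 𝔨)
    (p : ((Paths EG × Icc (0 : ℝ) 1) × M) × Icc (0 : ℝ) 1) :
    SmAt ((((LCModel.self (Paths EG)).prod LCModel.unitInterval).prod
      (LCModel.ofCorners I)).prod LCModel.unitInterval) (LCModel.self 𝔨)
      (fun p : ((Paths EG × Icc (0 : ℝ) 1) × M) × Icc (0 : ℝ) 1 =>
        (p.1.1.2 : ℝ) • Ψ (p.1.1.1 (p.1.1.2 * p.2)) p.1.2) p := by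
  have := locallyCompactSpace_of_finiteDimensional EM
  set JJ := (((LCModel.self (Paths EG)).prod LCModel.unitInterval).prod
      (LCModel.ofCorners I)).prod LCModel.unitInterval
  have a1 : SmAt JJ (((LCModel.self (Paths EG)).prod LCModel.unitInterval).prod
      (LCModel.ofCorners I)) (fun p : ((Paths EG × Icc (0 : ℝ) 1) × M) × Icc (0 : ℝ) 1 => p.1) p :=
    smAt_fst _
  have a2 : SmAt JJ ((LCModel.self (Paths EG)).prod LCModel.unitInterval)
      (fun p : ((Paths EG × Icc (0 : ℝ) 1) × M) × Icc (0 : ℝ) 1 => p.1.1) p :=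
    SmAt.comp (g := fun p : (Paths EG × Icc (0 : ℝ) 1) × M => p.1) (smAt_fst _) a1
  have a3 : SmAt JJ (LCModel.ofCorners I)
      (fun p : ((Paths EG × Icc (0 : ℝ) 1) × M) × Icc (0 : ℝ) 1 => p.1.2) p :=
    SmAt.comp (g := fun p : (Paths EG × Icc (0 : ℝ) 1) × M => p.2) (smAt_snd _) a1
  have a4 : SmAt JJ (LCModel.self (Paths EG))
      (fun p : ((Paths EG × Icc (0 : ℝ) 1) × M) × Icc (0 : ℝ) 1 => p.1.1.1) p :=
    SmAt.comp (g := fun p : Paths EG × Icc (0 : ℝ) 1 => p.1) (smAt_fst _) a2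
  have a5 : SmAt JJ LCModel.unitInterval
      (fun p : ((Paths EG × Icc (0 : ℝ) 1) × M) × Icc (0 : ℝ) 1 => p.1.1.2) p :=
    SmAt.comp (g := fun p : Paths EG × Icc (0 : ℝ) 1 => p.2) (smAt_snd _) a2
  have a6 : SmAt JJ LCModel.unitInterval
      (fun p : ((Paths EG × Icc (0 : ℝ) 1) × M) × Icc (0 : ℝ) 1 => p.1.1.2 * p.2) p :=
    SmAt.comp (g := fun p : Icc (0 : ℝ) 1 × Icc (0 : ℝ) 1 => p.1 * p.2)
      (smAt_mul_unitInterval _) (a5.prodMk (smAt_snd _))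
  have a7 : SmAt JJ (LCModel.self ℝ)
      (fun p : ((Paths EG × Icc (0 : ℝ) 1) × M) × Icc (0 : ℝ) 1 => (p.1.1.2 : ℝ)) p :=
    SmAt.comp (g := LCModel.unitInterval.toFun)
      (f := fun p : ((Paths EG × Icc (0 : ℝ) 1) × M) × Icc (0 : ℝ) 1 => p.1.1.2) (smAt_toFun _) a5
  exact a7.smul (((a4.eval a6).clm_comp Ψ).eval a3)

variable [TopologicalSpace (MapGroup I M 𝔨 K)] [ChartedSpace EG (MapGroup I M 𝔨 K)]
  {L : EG →L[ℝ] 𝔨 × OneForm I M 𝔨} {m₀ : M} {evol : Paths 𝔨 → K}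

/-- A smooth curve in `C^∞(M,K)` has some logarithmic derivative, which is determined by its
evaluations since `Ψ` is injective. -/
theorem IsMapMfd.isEvolution_of_eval (h : IsMapMfd L m₀ evol)
    {Ψ : EG ≃L[ℝ] SmoothFun (LCModel.ofCorners I) M 𝔨}
    (hΨ : ∀ x m, Ψ x m = mdiff (LCModel.self EG) (fun y => evChart I M 𝔨 K y m)
        (chartAt EG (1 : MapGroup I M 𝔨 K) 1) x)
    {γ : Icc (0 : ℝ) 1 → MapGroup I M 𝔨 K}
    (hγ : ∀ t, SmAt LCModel.unitInterval (LCModel.self EG) γ t) {ξ : Icc (0 : ℝ) 1 → EG}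
    (hev : ∀ m, IsEvolution (fun t => Ψ (ξ t) m) (fun t => γ t m)) : IsEvolution ξ γ := by
  have := h.smGrp
  intro t
  set CG := chartAt EG (1 : MapGroup I M 𝔨 K) with hCG
  have h1 : (1 : MapGroup I M 𝔨 K) ∈ CG.source := mem_chart_source EG _
  let σ : Icc (0 : ℝ) 1 → EG := fun s => CG ((γ t)⁻¹ * γ s)
  have hσ : SmAt LCModel.unitInterval (LCModel.self EG) σ t :=
    SmAt.log (smAt_const (γ t) t) (hγ t) rfl
  have hσ1 : σ t = CG 1 := by simp only [σ, inv_mul_cancel]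
  have hlim := tendsto_mdiff hσ (l := 𝓝[≠] t) (t := fun s : Icc (0 : ℝ) 1 => (s : ℝ) - t)
    (y := fun s => s) (u := 1) (tendsto_sub_unitInterval t) (eventually_sub_ne_zero t) (by
      refine Tendsto.congr' (f₁ := fun _ => (1 : ℝ)) ?_ tendsto_const_nhds
      filter_upwards [eventually_sub_ne_zero t] with s hs
      exact (inv_mul_cancel₀ hs).symm)
  rw [hσ1] at hlim
  suffices hw : mdiff LCModel.unitInterval σ t 1 = ξ t by rwa [hw] at hlim
  apply Ψ.injective
  refine SmoothFun.ext fun m => ?_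
  rw [hΨ]
  have h2 := tendsto_mdiff (h.smAt_evChart m) (y := σ) (tendsto_sub_unitInterval t)
    (eventually_sub_ne_zero t) hlim
  refine tendsto_nhds_unique h2 ((hev m t).congr' ?_)
  have hmem : ∀ᶠ s in 𝓝[≠] t, (γ t)⁻¹ * γ s ∈ CG.source := by
    have hc := ((smAt_const (J := LCModel.unitInterval) (J' := LCModel.self EG) (γ t) t).inv.mul
      (hγ t)).continuousAt
    have hs : CG.source ∈ 𝓝 ((γ t)⁻¹ * γ t) := by
      rw [inv_mul_cancel]
      exact CG.open_source.mem_nhds h1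
    exact nhdsWithin_le_nhds (hc hs)
  filter_upwards [hmem] with s hs
  rw [← hCG, evChart_one]
  have h3 : CG.symm (σ s) = (γ t)⁻¹ * γ s := CG.left_inv hs
  simp only [evChart]
  rw [← hCG, h3]
  rfl

/-- The group `C^∞(M,K)` is regular. -/
theorem IsMapMfd.isRegularGrp (h : IsMapMfd L m₀ evol) : IsRegularGrp EG (MapGroup I M 𝔨 K) := by
  have := h.smGrp
  obtain ⟨Ψ, hΨ⟩ := h.exists_lieAlgebra_equiv
  have hint := smAt_pathIntegrand (Ψ : EG →L[ℝ] SmoothFun (LCModel.ofCorners I) M 𝔨)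
  -- For `q = ((ξ, t), m)`, the time-one evolution of this path is the evolution of `s ↦ Ψ (ξ s) m`
  -- at time `t`.
  let path : (Paths EG × Icc (0 : ℝ) 1) × M → Paths 𝔨 := fun q =>
    ⟨fun s => (q.1.2 : ℝ) • Ψ (q.1.1 (q.1.2 * s)) q.2, LC.smooth_iff.2 fun s =>
      SmAt.comp (f := fun s => (q, s)) (hint (q, s)) ((smAt_const q s).prodMk (smAt_id s))⟩
  have hpath : ∀ q, SmAt (((LCModel.self (Paths EG)).prod LCModel.unitInterval).prod
      (LCModel.ofCorners I)) (LCModel.self (Paths 𝔨)) path q := fun q =>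
    SmoothFun.smAt_of_uncurry isOpen_univ (fun q _ s => hint (q, s)) (mem_univ q)
  have hΓ : ∀ q, SmAt (((LCModel.self (Paths EG)).prod LCModel.unitInterval).prod
      (LCModel.ofCorners I)) (LCModel.self 𝔨) (fun q => evol (path q)) q := fun q =>
    SmAt.comp (g := evol) (h.isEvol.smAt _) (hpath q)
  let Γ : Paths EG × Icc (0 : ℝ) 1 → MapGroup I M 𝔨 K := fun p =>
    ⟨fun m => evol (path (p, m)), LC.smooth_iff.2 fun m => SmAt.slice (hΓ (p, m))⟩
  have hΓs : ∀ p, SmAt ((LCModel.self (Paths EG)).prod LCModel.unitInterval) (LCModel.self EG) Γ p :=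
    h.smAt_curry hΓ
  refine ⟨fun ξ => Γ (ξ, 1), LC.smooth_iff.2 fun ξ => ?_, fun ξ => ⟨fun t => Γ (ξ, t), ?_, ?_, ?_,
    rfl⟩⟩
  · exact SmAt.comp (g := Γ) (f := fun ξ => (ξ, (1 : Icc (0 : ℝ) 1))) (hΓs _)
      ((smAt_id ξ).prodMk (smAt_const 1 ξ))
  · exact LC.smooth_iff.2 fun t => SmAt.comp (g := Γ) (f := fun t => (ξ, t)) (hΓs _)
      ((smAt_const ξ t).prodMk (smAt_id t))
  · refine SmoothMap.ext (funext fun m => ?_)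
    change evol (path ((ξ, 0), m)) = 1
    have : path ((ξ, 0), m) = constPath 0 := SmoothFun.ext fun s => by simp [path, constPath]
    rw [this, h.isEvol.exp_zero]
  · refine h.isEvolution_of_eval hΨ (fun t => SmAt.comp (g := Γ) (f := fun t => (ξ, t)) (hΓs _)
      ((smAt_const ξ t).prodMk (smAt_id t))) fun m => ?_
    -- With `t = 1` the path is the unscaled one; its curve `γ` coincides with `t ↦ Γ (ξ, t) m`.
    obtain ⟨γ, h1, h2, h3, -⟩ := h.isEvol.exists_curve (path ((ξ, 1), m))
    have h4 : ∀ t, Γ (ξ, t) m = γ t := fun t =>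
      h.isEvol.eq_of_reparam h1 h2 h3 t fun s => by simp [path]
    simp only [h4]
    convert h3 using 1
    funext t
    simp [path]

end Regularity

/-! ### The bijections defining the manifold structures. -/

section Based

variable {EM : Type*} [NormedAddCommGroup EM] [NormedSpace ℝ EM]
  {HM : Type*} [TopologicalSpace HM] (I : ModelWithCorners ℝ EM HM)
  {M : Type*} [TopologicalSpace M] [ChartedSpace HM M] [IsManifold I ∞ M] (m₀ : M)
  {𝔨 : Type*} [AddCommGroup 𝔨] [Module ℝ 𝔨] [TopologicalSpace 𝔨] [IsLCS 𝔨]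
  {K : Type*} [Group K] [TopologicalSpace K] [ChartedSpace 𝔨 K] [SmGrp 𝔨 K]

variable (𝔨 K) in
/-- The logarithmic derivative as a bijection onto its image. -/
def logEquiv [ConnectedSpace M] : BasedMap I 𝔨 K m₀ ≃ leftLogDerivImage I 𝔨 K m₀ :=
  Equiv.ofBijective (fun f => ⟨logForm f.1, f, fun _ => rfl⟩) (by
    constructor
    · intro f g h
      exact Subtype.ext (logForm_injective (f.2.trans g.2.symm) (congrArg Subtype.val h))
    · rintro ⟨α, f, hf⟩
      exact ⟨f, Subtype.ext (Subtype.ext (SmoothFun.ext fun v => (hf v).symm))⟩)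

variable (𝔨 K) in
/-- The decomposition of `C^∞(M,K)` into values in `m₀` and based maps. -/
def splitEquiv : MapGroup I M 𝔨 K ≃ K × BasedMap I 𝔨 K m₀ where
  toFun f := (f m₀, ⟨⟨fun m => (f m₀)⁻¹ * f m, smooth_iff.2 fun m =>
    (smAt_const _ m).mul (f.smooth.smAt m)⟩, inv_mul_cancel (f m₀)⟩)
  invFun p := ⟨fun m => p.1 * p.2.1 m, smooth_iff.2 fun m =>
    (smAt_const _ m).mul (p.2.1.smooth.smAt m)⟩
  left_inv f := SmoothMap.ext (funext fun m => mul_inv_cancel_left (f m₀) (f m))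
  right_inv p := by
    obtain ⟨k, f, hf⟩ := p
    refine Prod.ext ?_ (Subtype.ext (SmoothMap.ext (funext fun m => ?_)))
    · change k * f m₀ = k
      rw [hf, mul_one]
    · change (k * f m₀)⁻¹ * (k * f m) = f m
      rw [hf, mul_one, inv_mul_cancel_left]

/-- Conjugation of based maps by elements of `K`. -/
def conjBased (p : K × BasedMap I 𝔨 K m₀) : BasedMap I 𝔨 K m₀ :=
  ⟨⟨fun m => p.1 * p.2.1 m * p.1⁻¹, smooth_iff.2 fun m =>
    ((smAt_const _ m).mul (p.2.1.smooth.smAt m)).mul (smAt_const _ m)⟩, by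
    change p.1 * p.2.1 m₀ * p.1⁻¹ = 1
    rw [p.2.2, mul_one, mul_inv_cancel]⟩

end Based

end LC

end

/-! ### The main theorem. -/

theorem mainTheorem2
    -- a connected finite-dimensional manifold `M`, possibly with boundary, with a base point
    {EM : Type*} [NormedAddCommGroup EM] [NormedSpace ℝ EM] [FiniteDimensional ℝ EM]
    {HM : Type*} [TopologicalSpace HM] (I : ModelWithCorners ℝ EM HM)
    {M : Type*} [TopologicalSpace M] [T2Space M] [ConnectedSpace M] [ChartedSpace HM M]
    [IsManifold I ∞ M] (m₀ : M)
    -- a regular Lie group `K` with Lie algebra `𝔨`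
    {𝔨 : Type*} [AddCommGroup 𝔨] [Module ℝ 𝔨] [TopologicalSpace 𝔨] [IsLCS 𝔨]
    {K : Type*} [Group K] [TopologicalSpace K] [ChartedSpace 𝔨 K]
    (hK : IsLieGrp 𝔨 K) (hreg : IsRegularGrp 𝔨 K)
    -- `δ(C^∞_*(M,K))` is a submanifold of `Ω^1(M,𝔨)`
    (F : Submodule ℝ (OneForm I M 𝔨)) (hF : IsSubmanifold (leftLogDerivImage I 𝔨 K m₀) F) :
    -- `C^∞(M,K)` is a group under pointwise multiplication,
    ∃ (grp : Group (MapGroup I M 𝔨 K)),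
      (∀ (f g : MapGroup I M 𝔨 K) (m : M), (f * g) m = f m * g m) ∧
    -- `δ` is a bijection of `C^∞_*(M,K)` onto its image,
    ∃ (δ : BasedMap I 𝔨 K m₀ ≃ leftLogDerivImage I 𝔨 K m₀),
      (∀ (f : BasedMap I 𝔨 K m₀) (v : TangentBundle I M),
        (δ f).1.1 v = leftLogDeriv I 𝔨 f.1 v) ∧
    -- and `C^∞(M,K) ≅ K ⋉ C^∞_*(M,K)`.
    ∃ (Φ : MapGroup I M 𝔨 K ≃ K × BasedMap I 𝔨 K m₀),
      (∀ f : MapGroup I M 𝔨 K,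
        (Φ f).1 = f m₀ ∧ ∀ m : M, (Φ f).2.1 m = (f m₀)⁻¹ * f m) ∧
    -- With the manifold structures for which `δ` and this bijection are diffeomorphisms,
    letI : ChartedSpace F (leftLogDerivImage I 𝔨 K m₀) := hF.chartedSpace
    letI : TopologicalSpace (BasedMap I 𝔨 K m₀) := TopologicalSpace.induced δ inferInstance
    letI : ChartedSpace F (BasedMap I 𝔨 K m₀) := transportCharts δ
    letI : ChartedSpace (𝔨 × F) (K × BasedMap I 𝔨 K m₀) :=
      prodCharts 𝔨 F K (BasedMap I 𝔨 K m₀)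
    letI : TopologicalSpace (MapGroup I M 𝔨 K) := TopologicalSpace.induced Φ inferInstance
    letI : ChartedSpace (𝔨 × F) (MapGroup I M 𝔨 K) := transportCharts Φ
    -- (1) smoothness of maps `N × M → K`,
    (∀ {EN : Type*} [AddCommGroup EN] [Module ℝ EN] [TopologicalSpace EN] [IsLCS EN]
        {HN : Type*} [TopologicalSpace HN] (J : LCModel EN HN)
        {N : Type*} [TopologicalSpace N] [ChartedSpace HN N] (_ : IsMfd J N) (f : N × M → K),
      Smooth (J.prod (LCModel.ofCorners I)) (LCModel.self 𝔨) f ↔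
        ∃ h : ∀ n, Smooth (LCModel.ofCorners I) (LCModel.self 𝔨) (fun m => f (n, m)),
          Smooth J (LCModel.self (𝔨 × F)) (fun n => (⟨fun m => f (n, m), h n⟩ :
            MapGroup I M 𝔨 K))) ∧
    -- (2) `K` acts smoothly by conjugation on `C^∞_*(M,K)`,
    (∃ c : K × BasedMap I 𝔨 K m₀ → BasedMap I 𝔨 K m₀,
      (∀ k f m, (c (k, f)).1 m = k * f.1 m * k⁻¹) ∧
      Smooth ((LCModel.self 𝔨).prod (LCModel.self F)) (LCModel.self F) c) ∧
    -- and `C^∞(M,K)` is a regular Lie group, compatible with evaluations.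
    ∃ _ : IsLCS (𝔨 × F),
      IsLieGrp (𝔨 × F) (MapGroup I M 𝔨 K) ∧ IsRegularGrp (𝔨 × F) (MapGroup I M 𝔨 K) ∧
      CompatibleWithEvaluations I M 𝔨 K (𝔨 × F) (MapGroup I M 𝔨 K) (fun f => f) := by
  have hgrp : SmGrp 𝔨 K := hK.smGrp
  have ht2 : T2Space K := hK.isMfd.t2
  obtain ⟨evol, hevol⟩ := hreg.exists_isEvol
  let δ := logEquiv I m₀ 𝔨 K
  let Φ := splitEquiv I m₀ 𝔨 K
  refine ⟨instGroupMapGroup, fun f g m => rfl, δ, fun f v => rfl, Φ, fun f => ⟨rfl, fun m => rfl⟩,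
    ?_⟩
  let _ : ChartedSpace F (leftLogDerivImage I 𝔨 K m₀) := hF.chartedSpace
  let _ : TopologicalSpace (BasedMap I 𝔨 K m₀) := TopologicalSpace.induced δ inferInstance
  let _ : ChartedSpace F (BasedMap I 𝔨 K m₀) := transportCharts δ
  let _ : ChartedSpace (𝔨 × F) (K × BasedMap I 𝔨 K m₀) := prodCharts 𝔨 F K (BasedMap I 𝔨 K m₀)
  let _ : TopologicalSpace (MapGroup I M 𝔨 K) := TopologicalSpace.induced Φ inferInstance
  let _ : ChartedSpace (𝔨 × F) (MapGroup I M 𝔨 K) := transportCharts Φ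
  have hB : IsAdaptedAtlas (LCModel.self (OneForm I M 𝔨)) F.subtypeL
      (fun b : BasedMap I 𝔨 K m₀ => logForm b.1) := isAdaptedAtlas_transport hF δ
  have hG : IsAdaptedAtlas ((LCModel.self 𝔨).prod (LCModel.self (OneForm I M 𝔨)))
      ((ContinuousLinearMap.id ℝ 𝔨).prodMap F.subtypeL)
      (fun g : MapGroup I M 𝔨 K => (g m₀, logForm g)) := by
    have h := isAdaptedAtlas_prod (𝔨 := 𝔨) hB Φ
    -- The based part of `g` is `(g m₀)⁻¹ * g`, which has the same logarithmic derivative as `g`.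
    have he : (fun g : MapGroup I M 𝔨 K => (g m₀, logForm g)) =
        fun g => ((Φ g).1, logForm (Φ g).2.1) := by
      funext g
      exact Prod.ext rfl (logForm_mul_left (g m₀)⁻¹ g _ fun m => rfl).symm
    rw [he]
    exact h
  have h : IsMapMfd ((ContinuousLinearMap.id ℝ 𝔨).prodMap F.subtypeL) m₀ evol := ⟨hG, hevol⟩
  have hconj := smooth_conj (b := fun b : BasedMap I 𝔨 K m₀ => b.1) (fun b => b.2) hB
    hevol (c := conjBased I m₀) fun p m => rfl
  have hL := h.isLieGrp
  have hR := h.isRegularGrp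
  have hC := h.compatibleWithEvaluations
  refine ⟨?_, ⟨conjBased I m₀, ?_, ?_⟩, inferInstance, ?_, ?_, ?_⟩
  · intro EN _ _ _ _ HN _ J N _ _ hN f
    have : Compat J N := ⟨hN.compatible⟩
    exact h.smooth_iff f
  · exact fun k f m => rfl
  · exact hconj
  · exact hL
  · exact hR
  · exact hC
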